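/- Let $n\ge 1$, let $\mathfrak g=\mathfrak{so}_{2n+1}(\mathbb C)$ be the Lie algebra of type $B_n$ with simple roots $\alpha_1,\dots,\alpha_n$ ($\alpha_n$ short), fundamental weights $\omega_1,\dots,\omega_n$, highest root $\theta$ and triangular decomposition $\mathfrak g=\mathfrak n^-\oplus\mathfrak h\oplus\mathfrak n^+$. The positive roots are $$\alpha_{p,q}=\alpha_p+\dots+\alpha_q\ (1\le p\le q\le n),\qquad \alpha_{p,q}=\alpha_p+\dots+\alpha_{2n-q}+2\alpha_{2n-q+1}+\dots+2\alpha_n\ (1\le p\le 2n-q<n).$$ For every $\beta\in R^+$ fix a non-zero root vector $x_{-\beta}\in\mathfrak g_{-\beta}$. For a multi-exponent $\mathbf s=(s_\beta)_{\beta\in R^+}\in\mathbb Z_{\ge0}^{R^+}$ put $X^{\mathbf s}=\prod_\beta x_{-\beta}^{s_\beta}\in S(\mathfrak n^-)=\mathbb C[x_{-\beta}\mid\beta\in R^+]$. Fix $1\le i\le n$ and $m\in\mathbb Z_{\ge 0}$. Let $R_i^+=\{\alpha_{p,q}\in R^+\mid p\le i\le q\}$ be the set of positive roots in which $\alpha_i$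 occurs. Let $V(m\omega_i)$ be the irreducible finite-dimensional $\mathfrak g$-module of highest weight $m\omega_i$ with highest weight vector $v$. Let $V_s$ be the span of all $y_1\cdots y_l v$ with $l\le s$ and $y_j\in\mathfrak n^-$ ($V_{-1}=0$), and let $\operatorname{gr}V(m\omega_i)=\bigoplus_{s\ge0}V_s/V_{s-1}$ with the induced structure of an $S(\mathfrak n^-)$-module. Let $\mathbf I_{m\omega_i}\subseteq S(\mathfrak n^-)$ be the annihilator of the class of $v$ in $V_0/V_{-1}$, so that $\operatorname{gr}V(m\omega_i)\cong S(\mathfrak n^-)/\mathbf I_{m\omega_i}$. *Dyck paths.* A path from $\beta$ to $\gamma$ is a set $\{\beta(1),\dots,\beta(k)\}$ ($k\ge1$) of positive roots with $\beta(1)=\beta$, $\beta(k)=\gamma$ such that $\beta(r)=\alpha_{p,q}$ implies $\beta(r+1)\in\{\alpha_{p,q+1},\alpha_{p+1,q}\}$ for $1\le r<k$. A Dyck path of type 1 is a path from $\alpha_{1,i}$ to $\alpha_{i,2n-i-1}$ or from $\alpha_{1,i+1}$ to $\alpha_{i,2n-i}$. A Dyck path of type 2 (a double Dyck path) is a union $\mathbf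 p_1\cup\mathbf p_2$ of two disjoint paths, $\mathbf p_1$ from $\alpha_{1,i}$ to $\alpha_{j,2n-j}$ and $\mathbf p_2$ from $\alpha_{2,i}$ to $\alpha_{j+1,2n-j-1}$, for some $1\le j<i$. Let $\mathbf D$ be the set of all Dyck paths of type 1 or 2. Put $M_{\mathbf p}(m\omega_i)=m$ if $\mathbf p$ is of type 1 and $M_{\mathbf p}(m\omega_i)=m\,\omega_i(\theta^\vee)$ if $\mathbf p$ is of type 2. Let $S(\mathbf D,m\omega_i)$ be the set of integral points of the polytope of all $\mathbf s\in\mathbb R_{\ge0}^{R^+}$ such that $s_\beta=0$ for $\beta\notin R_i^+$ and $\sum_{\beta\in\mathbf p}s_\beta\le M_{\mathbf p}(m\omega_i)$ for all $\mathbf p\in\mathbf D$. *Order.* Order $R^+$ totally by $\alpha_{p,q}\prec\alpha_{s,t}$ iff $q<t$, or $q=t$ and $p>s$. The induced homogeneous reverse lexicographic order on multi-exponents (equivalently, on monomials) is: $\mathbf t\prec\mathbf s$ iff $\sum_\beta t_\beta<\sum_\beta s_\beta$, or $\sum_\beta t_\beta=\sum_\beta s_\beta$, $\mathbf t\neq\mathbf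 s$ and $t_\beta>s_\beta$ for the largest root $\beta$ with $t_\beta\ne s_\beta$. **Proposition.** 1. Let $\mathbf p\in\mathbf D$ and let $\mathbf s$ be a multi-exponent supported on $\mathbf p$ (that is, $s_\beta=0$ for $\beta\notin\mathbf p$) with $\sum_{\beta\in\mathbf p}s_\beta>M_{\mathbf p}(m\omega_i)$. Then there are constants $c_{\mathbf t}\in\mathbb C$, only finitely many of them non-zero, indexed by the multi-exponents $\mathbf t\prec\mathbf s$ supported on $R_i^+$, such that $$X^{\mathbf s}+\sum_{\mathbf t\prec\mathbf s}c_{\mathbf t}X^{\mathbf t}\in\mathbf I_{m\omega_i}.$$ 2. The classes of the monomials $X^{\mathbf s}$, $\mathbf s\in S(\mathbf D,m\omega_i)$, span the vector space $S(\mathfrak n^-)/\mathbf I_{m\omega_i}$. 3. The elements $X^{\mathbf s}v$, $\mathbf s\in S(\mathbf D,m\omega_i)$, span the vector space $\operatorname{gr}V(m\omega_i)$. -/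

import Mathlib

open scoped DirectSum

namespace PBWTypeB

/-! ### The associated graded space of a cyclic module for the PBW filtration -/

section Graded

variable {N V : Type*} [LieRing N] [LieAlgebra ℂ N] [AddCommGroup V] [Module ℂ V]
  [LieRingModule N V] [LieModule ℂ N V]

variable (N) in
/-- `V_s = U(N)_s v`, where `U(N)_s` is spanned by the products `y₁ ⋯ y_l`, `y_j ∈ N`, `l ≤ s`. -/
def pbwFiltration (v : V) (s : ℕ) : Submodule ℂ V :=
  Submodule.span ℂ {w | ∃ l : List N, l.length ≤ s ∧ w = l.foldr (fun y u => ⁅y, u⁆) v}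

variable (N) in
/-- `V_{s-1}`, with the convention `V_{-1} = 0`. -/
def pbwPrev (v : V) : ℕ → Submodule ℂ V
  | 0 => ⊥
  | s + 1 => pbwFiltration N v s

variable (N) in
/-- The graded piece `V_s / V_{s-1}`. -/
abbrev GrPiece (v : V) (s : ℕ) : Type _ :=
  (pbwFiltration N v s) ⧸ (pbwPrev N v s).comap (pbwFiltration N v s).subtype

variable (N) in
/-- The associated graded space `gr V = ⨁ₛ V_s / V_{s-1}`. -/
abbrev Gr (v : V) : Type _ := ⨁ s : ℕ, GrPiece N v s

theorem self_mem_pbwFiltration (v : V) (s : ℕ) : v ∈ pbwFiltration N v s :=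
  Submodule.subset_span ⟨[], by simp, rfl⟩

theorem lie_mem_pbwFiltration (v : V) (s : ℕ) (y : N) {w : V} (hw : w ∈ pbwFiltration N v s) :
    ⁅y, w⁆ ∈ pbwFiltration N v (s + 1) := by
  induction hw using Submodule.span_induction with
  | mem w hw =>
    obtain ⟨l, hl, rfl⟩ := hw
    exact Submodule.subset_span ⟨y :: l, by simpa using hl, rfl⟩
  | zero => simp
  | add a b _ _ ha hb => rw [lie_add]; exact add_mem ha hb
  | smul c a _ ha => rw [lie_smul]; exact Submodule.smul_mem _ _ ha

theorem lie_mem_pbwPrev (v : V) (s : ℕ) (y : N) {w : V} (hw : w ∈ pbwPrev N v s) :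
    ⁅y, w⁆ ∈ pbwPrev N v (s + 1) := by
  cases s with
  | zero =>
    have : w = 0 := by simpa [pbwPrev] using hw
    simp [this]
  | succ s => exact lie_mem_pbwFiltration v s y hw

/-- The map `V_s → V_{s+1}` given by the action of `y`. -/
def lieStep (v : V) (s : ℕ) (y : N) :
    pbwFiltration N v s →ₗ[ℂ] pbwFiltration N v (s + 1) :=
  (LieModule.toEnd ℂ N V y).restrict fun _ hw => lie_mem_pbwFiltration v s y hw

/-- The map `V_s / V_{s-1} → V_{s+1} / V_s` induced by the action of `y`. -/
def grStep (v : V) (s : ℕ) (y : N) : GrPiece N v s →ₗ[ℂ] GrPiece N v (s + 1) :=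
  Submodule.mapQ _ _ (lieStep v s y) fun _ hw => lie_mem_pbwPrev v s y hw

/-- The operator on `gr V` induced by the action of `y` on `V`. -/
def grAct (v : V) (y : N) : Module.End ℂ (Gr N v) :=
  DirectSum.toModule ℂ ℕ (Gr N v) fun s =>
    (DirectSum.lof ℂ ℕ (GrPiece N v) (s + 1)) ∘ₗ (grStep v s y)

theorem grStep_comm (v : V) (s : ℕ) (y z : N) (w : GrPiece N v s) :
    grStep v (s + 1) y (grStep v s z w) = grStep v (s + 1) z (grStep v s y w) := by
  obtain ⟨w, rfl⟩ := Submodule.Quotient.mk_surjective _ w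
  refine (Submodule.Quotient.eq _).2 ?_
  change ⁅y, ⁅z, (w : V)⁆⁆ - ⁅z, ⁅y, (w : V)⁆⁆ ∈ pbwFiltration N v (s + 1)
  rw [← lie_lie]
  exact lie_mem_pbwFiltration v s _ w.2

theorem grAct_comm (v : V) (y z : N) : grAct v y * grAct v z = grAct v z * grAct v y := by
  refine DirectSum.linearMap_ext ℂ fun s => LinearMap.ext fun w => ?_
  simp [grAct, DirectSum.toModule_lof, grStep_comm v s y z w]

section Commuting

variable {A ι : Type*} [Semiring A] [Algebra ℂ A]

open scoped IsMulCommutative in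
/-- Evaluation of polynomials at a family of pairwise commuting elements of an algebra. -/
noncomputable def commAeval (f : ι → A) (hf : ∀ a b, f a * f b = f b * f a) :
    MvPolynomial ι ℂ →ₐ[ℂ] A :=
  haveI : IsMulCommutative (Algebra.adjoin ℂ (Set.range f)) :=
    Algebra.isMulCommutative_adjoin ℂ (by
      rintro _ ⟨a, rfl⟩ _ ⟨b, rfl⟩
      exact hf a b)
  (Algebra.adjoin ℂ (Set.range f)).val.comp
    (MvPolynomial.aeval fun b => ⟨f b, Algebra.subset_adjoin ⟨b, rfl⟩⟩)

theorem commAeval_X (f : ι → A) (hf : ∀ a b, f a * f b = f b * f a) (b : ι) :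
    commAeval f hf (MvPolynomial.X b) = f b := by
  simp [commAeval]

end Commuting

/-- The action of the polynomial ring `ℂ[x_b | b ∈ ι]` on `gr V` in which `x_b` acts as `y b ∈ N`.
If `y` is a basis of `N`, the polynomial ring is the symmetric algebra `S(N)` and this is
the structure of an `S(N)`-module on `gr V` induced by the action of `U(N)` on `V`. -/
noncomputable def grRep {ι : Type*} (v : V) (y : ι → N) :
    MvPolynomial ι ℂ →ₐ[ℂ] Module.End ℂ (Gr N v) :=
  commAeval (fun b => grAct v (y b)) fun a b => grAct_comm v (y a) (y b)

theorem grRep_X {ι : Type*} (v : V) (y : ι → N) (b : ι) :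
    grRep v y (MvPolynomial.X b) = grAct v (y b) := by
  rw [grRep, commAeval_X]

variable (N) in
/-- The class of the cyclic vector `v` in `V_0 / V_{-1} ⊆ gr V`. -/
def grVec (v : V) : Gr N v :=
  DirectSum.lof ℂ ℕ (GrPiece N v) 0 (Submodule.Quotient.mk ⟨v, self_mem_pbwFiltration v 0⟩)

/-- The annihilator of the class of `v` in `gr V`, so that `S(N) / I ≅ S(N) v = gr V`. -/
def annIdeal {ι : Type*} (v : V) (y : ι → N) : Ideal (MvPolynomial ι ℂ) where
  carrier := {P | grRep v y P (grVec N v) = 0}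
  zero_mem' := by simp
  add_mem' {P Q} hP hQ := by
    simp only [Set.mem_ofPred_eq] at hP hQ ⊢
    rw [map_add, LinearMap.add_apply, hP, hQ, add_zero]
  smul_mem' Q P hP := by
    simp only [Set.mem_ofPred_eq] at hP ⊢
    rw [smul_eq_mul, map_mul, Module.End.mul_apply, hP, map_zero]

end Graded

/-! ### The Lie algebra and the root system of type `B_n` -/

/-- The Lie algebra `so(2n+1, ℂ)` of type `B_n`. -/
abbrev SO (n : ℕ) : Type := LieAlgebra.Orthogonal.typeB (Fin n) ℂ

/-- The diagonal matrix `diag(0, t, -t)`; these form the Cartan subalgebra. -/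
def cartanElt {n : ℕ} (t : Fin n → ℂ) : SO n :=
  ⟨Matrix.diagonal (Sum.elim (fun _ => 0) (Sum.elim t fun k => -t k)), by
    rw [LieAlgebra.Orthogonal.typeB, mem_skewAdjointMatricesLieSubalgebra,
      mem_skewAdjointMatricesSubmodule, Matrix.IsSkewAdjoint, Matrix.IsAdjointPair]
    ext a b
    rw [Matrix.diagonal_transpose, Matrix.diagonal_mul, Matrix.diagonal_neg, Matrix.mul_diagonal]
    rcases a with a | a | a <;> rcases b with b | b | b <;>
      simp [LieAlgebra.Orthogonal.JB, LieAlgebra.Orthogonal.JD, Matrix.one_apply]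
    all_goals
      by_cases h : a = b
      · simp [h]
      · simp [h]⟩

/-- A weight `∑ μ_k ε_k`, given by its coordinates, evaluated at `diag(0, t, -t)`. -/
noncomputable def evalWt {n : ℕ} (μ : Fin n → ℝ) (t : Fin n → ℂ) : ℂ := ∑ k, (μ k : ℂ) * t k

/-- The simultaneous eigenspace of weight `μ` for the adjoint action of the Cartan subalgebra. -/
def rootSpace {n : ℕ} (μ : Fin n → ℝ) : Submodule ℂ (SO n) where
  carrier := {y | ∀ t : Fin n → ℂ, ⁅cartanElt t, y⁆ = evalWt μ t • y}
  zero_mem' := by simp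
  add_mem' {a b} ha hb t := by rw [lie_add, ha t, hb t, smul_add]
  smul_mem' c a ha t := by rw [lie_smul, ha t, smul_comm]

/-- `ε_k` for `1 ≤ k ≤ n`, and `0` for all other `k`. -/
noncomputable def eps (n k : ℕ) : Fin n → ℝ := fun j => if (j : ℕ) + 1 = k then 1 else 0

/-- The simple roots `α_k = ε_k - ε_{k+1}` for `1 ≤ k < n` and `α_n = ε_n`. -/
noncomputable def simpleRoot (n k : ℕ) : Fin n → ℝ := eps n k - eps n (k + 1)

/-- `α_{p,q}`, for `q ≤ n` and for `n < q`. -/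
noncomputable def rootVec (n p q : ℕ) : Fin n → ℝ :=
  if q ≤ n then ∑ k ∈ Finset.Icc p q, simpleRoot n k
  else ∑ k ∈ Finset.Icc p (2 * n - q), simpleRoot n k +
    2 • ∑ k ∈ Finset.Icc (2 * n - q + 1) n, simpleRoot n k

/-- The pairs `(p, q)` with `1 ≤ p ≤ q ≤ n` or `1 ≤ p ≤ 2n - q < n`, which label the positive
roots `α_{p,q}`. -/
abbrev PosRoot (n : ℕ) : Type :=
  {b : ℕ × ℕ // 1 ≤ b.1 ∧ (b.1 ≤ b.2 ∧ b.2 ≤ n ∨ n < b.2 ∧ b.1 + b.2 ≤ 2 * n)}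

/-- The positive root labelled by `b`. -/
noncomputable def PosRoot.root {n : ℕ} (b : PosRoot n) : Fin n → ℝ := rootVec n b.1.1 b.1.2

/-- The coroot `α^∨ = 2 α / (α, α)`. -/
noncomputable def coroot {n : ℕ} (α : Fin n → ℝ) : Fin n → ℝ := (2 / (α ⬝ᵥ α)) • α

/-- The fundamental weight `ω_i`: it is `ε_1 + ⋯ + ε_i` for `i < n` and
`(ε_1 + ⋯ + ε_n) / 2` for `i = n`. -/
noncomputable def fundWeight (n i : ℕ) : Fin n → ℝ :=
  fun k => if (k : ℕ) < i then (if i = n then 1 / 2 else 1) else 0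

/-- `ω_i (α_j^∨) = δ_{ij}`. -/
theorem fundWeight_coroot (n i j : ℕ) (hin : i ≤ n) (hj : 1 ≤ j) (hjn : j ≤ n) :
    fundWeight n i ⬝ᵥ coroot (simpleRoot n j) = if i = j then 1 else 0 := by
  obtain ⟨j, rfl⟩ : ∃ k, j = k + 1 := ⟨j - 1, by omega⟩
  have e1 : ∀ μ : Fin n → ℝ, μ ⬝ᵥ eps n (j + 1) = μ ⟨j, by omega⟩ := fun μ => by
    have : eps n (j + 1) = Pi.single ⟨j, by omega⟩ 1 := by
      funext k
      simp [eps, Pi.single_apply, Fin.ext_iff]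
    rw [this, dotProduct_single_one]
  rcases hjn.lt_or_eq with h | h
  · have e2 : ∀ μ : Fin n → ℝ, μ ⬝ᵥ eps n (j + 1 + 1) = μ ⟨j + 1, h⟩ := fun μ => by
      have : eps n (j + 1 + 1) = Pi.single ⟨j + 1, h⟩ 1 := by
        funext k
        simp [eps, Pi.single_apply, Fin.ext_iff]
      rw [this, dotProduct_single_one]
    simp only [coroot, simpleRoot, dotProduct_smul, dotProduct_sub, e1, e2, Pi.sub_apply]
    simp only [eps, fundWeight]
    split_ifs <;> first | omega | norm_num
  · have e2 : eps n (j + 1 + 1) = 0 := by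
      rw [h]
      funext k
      have := k.2
      simp [eps]
      omega
    simp only [coroot, simpleRoot, e2, sub_zero, dotProduct_smul, e1]
    simp only [eps, fundWeight]
    split_ifs <;> first | omega | norm_num

/-- The highest root `θ = α_{1,2n-1}`. -/
noncomputable def highestRoot (n : ℕ) : Fin n → ℝ := rootVec n 1 (2 * n - 1)

/-! The next lemmas show that the sum of the negative root spaces is closed under the bracket. -/

theorem eps_succ_self (n : ℕ) : eps n (n + 1) = 0 := by
  funext j
  have := j.2
  simp [eps]
  omega

theorem sum_simpleRoot (n p q : ℕ) (h : p ≤ q + 1) :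
    ∑ k ∈ Finset.Icc p q, simpleRoot n k = eps n p - eps n (q + 1) := by
  have : Finset.Icc p q = Finset.Ico p (q + 1) := by ext; simp
  rw [this]
  have h' := Finset.sum_Ico_sub (eps n) h
  simp only [simpleRoot]
  rw [← neg_inj, ← Finset.sum_neg_distrib, neg_sub, ← h']
  exact Finset.sum_congr rfl fun _ _ => neg_sub _ _

theorem rootVec_of_le {n p q : ℕ} (hp : p ≤ q) (hq : q ≤ n) :
    rootVec n p q = eps n p - eps n (q + 1) := by
  rw [rootVec, if_pos hq, sum_simpleRoot n p q (by omega)]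

theorem rootVec_of_lt {n p q : ℕ} (hq : n < q) (hp : p + q ≤ 2 * n) :
    rootVec n p q = eps n p + eps n (2 * n - q + 1) := by
  rw [rootVec, if_neg (by omega), sum_simpleRoot n _ _ (by omega),
    sum_simpleRoot n _ _ (by omega), eps_succ_self]
  module

theorem evalWt_add {n : ℕ} (μ ν : Fin n → ℝ) (t : Fin n → ℂ) :
    evalWt (μ + ν) t = evalWt μ t + evalWt ν t := by
  simp [evalWt, add_mul, Finset.sum_add_distrib]

theorem evalWt_neg {n : ℕ} (μ : Fin n → ℝ) (t : Fin n → ℂ) :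
    evalWt (-μ) t = -evalWt μ t := by
  simp [evalWt]

theorem evalWt_eps {n : ℕ} (k : Fin n) (t : Fin n → ℂ) :
    evalWt (eps n (k + 1)) t = t k := by
  simp only [evalWt, eps, add_left_inj, Fin.val_inj]
  rw [Finset.sum_eq_single k]
  · simp
  · intro b _ hb
    simp [hb]
  · simp

theorem evalWt_injective {n : ℕ} {μ ν : Fin n → ℝ} (h : ∀ t, evalWt μ t = evalWt ν t) :
    μ = ν := by
  funext k
  simpa [evalWt, Pi.single_apply] using h (Pi.single k 1)

/-- The weights of the basis vectors of `ℂ^{2n+1}`. -/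
noncomputable def stdWt {n : ℕ} : Unit ⊕ Fin n ⊕ Fin n → Fin n → ℝ :=
  Sum.elim (fun _ => 0) (Sum.elim (fun k => eps n (k + 1)) fun k => -eps n (k + 1))

theorem cartanElt_coe {n : ℕ} (t : Fin n → ℂ) :
    (cartanElt t : Matrix (Unit ⊕ Fin n ⊕ Fin n) (Unit ⊕ Fin n ⊕ Fin n) ℂ) =
      Matrix.diagonal fun a => evalWt (stdWt a) t := by
  change Matrix.diagonal _ = _
  refine congrArg Matrix.diagonal (funext fun a => ?_)
  rcases a with a | a | a
  · simp [stdWt, evalWt]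
  · simp [stdWt, evalWt_eps]
  · simp [stdWt, evalWt_eps, evalWt_neg]

theorem stdWt_of_mem_rootSpace {n : ℕ} {μ : Fin n → ℝ} {y : SO n} (hy : y ∈ rootSpace μ)
    {a b : Unit ⊕ Fin n ⊕ Fin n} (hab : y.1 a b ≠ 0) : stdWt a = μ + stdWt b := by
  refine evalWt_injective fun t => ?_
  have h := congrArg (fun z : SO n => z.1 a b) (hy t)
  simp only [LieSubalgebra.coe_bracket, Ring.lie_def, cartanElt_coe, Matrix.sub_apply,
    Matrix.diagonal_mul, Matrix.mul_diagonal] at h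
  change _ = evalWt μ t * y.1 a b at h
  rw [evalWt_add]
  have : (evalWt (stdWt a) t - evalWt (stdWt b) t - evalWt μ t) * y.1 a b = 0 := by
    linear_combination h
  rcases mul_eq_zero.1 this with h' | h'
  · linear_combination h'
  · exact absurd h' hab

/-- A linear form that is positive on the positive roots. -/
noncomputable def htForm {n : ℕ} : (Fin n → ℝ) →ₗ[ℝ] ℝ :=
  ∑ k : Fin n, ((n : ℝ) - k) • LinearMap.proj k

theorem htForm_eps {n : ℕ} (k : Fin n) : htForm (eps n (k + 1)) = (n : ℝ) - k := by
  simp [htForm, eps, Fin.val_inj]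

theorem htForm_eps' {n k : ℕ} (h : 1 ≤ k) (hk : k ≤ n) : htForm (eps n k) = (n : ℝ) + 1 - k := by
  obtain ⟨j, rfl⟩ : ∃ j, k = j + 1 := ⟨k - 1, by omega⟩
  have := htForm_eps (n := n) ⟨j, by omega⟩
  simp only at this
  rw [this]
  push_cast
  ring

theorem htForm_root_pos {n : ℕ} (b : PosRoot n) : 0 < htForm b.root := by
  obtain ⟨⟨p, q⟩, hp, h⟩ := b
  simp only at hp h
  rw [PosRoot.root]
  rcases h with ⟨h1, h2⟩ | ⟨h1, h2⟩
  · simp only [rootVec_of_le h1 h2]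
    rw [map_sub, htForm_eps' hp (by omega)]
    rcases h2.lt_or_eq with h3 | h3
    · rw [htForm_eps' (by omega) (by omega)]
      have : (p : ℝ) ≤ q := by exact_mod_cast h1
      push_cast
      linarith
    · subst h3
      have : (p : ℝ) ≤ q := by exact_mod_cast h1
      rw [eps_succ_self, map_zero]
      linarith
  · simp only [rootVec_of_lt h1 h2]
    rw [map_add, htForm_eps' hp (by omega), htForm_eps' (by omega) (by omega)]
    have h3 : (p : ℝ) ≤ n := by exact_mod_cast (by omega : p ≤ n)
    have h4 : ((2 * n - q + 1 : ℕ) : ℝ) ≤ n := by exact_mod_cast (by omega : 2 * n - q + 1 ≤ n)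
    linarith

theorem diag_entry_eq_zero {n : ℕ} (y : SO n) (k : Fin n) :
    y.1 (Sum.inr (Sum.inr k)) (Sum.inr (Sum.inl k)) = 0 := by
  obtain ⟨y, hy⟩ := y
  change y _ _ = 0
  rw [LieAlgebra.Orthogonal.typeB, mem_skewAdjointMatricesLieSubalgebra,
    mem_skewAdjointMatricesSubmodule, Matrix.IsSkewAdjoint, Matrix.IsAdjointPair] at hy
  have h := congrFun (congrFun hy (Sum.inr (Sum.inl k))) (Sum.inr (Sum.inl k))
  simp [Matrix.mul_apply, LieAlgebra.Orthogonal.JB, LieAlgebra.Orthogonal.JD, Matrix.one_apply]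
    at h
  linear_combination h / 2

theorem exists_root_eq {n : ℕ} (y : SO n) {a b : Unit ⊕ Fin n ⊕ Fin n} (hab : y.1 a b ≠ 0)
    (hpos : 0 < htForm (stdWt b - stdWt a)) : ∃ c : PosRoot n, c.root = stdWt b - stdWt a := by
  have hlt : ∀ k : Fin n, 0 < (n : ℝ) - k := fun k => by
    have : ((k : ℕ) : ℝ) < n := by exact_mod_cast k.2
    linarith
  have hshort : ∀ k : Fin n, ∃ c : PosRoot n, c.root = eps n (k + 1) := fun k => by
    have hk := k.2
    refine ⟨⟨(k + 1, n), by simp⟩, ?_⟩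
    simp only [PosRoot.root]
    rw [rootVec_of_le (by omega) le_rfl, eps_succ_self, sub_zero]
  have hminus : ∀ k l : Fin n, k < l → ∃ c : PosRoot n, c.root = eps n (k + 1) - eps n (l + 1) :=
    fun k l hkl => by
      have hl := l.2
      have hkl' : (k : ℕ) < l := hkl
      refine ⟨⟨(k + 1, l), by simp; omega⟩, ?_⟩
      simp only [PosRoot.root]
      rw [rootVec_of_le (by omega) (by omega)]
  have hplus : ∀ k l : Fin n, k < l → ∃ c : PosRoot n, c.root = eps n (k + 1) + eps n (l + 1) :=
    fun k l hkl => by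
      have hl := l.2
      have hkl' : (k : ℕ) < l := hkl
      refine ⟨⟨(k + 1, 2 * n - l), by simp; omega⟩, ?_⟩
      simp only [PosRoot.root]
      rw [rootVec_of_lt (by omega) (by omega)]
      congr 3
      omega
  rcases a with a | a | a <;> rcases b with b | b | b <;>
    simp only [stdWt, Sum.elim_inl, Sum.elim_inr, sub_zero, zero_sub, sub_neg_eq_add, zero_add,
      map_sub, map_add, map_neg, map_zero, htForm_eps] at hpos ⊢
  · exact absurd hpos (lt_irrefl _)
  · exact hshort b
  · have := hlt b
    linarith
  · have := hlt a
    linarith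
  · obtain ⟨c, hc⟩ := hminus b a (by
      have : ((b : ℕ) : ℝ) < (a : ℕ) := by linarith
      exact_mod_cast this)
    exact ⟨c, hc⟩
  · have := hlt a
    have := hlt b
    linarith
  · exact hshort a
  · rcases lt_trichotomy a b with h | h | h
    · obtain ⟨c, hc⟩ := hplus a b h
      exact ⟨c, by rw [hc, add_comm]⟩
    · subst h
      exact absurd (diag_entry_eq_zero y a) hab
    · exact hplus b a h
  · obtain ⟨c, hc⟩ := hminus a b (by
      have : ((a : ℕ) : ℝ) < (b : ℕ) := by linarith
      exact_mod_cast this)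
    exact ⟨c, by rw [hc]; abel⟩

theorem lie_mem_iSup_rootSpace {n : ℕ} (b c : PosRoot n) {y z : SO n}
    (hy : y ∈ rootSpace (-b.root)) (hz : z ∈ rootSpace (-c.root)) :
    ⁅y, z⁆ ∈ ⨆ b : PosRoot n, rootSpace (-b.root) := by
  have hyz : ⁅y, z⁆ ∈ rootSpace (-b.root + -c.root) := fun t => by
    rw [leibniz_lie, hy t, hz t, evalWt_add, smul_lie, lie_smul, add_smul]
  by_cases h0 : ⁅y, z⁆ = 0
  · rw [h0]
    exact zero_mem _
  obtain ⟨i, j, hij⟩ : ∃ i j, (⁅y, z⁆ : SO n).1 i j ≠ 0 := by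
    by_contra! h
    exact h0 (Subtype.ext (Matrix.ext h))
  have hw := stdWt_of_mem_rootSpace hyz hij
  have hw' : stdWt j - stdWt i = b.root + c.root := by rw [hw]; abel
  obtain ⟨d, hd⟩ := exists_root_eq _ hij (by
    rw [hw', map_add]
    exact add_pos (htForm_root_pos b) (htForm_root_pos c))
  refine Submodule.mem_iSup_of_mem d ?_
  rw [hd, hw', neg_add]
  exact hyz

/-- `𝔫⁻ = ⨁_{β ∈ R⁺} 𝔤_{-β}`. -/
noncomputable def nMinus (n : ℕ) : LieSubalgebra ℂ (SO n) where
  toSubmodule := ⨆ b : PosRoot n, rootSpace (-b.root)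
  lie_mem' {y z} hy hz := by
    change y ∈ ⨆ b : PosRoot n, rootSpace (-b.root) at hy
    change z ∈ ⨆ b : PosRoot n, rootSpace (-b.root) at hz
    change ⁅y, z⁆ ∈ ⨆ b : PosRoot n, rootSpace (-b.root)
    induction hy using Submodule.iSup_induction' with
    | mem b y hy =>
      induction hz using Submodule.iSup_induction' with
      | mem c z hz => exact lie_mem_iSup_rootSpace b c hy hz
      | zero => simp
      | add z w _ _ h1 h2 => rw [lie_add]; exact add_mem h1 h2
    | zero => simp
    | add y w _ _ h1 h2 => rw [add_lie]; exact add_mem h1 h2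

theorem rootSpace_le_nMinus {n : ℕ} (b : PosRoot n) {y : SO n} (hy : y ∈ rootSpace (-b.root)) :
    y ∈ nMinus n :=
  (le_iSup (fun b : PosRoot n => rootSpace (-b.root)) b) hy

/-- `V` is the irreducible finite-dimensional module of highest weight `μ`, with highest weight
vector `v`. -/
structure IsHighestWeightModule {n : ℕ} (V : Type*) [AddCommGroup V] [Module ℂ V]
    [LieRingModule (SO n) V] [LieModule ℂ (SO n) V] (μ : Fin n → ℝ) (v : V) : Prop where
  finite : Module.Finite ℂ V
  irreducible : LieModule.IsIrreducible ℂ (SO n) V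
  ne_zero : v ≠ 0
  nPlus : ∀ (b : PosRoot n), ∀ y ∈ rootSpace b.root, ⁅y, v⁆ = 0
  weight : ∀ t : Fin n → ℂ, ⁅cartanElt t, v⁆ = evalWt μ t • v

/-! ### Dyck paths, the polytope and the monomial order -/

/-- The roots `α_{p,q} ∈ R⁺_i`, i.e. those in which `α_i` has a non-zero coefficient. -/
def PosRoot.MemR {n : ℕ} (i : ℕ) (b : PosRoot n) : Prop := b.1.1 ≤ i ∧ i ≤ b.1.2

/-- `p = {β(0), …, β(k)}` with `β(0) = α_a`, `β(k) = α_e`, where each `β(s) = α_{p,q}` is followed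
by `α_{p,q+1}` or `α_{p+1,q}`. -/
def IsPath {n : ℕ} (p : Finset (PosRoot n)) (a e : ℕ × ℕ) : Prop :=
  ∃ (k : ℕ) (β : ℕ → PosRoot n), (β 0).1 = a ∧ (β k).1 = e ∧
    (∀ s < k, (β (s + 1)).1 = ((β s).1.1, (β s).1.2 + 1) ∨
      (β (s + 1)).1 = ((β s).1.1 + 1, (β s).1.2)) ∧
    p = (Finset.range (k + 1)).image β

/-- (Single) Dyck paths of type 1. -/
def IsDyck1 {n : ℕ} (i : ℕ) (p : Finset (PosRoot n)) : Prop :=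
  IsPath p (1, i) (i, 2 * n - i - 1) ∨ IsPath p (1, i + 1) (i, 2 * n - i)

/-- Double Dyck paths (type 2). -/
def IsDyck2 {n : ℕ} (i : ℕ) (p : Finset (PosRoot n)) : Prop :=
  ∃ j, 1 ≤ j ∧ j < i ∧ ∃ p₁ p₂ : Finset (PosRoot n),
    IsPath p₁ (1, i) (j, 2 * n - j) ∧ IsPath p₂ (2, i) (j + 1, 2 * n - j - 1) ∧
    Disjoint p₁ p₂ ∧ p = p₁ ∪ p₂

/-- The set `𝐃` of Dyck paths. -/
def IsDyck {n : ℕ} (i : ℕ) (p : Finset (PosRoot n)) : Prop := IsDyck1 i p ∨ IsDyck2 i p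

open Classical in
/-- `M_p(m ω_i)`: it is `m` for type 1 and `m ω_i(θ^∨)` for type 2. -/
noncomputable def pathBound {n : ℕ} (m i : ℕ) (p : Finset (PosRoot n)) : ℝ :=
  if IsDyck1 i p then m else m * (fundWeight n i ⬝ᵥ coroot (highestRoot n))

/-- The polytope `P(𝐃, m ω_i)`, as a subset of `ℝ^{R⁺}`. -/
def polytope (n m i : ℕ) : Set (PosRoot n → ℝ) :=
  {s | (∀ b, 0 ≤ s b) ∧ (∀ b, ¬ b.MemR i → s b = 0) ∧
    ∀ p : Finset (PosRoot n), IsDyck i p → ∑ b ∈ p, s b ≤ pathBound m i p}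

/-- The integral points `S(𝐃, m ω_i)` of the polytope. -/
def latticePoints (n m i : ℕ) : Set (PosRoot n →₀ ℕ) :=
  {s | (fun b => (s b : ℝ)) ∈ polytope n m i}

/-- The total order on positive roots: `α_{p,q} ≺ α_{s,t}` iff `q < t`, or `q = t` and `p > s`. -/
def rootLT {n : ℕ} (b c : PosRoot n) : Prop :=
  b.1.2 < c.1.2 ∨ b.1.2 = c.1.2 ∧ c.1.1 < b.1.1

/-- The induced homogeneous reverse lexicographic order: first compare total degrees; if they are
equal, then `X^t ≺ X^s` iff the exponent of `t` is the larger one at the largest root at which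
`t` and `s` differ. -/
def monoLT {n : ℕ} (t s : PosRoot n →₀ ℕ) : Prop :=
  t.degree < s.degree ∨ t.degree = s.degree ∧
    ∃ b, s b < t b ∧ ∀ c, rootLT b c → t c = s c

/-- The monomial `X^s = ∏ x_{-β}^{s_β}` in `S(𝔫⁻) = ℂ[x_{-β} | β ∈ R⁺]`. -/
noncomputable abbrev mon {n : ℕ} (s : PosRoot n →₀ ℕ) : MvPolynomial (PosRoot n) ℂ :=
  MvPolynomial.monomial s 1

end PBWTypeB

/-! Identify `so(2n+1)` with the exterior square of its standard representation, `a ∧ b` being `x ↦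
(b,x)a - (a,x)b`. Order the weight basis as `v_1, …, v_{2n+1} = f_1, …, f_n, u, e_n, …, e_1`, so
that `v_k` pairs only with `v_{2n+2-k}`. The root vector of weight `-α_{p,q}` is then, up to a
scalar, `v_p ∧ v_{q'}` with `q' = 2n+1-q`. Thus a positive root is a cell in row `p` and column
`q'`, `R_i⁺` consists of the cells with `p ≤ i` and `q' ≤ 2n+1-i`, and a smaller column means a
larger root.

All relations come from `sl₂`. If `(h, e, f)` is an `sl₂`-triple with `ev = 0` and `hv = Mv`, then
`f^d v = 0` for `d > M`. The stabilizer of the line through `v` preserves the PBW filtration and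
together with `𝔫⁻` spans the Lie algebra, so in `gr V` only the `𝔫⁻`-component of `f` matters: it
gives a linear form whose `d`-th power lies in the annihilator (`linear_pow_mem_annIdeal_of_sl2`).
Two families of `f` are used. For double Dyck paths `f` is a general decomposable bivector `A ∧ B`
with `A, B` orthogonal to `f_1, …, f_i`, corrected inside the stabilizer so that the plane becomes
isotropic; here `M = m ω_i(θ^∨)` (`exists_sl2_of_plane`). For paths of type 1, which exist only when
`i < n`, `f = a ∧ w` with `a` in the span of `f_1, …, f_i` and `w` an isotropic vector of the Levi
part; here `M = m` (`exists_sl2_of_isotropic`).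

Both linear forms have coefficients polynomial in free parameters, and the power relation holds on a
dense open set of parameters. Hence the coefficient of every parameter monomial lies in the
annihilator (`coefficient_mem`). For `s` supported on a Dyck path, take a parameter monomial whose
coefficient contains `X^s`. The other monomials in this coefficient share prescribed row and column
data with `s`, and a path meets rows and columns monotonically. A counting argument then shows that
`X^s` is the largest of them (`eq_or_monoLT_of_chain`, `eq_or_monoLT_of_matching`,
`eq_or_monoLT_of_top_column`). This is part 1.

Part 2 is straightening: a monomial supported on `R_i⁺` and outside the polytope violates the
inequality of some Dyck path, its restriction to this path can be replaced by smaller monomials, and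
the order is multiplicative and well-founded. Part 3 follows because `gr V` is generated over
`S(𝔫⁻)` by the class of `v`. -/

namespace PBWTypeB

/-! ### The orthogonal Lie algebra as an exterior square -/

section Wedge

variable {n : ℕ}

/-- The symmetric bilinear form on `ℂ^{2n+1}` preserved by `so(2n+1)`. -/
noncomputable def form (n : ℕ) : LinearMap.BilinForm ℂ (Unit ⊕ Fin n ⊕ Fin n → ℂ) :=
  Matrix.toLinearMap₂' ℂ (LieAlgebra.Orthogonal.JB (Fin n) ℂ)

theorem form_apply (x y : Unit ⊕ Fin n ⊕ Fin n → ℂ) :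
    form n x y = x ⬝ᵥ (LieAlgebra.Orthogonal.JB (Fin n) ℂ).mulVec y := by
  rw [form, Matrix.toLinearMap₂'_apply']

theorem JB_transpose : (LieAlgebra.Orthogonal.JB (Fin n) ℂ).transpose =
    LieAlgebra.Orthogonal.JB (Fin n) ℂ := by
  simp [LieAlgebra.Orthogonal.JB, LieAlgebra.Orthogonal.JD, Matrix.fromBlocks_transpose]

theorem form_comm (x y : Unit ⊕ Fin n ⊕ Fin n → ℂ) : form n x y = form n y x := by
  rw [form_apply, form_apply, Matrix.dotProduct_mulVec, ← Matrix.mulVec_transpose, JB_transpose,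
    dotProduct_comm]

theorem coe_mem_SO (M : SO n) :
    M.1.transpose * LieAlgebra.Orthogonal.JB (Fin n) ℂ =
      LieAlgebra.Orthogonal.JB (Fin n) ℂ * -M.1 := by
  have h : M.1 ∈ skewAdjointMatricesLieSubalgebra (LieAlgebra.Orthogonal.JB (Fin n) ℂ) := M.2
  rwa [mem_skewAdjointMatricesLieSubalgebra,
      mem_skewAdjointMatricesSubmodule, Matrix.IsSkewAdjoint, Matrix.IsAdjointPair] at h

theorem form_mulVec_left (M : SO n) (x y : Unit ⊕ Fin n ⊕ Fin n → ℂ) :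
    form n (M.1.mulVec x) y = -form n x (M.1.mulVec y) := by
  have h := coe_mem_SO M
  rw [form_apply, form_apply, dotProduct_comm, Matrix.dotProduct_mulVec, dotProduct_comm,
    ← Matrix.mulVec_transpose, Matrix.mulVec_mulVec, h, Matrix.mulVec_mulVec, Matrix.mul_neg,
    Matrix.neg_mulVec, dotProduct_neg]

/-- The matrix of `x ↦ (b, x) a - (a, x) b`. -/
noncomputable def wedgeMatrix (a b : Unit ⊕ Fin n ⊕ Fin n → ℂ) :
    Matrix (Unit ⊕ Fin n ⊕ Fin n) (Unit ⊕ Fin n ⊕ Fin n) ℂ :=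
  Matrix.vecMulVec a ((LieAlgebra.Orthogonal.JB (Fin n) ℂ).mulVec b) -
    Matrix.vecMulVec b ((LieAlgebra.Orthogonal.JB (Fin n) ℂ).mulVec a)

theorem wedgeMatrix_mem (a b : Unit ⊕ Fin n ⊕ Fin n → ℂ) :
    wedgeMatrix a b ∈ LieAlgebra.Orthogonal.typeB (Fin n) ℂ := by
  rw [LieAlgebra.Orthogonal.typeB, mem_skewAdjointMatricesLieSubalgebra,
      mem_skewAdjointMatricesSubmodule, Matrix.IsSkewAdjoint, Matrix.IsAdjointPair]
  simp only [wedgeMatrix, Matrix.transpose_sub, Matrix.transpose_vecMulVec, Matrix.sub_mul,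
    Matrix.vecMulVec_mul, neg_sub, Matrix.mul_sub, Matrix.mul_vecMulVec]
  simp only [← Matrix.mulVec_transpose, JB_transpose]

/-- The element `x ↦ (b, x) a - (a, x) b` of `so(2n+1)`, as a bilinear function of `a`, `b`. -/
noncomputable def wedge (n : ℕ) :
    (Unit ⊕ Fin n ⊕ Fin n → ℂ) →ₗ[ℂ] (Unit ⊕ Fin n ⊕ Fin n → ℂ) →ₗ[ℂ] SO n :=
  LinearMap.mk₂ ℂ (fun a b => ⟨wedgeMatrix a b, wedgeMatrix_mem a b⟩)
    (fun a b c => Subtype.ext (by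
      change wedgeMatrix _ _ = wedgeMatrix _ _ + wedgeMatrix _ _
      simp only [wedgeMatrix, Matrix.add_vecMulVec, Matrix.mulVec_add, Matrix.vecMulVec_add]
      abel))
    (fun r a b => Subtype.ext (by
      change wedgeMatrix _ _ = r • wedgeMatrix _ _
      simp only [wedgeMatrix, Matrix.smul_vecMulVec, Matrix.mulVec_smul, Matrix.vecMulVec_smul,
        smul_sub]))
    (fun a b c => Subtype.ext (by
      change wedgeMatrix _ _ = wedgeMatrix _ _ + wedgeMatrix _ _
      simp only [wedgeMatrix, Matrix.add_vecMulVec, Matrix.mulVec_add, Matrix.vecMulVec_add]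
      abel))
    (fun r a b => Subtype.ext (by
      change wedgeMatrix _ _ = r • wedgeMatrix _ _
      simp only [wedgeMatrix, Matrix.smul_vecMulVec, Matrix.mulVec_smul, Matrix.vecMulVec_smul,
        smul_sub]))

theorem wedge_coe (a b : Unit ⊕ Fin n ⊕ Fin n → ℂ) : (wedge n a b).1 = wedgeMatrix a b := rfl

theorem wedge_mulVec (a b x : Unit ⊕ Fin n ⊕ Fin n → ℂ) :
    (wedge n a b).1.mulVec x = form n b x • a - form n a x • b := by
  rw [wedge_coe, wedgeMatrix, Matrix.sub_mulVec, Matrix.vecMulVec_mulVec, Matrix.vecMulVec_mulVec,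
    form_comm b x, form_comm a x, form_apply, form_apply, dotProduct_comm x, dotProduct_comm x]
  simp

theorem SO_ext {M M' : SO n} (h : ∀ x, M.1.mulVec x = M'.1.mulVec x) : M = M' :=
  Subtype.ext (Matrix.mulVec_injective (funext h))

theorem SO_mulVec_lie (M M' : SO n) (x : Unit ⊕ Fin n ⊕ Fin n → ℂ) :
    (⁅M, M'⁆ : SO n).1.mulVec x = M.1.mulVec (M'.1.mulVec x) - M'.1.mulVec (M.1.mulVec x) := by
  simp only [LieSubalgebra.coe_bracket, Ring.lie_def, Matrix.sub_mulVec, Matrix.mulVec_mulVec]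

theorem SO_mulVec_add (M M' : SO n) (x : Unit ⊕ Fin n ⊕ Fin n → ℂ) :
    (M + M').1.mulVec x = M.1.mulVec x + M'.1.mulVec x :=
  Matrix.add_mulVec _ _ _

theorem SO_mulVec_neg (M : SO n) (x : Unit ⊕ Fin n ⊕ Fin n → ℂ) :
    (-M).1.mulVec x = -M.1.mulVec x :=
  Matrix.neg_mulVec _ _

theorem SO_mulVec_smul (c : ℂ) (M : SO n) (x : Unit ⊕ Fin n ⊕ Fin n → ℂ) :
    (c • M).1.mulVec x = c • M.1.mulVec x :=
  Matrix.smul_mulVec _ _ _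

theorem wedge_swap (a b : Unit ⊕ Fin n ⊕ Fin n → ℂ) : wedge n a b = -wedge n b a :=
  SO_ext fun x => by simp only [SO_mulVec_neg, wedge_mulVec]; abel

theorem wedge_self (a : Unit ⊕ Fin n ⊕ Fin n → ℂ) : wedge n a a = 0 :=
  Subtype.ext (by rw [wedge_coe, wedgeMatrix, sub_self]; rfl)

theorem lie_wedge (M : SO n) (a b : Unit ⊕ Fin n ⊕ Fin n → ℂ) :
    ⁅M, wedge n a b⁆ = wedge n (M.1.mulVec a) b + wedge n a (M.1.mulVec b) :=
  SO_ext fun x => by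
    simp only [SO_mulVec_lie, SO_mulVec_add, wedge_mulVec, form_mulVec_left, Matrix.mulVec_sub,
      Matrix.mulVec_smul]
    module

/-- An isotropic plane with basis `a, b` and an isotropic plane with the dual basis `a', b'`: `h`
acts by `-1` on the first and by `1` on the second. Every triple used for the Dyck relations has
this form. -/
theorem isSl2Triple_wedge {a b a' b' : Unit ⊕ Fin n ⊕ Fin n → ℂ}
    (haa : form n a a = 0) (hab : form n a b = 0) (hbb : form n b b = 0)
    (haa' : form n a' a' = 0) (hab' : form n a' b' = 0) (hbb' : form n b' b' = 0)
    (h1 : form n a a' = 1) (h2 : form n a b' = 0) (h3 : form n b a' = 0) (h4 : form n b b' = 1) :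
    IsSl2Triple (wedge n a' a + wedge n b' b) (wedge n b' a') (wedge n a b) := by
  have hba := form_comm b a
  have hba' := form_comm b' a'
  have h1' := form_comm a' a
  have h2' := form_comm b' a
  have h3' := form_comm a' b
  have h4' := form_comm b' b
  have key : ∀ x, (wedge n a' a + wedge n b' b).1.mulVec x =
      form n a x • a' - form n a' x • a + (form n b x • b' - form n b' x • b) := fun x => by
    simp only [SO_mulVec_add, wedge_mulVec]
  refine ⟨fun h => ?_, ?_, ?_, ?_⟩
  · have h0 := key a'
    rw [h] at h0
    simp only [h1, haa', h3, hba', hab'] at h0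
    have h5 : a' = 0 := by simpa using h0.symm
    rw [h5, map_zero] at h1
    exact zero_ne_one h1
  · rw [lie_wedge, wedge_mulVec, wedge_mulVec]
    simp only [h1', h2', h3', h4', h1, h2, h3, h4, one_smul, zero_smul, zero_sub, sub_zero, map_neg]
    rw [wedge_swap b' b, wedge_swap a' a]
    abel
  · rw [lie_wedge, key, key]
    simp [*, two_nsmul]
  · rw [lie_wedge, key, key]
    simp [*, two_nsmul]

/-- The short root case, where `b` is an anisotropic vector such as `u`. The normalisation `(b, b) =
2` accounts for the factor `2` in `h`. -/
theorem isSl2Triple_wedge_short {a b a' : Unit ⊕ Fin n ⊕ Fin n → ℂ}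
    (haa : form n a a = 0) (hab : form n a b = 0) (hbb : form n b b = 2)
    (haa' : form n a' a' = 0) (h1 : form n a a' = 1) (h3 : form n b a' = 0) :
    IsSl2Triple ((2 : ℂ) • wedge n a' a) (-wedge n a' b) (wedge n a b) := by
  have hba := form_comm b a
  have h1' := form_comm a' a
  have h3' := form_comm a' b
  have key : ∀ x, ((2 : ℂ) • wedge n a' a).1.mulVec x =
      (2 : ℂ) • (form n a x • a' - form n a' x • a) := fun x => by
    simp only [SO_mulVec_smul, wedge_mulVec]
  refine ⟨fun h => ?_, ?_, ?_, ?_⟩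
  · have h0 := key a'
    rw [h] at h0
    simp only [h1, haa'] at h0
    have h5 : a' = 0 := by simpa using h0.symm
    rw [h5, map_zero] at h1
    exact zero_ne_one h1
  · rw [lie_wedge, SO_mulVec_neg, SO_mulVec_neg, wedge_mulVec, wedge_mulVec]
    simp [*, wedge_self]
    rw [wedge_swap a a']
    simp
  · rw [lie_neg, lie_wedge, key, key]
    simp [*, two_smul]
  · rw [lie_wedge, key, key]
    simp [*, two_smul]

end Wedge

/-! ### An ordered weight basis of the standard representation -/

section Basis

variable {n : ℕ}

/-- The position of an index in the order `f_1, …, f_n, u, e_n, …, e_1` of the basis of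
`ℂ^{2n+1}`. -/
def pos : Unit ⊕ Fin n ⊕ Fin n → ℕ :=
  Sum.elim (fun _ => n + 1) (Sum.elim (fun k => 2 * n + 1 - k) fun k => k + 1)

/-- The `k`-th basis vector in the order `f_1, …, f_n, u, e_n, …, e_1`; it is zero unless
`1 ≤ k ≤ 2n+1`. -/
noncomputable def vec (n k : ℕ) : Unit ⊕ Fin n ⊕ Fin n → ℂ := fun a => if pos a = k then 1 else 0

/-- The weight of `vec n k`. -/
noncomputable def vecWt (n k : ℕ) : Fin n → ℝ := eps n (2 * n + 2 - k) - eps n k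

theorem pos_mem (a : Unit ⊕ Fin n ⊕ Fin n) : 1 ≤ pos a ∧ pos a ≤ 2 * n + 1 := by
  rcases a with a | a | a <;> simp [pos] <;> omega

theorem pos_injective : Function.Injective (pos (n := n)) := by
  intro a b h
  rcases a with a | a | a <;> rcases b with b | b | b <;>
    simp only [pos, Sum.elim_inl, Sum.elim_inr] at h
  · rfl
  · omega
  · omega
  · omega
  · congr 2; omega
  · omega
  · omega
  · omega
  · congr 2; omega

theorem exists_pos_eq {k : ℕ} (h1 : 1 ≤ k) (h2 : k ≤ 2 * n + 1) :
    ∃ a : Unit ⊕ Fin n ⊕ Fin n, pos a = k := by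
  rcases lt_trichotomy k (n + 1) with h | h | h
  · exact ⟨Sum.inr (Sum.inr ⟨k - 1, by omega⟩), by simp [pos]; omega⟩
  · exact ⟨Sum.inl (), by simp [pos, h]⟩
  · exact ⟨Sum.inr (Sum.inl ⟨2 * n + 1 - k, by omega⟩), by simp [pos]; omega⟩

theorem vec_pos (a : Unit ⊕ Fin n ⊕ Fin n) : vec n (pos a) = Pi.single a 1 := by
  funext b
  simp [vec, Pi.single_apply, pos_injective.eq_iff]

theorem form_vec_pos (a b : Unit ⊕ Fin n ⊕ Fin n) :
    form n (vec n (pos a)) (vec n (pos b)) = LieAlgebra.Orthogonal.JB (Fin n) ℂ a b := by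
  rw [vec_pos, vec_pos, form_apply]
  simp

theorem form_vec {k l : ℕ} (hk : 1 ≤ k) (hk' : k ≤ 2 * n + 1) (hl : 1 ≤ l)
    (hl' : l ≤ 2 * n + 1) :
    form n (vec n k) (vec n l) =
      if k + l = 2 * n + 2 then (if k = n + 1 then 2 else 1) else 0 := by
  obtain ⟨a, rfl⟩ := exists_pos_eq hk hk'
  obtain ⟨b, rfl⟩ := exists_pos_eq hl hl'
  rw [form_vec_pos]
  rcases a with a | a | a <;> rcases b with b | b | b <;>
    simp only [pos, Sum.elim_inl, Sum.elim_inr, LieAlgebra.Orthogonal.JB,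
      LieAlgebra.Orthogonal.JD, Matrix.fromBlocks_apply₁₁, Matrix.fromBlocks_apply₁₂,
      Matrix.fromBlocks_apply₂₁, Matrix.fromBlocks_apply₂₂, Matrix.smul_apply, Matrix.zero_apply,
      Matrix.one_apply, Fin.ext_iff, smul_eq_mul] <;>
    grind

theorem stdWt_eq_vecWt (a : Unit ⊕ Fin n ⊕ Fin n) : stdWt a = vecWt n (pos a) := by
  have h0 : ∀ k, n < k → eps n k = 0 := fun k hk => by
    funext j
    have := j.2
    simp [eps]
    omega
  rcases a with a | a | a
  · simp [stdWt, vecWt, pos, h0, show 2 * n + 2 - (n + 1) = n + 1 by omega]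
  · have := a.2
    simp only [stdWt, vecWt, pos, Sum.elim_inl, Sum.elim_inr]
    rw [h0 (2 * n + 1 - a) (by omega), sub_zero]
    congr 1
    omega
  · have := a.2
    simp only [stdWt, vecWt, pos, Sum.elim_inr]
    rw [h0 (2 * n + 2 - (a + 1)) (by omega), zero_sub]

theorem vecWt_dual {k : ℕ} (hk : k ≤ 2 * n + 2) : vecWt n (2 * n + 2 - k) = -vecWt n k := by
  rw [vecWt, vecWt, show 2 * n + 2 - (2 * n + 2 - k) = k by omega, neg_sub]

theorem cartanElt_mulVec_vec (t : Fin n → ℂ) {k : ℕ} (hk : 1 ≤ k) (hk' : k ≤ 2 * n + 1) :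
    (cartanElt t).1.mulVec (vec n k) = evalWt (vecWt n k) t • vec n k := by
  obtain ⟨a, rfl⟩ := exists_pos_eq hk hk'
  rw [vec_pos, cartanElt_coe, ← stdWt_eq_vecWt]
  funext b
  rw [Matrix.mulVec_diagonal]
  by_cases h : b = a
  · simp [h]
  · simp [h]

theorem wedge_mem_rootSpace {k l : ℕ} (hk : 1 ≤ k) (hk' : k ≤ 2 * n + 1) (hl : 1 ≤ l)
    (hl' : l ≤ 2 * n + 1) :
    wedge n (vec n k) (vec n l) ∈ rootSpace (vecWt n k + vecWt n l) := fun t => by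
  rw [lie_wedge, cartanElt_mulVec_vec t hk hk', cartanElt_mulVec_vec t hl hl', evalWt_add,
    map_smul, LinearMap.smul_apply, map_smul, add_smul]

/-- The linear form `(dualVec a, ·)` is the coordinate at `a`. -/
noncomputable def dualVec (a : Unit ⊕ Fin n ⊕ Fin n) : Unit ⊕ Fin n ⊕ Fin n → ℂ :=
  (if pos a = n + 1 then 2⁻¹ else 1 : ℂ) • vec n (2 * n + 2 - pos a)

theorem eq_sum_vec (x : Unit ⊕ Fin n ⊕ Fin n → ℂ) : x = ∑ a, x a • vec n (pos a) := by
  simp only [vec_pos]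
  exact pi_eq_sum_univ' x

theorem form_dualVec_vec (a b : Unit ⊕ Fin n ⊕ Fin n) :
    form n (dualVec a) (vec n (pos b)) = if a = b then 1 else 0 := by
  have ha := pos_mem a
  have hb := pos_mem b
  rw [dualVec, map_smul, LinearMap.smul_apply, form_vec (by omega) (by omega) hb.1 hb.2]
  simp only [← pos_injective.eq_iff (a := a)]
  split_ifs <;> first | omega | simp

theorem form_dualVec (a : Unit ⊕ Fin n ⊕ Fin n) (x : Unit ⊕ Fin n ⊕ Fin n → ℂ) :
    form n (dualVec a) x = x a := by
  conv_lhs => rw [eq_sum_vec x]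
  simp only [map_sum, map_smul, form_dualVec_vec, smul_eq_mul, mul_ite, mul_one, mul_zero,
    Finset.sum_ite_eq, Finset.mem_univ, if_true]

theorem sum_form_smul_dualVec (x : Unit ⊕ Fin n ⊕ Fin n → ℂ) :
    ∑ a, form n (vec n (pos a)) x • dualVec a = x := by
  funext b
  have h : ∀ a, dualVec a b = dualVec b a := fun a => by
    rw [← form_dualVec b (dualVec a), form_comm, form_dualVec]
  rw [Finset.sum_apply, ← form_dualVec b x]
  conv_rhs => rw [eq_sum_vec (dualVec b), map_sum, LinearMap.sum_apply]
  refine Finset.sum_congr rfl fun a _ => ?_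
  rw [Pi.smul_apply, h, map_smul, LinearMap.smul_apply, smul_eq_mul, smul_eq_mul, mul_comm]

/-- In the value of the sum at `x`, one half of each wedge adds up to `Mx` by expanding `x` in the
basis, the other half adds up to `Mx` by skewness of `M`; hence the factor `1/2`. -/
theorem SO_eq_sum (M : SO n) :
    M = (2⁻¹ : ℂ) • ∑ a, wedge n (M.1.mulVec (vec n (pos a))) (dualVec a) := by
  refine SO_ext fun x => ?_
  have h1 : ∀ z, ∀ f : (Unit ⊕ Fin n ⊕ Fin n) → SO n,
      (∑ a, f a).1.mulVec z = ∑ a, (f a).1.mulVec z := fun z f => by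
    let φ : SO n →+ (Unit ⊕ Fin n ⊕ Fin n → ℂ) :=
      ⟨⟨fun M => M.1.mulVec z, Matrix.zero_mulVec z⟩, fun M M' => SO_mulVec_add M M' z⟩
    exact map_sum φ f _
  rw [SO_mulVec_smul, h1]
  simp only [wedge_mulVec, form_dualVec, form_mulVec_left, neg_smul, sub_neg_eq_add,
    Finset.sum_add_distrib, sum_form_smul_dualVec, ← Matrix.mulVec_smul]
  rw [← Matrix.mulVec_sum, ← eq_sum_vec, ← two_smul ℂ, smul_smul]
  norm_num

theorem SO_eq_double_sum (M : SO n) :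
    M = (2⁻¹ : ℂ) • ∑ a, ∑ c, M.1 c a • wedge n (vec n (pos c)) (dualVec a) := by
  conv_lhs => rw [SO_eq_sum M]
  congr 1
  refine Finset.sum_congr rfl fun a _ => ?_
  conv_lhs => rw [eq_sum_vec (M.1.mulVec (vec n (pos a)))]
  rw [map_sum, LinearMap.sum_apply]
  refine Finset.sum_congr rfl fun c _ => ?_
  rw [map_smul, LinearMap.smul_apply, vec_pos a]
  simp

theorem eq_top_of_wedge_mem (S : Submodule ℂ (SO n))
    (h : ∀ k l, 1 ≤ k → k < l → l ≤ 2 * n + 1 → wedge n (vec n k) (vec n l) ∈ S) : S = ⊤ := by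
  refine eq_top_iff.2 fun M _ => ?_
  rw [SO_eq_double_sum M]
  refine S.smul_mem _ (S.sum_mem fun a _ => S.sum_mem fun c _ => S.smul_mem _ ?_)
  rw [dualVec, map_smul]
  refine S.smul_mem _ ?_
  have ha := pos_mem a
  have hc := pos_mem c
  rcases lt_trichotomy (pos c) (2 * n + 2 - pos a) with h1 | h1 | h1
  · exact h _ _ hc.1 h1 (by omega)
  · rw [h1, wedge_self]
    exact S.zero_mem
  · rw [wedge_swap]
    exact S.neg_mem (h _ _ (by omega) h1 hc.2)

theorem vecWt_apply (k : ℕ) (j : Fin n) :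
    vecWt n k j = (if (j : ℕ) + 1 = 2 * n + 2 - k then 1 else 0) -
      if (j : ℕ) + 1 = k then 1 else 0 := rfl

theorem vecWt_eq_neg_one {k : ℕ} {j : Fin n} : vecWt n k j = -1 ↔ k = j + 1 := by
  have := j.2
  rw [vecWt_apply]
  by_cases h1 : (j : ℕ) + 1 = 2 * n + 2 - k
  · rw [if_pos h1, if_neg (by omega)]
    norm_num
    omega
  · by_cases h2 : (j : ℕ) + 1 = k
    · rw [if_neg h1, if_pos h2]
      norm_num [h2]
    · rw [if_neg h1, if_neg h2]
      norm_num
      omega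

theorem vecWt_eq_one {k : ℕ} {j : Fin n} : vecWt n k j = 1 ↔ k + j = 2 * n + 1 := by
  have := j.2
  rw [vecWt_apply]
  by_cases h1 : (j : ℕ) + 1 = 2 * n + 2 - k
  · rw [if_pos h1, if_neg (by omega)]
    norm_num
    omega
  · by_cases h2 : (j : ℕ) + 1 = k
    · rw [if_neg h1, if_pos h2]
      norm_num
      omega
    · rw [if_neg h1, if_neg h2]
      norm_num
      omega

theorem vecWt_cases (k : ℕ) (j : Fin n) :
    vecWt n k j = 1 ∨ vecWt n k j = -1 ∨ vecWt n k j = 0 := by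
  rw [vecWt_apply]
  by_cases h1 : (j : ℕ) + 1 = 2 * n + 2 - k <;> by_cases h2 : (j : ℕ) + 1 = k
  · rw [if_pos h1, if_pos h2]; norm_num
  · rw [if_pos h1, if_neg h2]; norm_num
  · rw [if_neg h1, if_pos h2]; norm_num
  · rw [if_neg h1, if_neg h2]; norm_num

theorem vecWt_injective {k l : ℕ} (hk : 1 ≤ k) (hk' : k ≤ 2 * n + 1) (hl : 1 ≤ l)
    (hl' : l ≤ 2 * n + 1) (h : vecWt n k = vecWt n l) : k = l := by
  have key : ∀ k l, 1 ≤ k → k ≤ 2 * n + 1 → vecWt n k = vecWt n l → k ≠ n + 1 → k = l := by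
    intro k l hk hk' h hne
    rcases lt_or_gt_of_ne hne with h1 | h1
    · have h2 := (vecWt_eq_neg_one (n := n) (k := k) (j := ⟨k - 1, by omega⟩)).2
        (by simp only; omega)
      rw [h, vecWt_eq_neg_one] at h2
      simp only at h2
      omega
    · have h2 := (vecWt_eq_one (n := n) (k := k) (j := ⟨2 * n + 1 - k, by omega⟩)).2
        (by simp only; omega)
      rw [h, vecWt_eq_one] at h2
      simp only at h2
      omega
  by_cases h1 : k = n + 1
  · by_cases h2 : l = n + 1
    · rw [h1, h2]
    · exact (key l k hl hl' h.symm h2).symm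
  · exact key k l hk hk' h h1

/-- Here `p ≤ n`, and `v_p` is the only basis vector whose weight has `p`-th coordinate `-1`. The
right-hand side has coordinate `-1` there because `v_q` contributes `0`, so one of `k, l` must be
`p`. -/
theorem pair_of_vecWt_add {k l p q : ℕ} (hk : 1 ≤ k) (hk' : k ≤ 2 * n + 1) (hl : 1 ≤ l)
    (hl' : l ≤ 2 * n + 1) (hp : 1 ≤ p) (hpq : p < q) (hq : p + q < 2 * n + 2)
    (h : vecWt n k + vecWt n l = vecWt n p + vecWt n q) : k = p ∧ l = q ∨ k = q ∧ l = p := by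
  have h1 := congrFun h ⟨p - 1, by omega⟩
  rw [Pi.add_apply, Pi.add_apply, vecWt_eq_neg_one.2 (by simp only [Nat.sub_add_cancel hp] :
    p = ((⟨p - 1, _⟩ : Fin n) : ℕ) + 1)] at h1
  have e0 : vecWt n q ⟨p - 1, by omega⟩ = 0 := by
    rcases vecWt_cases (n := n) q ⟨p - 1, by omega⟩ with e | e | e
    · rw [vecWt_eq_one] at e
      simp only at e
      omega
    · rw [vecWt_eq_neg_one] at e
      simp only at e
      omega
    · exact e
  have h2 : k = p ∨ l = p := by
    by_contra! h3
    have n1 : vecWt n k ⟨p - 1, by omega⟩ ≠ -1 := fun e => by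
      rw [vecWt_eq_neg_one] at e
      simp only at e
      omega
    have n2 : vecWt n l ⟨p - 1, by omega⟩ ≠ -1 := fun e => by
      rw [vecWt_eq_neg_one] at e
      simp only at e
      omega
    rcases vecWt_cases (n := n) k ⟨p - 1, by omega⟩ with e | e | e <;>
      rcases vecWt_cases (n := n) l ⟨p - 1, by omega⟩ with e' | e' | e' <;>
      first
        | exact n1 e
        | exact n2 e'
        | (rw [e, e', e0] at h1
           norm_num at h1)
  rcases h2 with rfl | rfl
  · exact Or.inl ⟨rfl, vecWt_injective hl hl' (by omega) (by omega) (add_left_cancel h)⟩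
  · rw [add_comm] at h
    exact Or.inr ⟨vecWt_injective hk hk' (by omega) (by omega) (add_left_cancel h), rfl⟩

/-- The second index of a positive root: `x_{-β}` is a multiple of
`vec n b.fst ∧ vec n b.snd`. -/
def PosRoot.snd (b : PosRoot n) : ℕ := 2 * n + 1 - b.1.2

theorem PosRoot.bounds (b : PosRoot n) :
    1 ≤ b.1.1 ∧ b.1.1 < b.snd ∧ b.1.1 + b.snd < 2 * n + 2 ∧ b.snd + b.1.2 = 2 * n + 1 := by
  have h := b.2
  rw [PosRoot.snd]
  omega

theorem exists_posRoot {p q : ℕ} (hp : 1 ≤ p) (hpq : p < q) (hq : p + q < 2 * n + 2) :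
    ∃ b : PosRoot n, b.1.1 = p ∧ b.snd = q :=
  ⟨⟨(p, 2 * n + 1 - q), by simp only; omega⟩, rfl, by simp only [PosRoot.snd]; omega⟩

theorem PosRoot.ext' {b c : PosRoot n} (h1 : b.1.1 = c.1.1) (h2 : b.snd = c.snd) : b = c := by
  have := b.bounds
  have := c.bounds
  exact Subtype.ext (Prod.ext h1 (by omega))

theorem neg_root_eq (b : PosRoot n) : -b.root = vecWt n b.1.1 + vecWt n b.snd := by
  have h0 : ∀ k, n < k → eps n k = 0 := fun k hk => by
    funext j
    have := j.2
    simp [eps]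
    omega
  have hb := b.2
  have hb' := b.bounds
  rw [PosRoot.root, vecWt, vecWt, h0 (2 * n + 2 - b.1.1) (by omega)]
  rcases hb.2 with ⟨h1, h2⟩ | ⟨h1, h2⟩
  · rw [rootVec_of_le h1 h2, h0 b.snd (by omega),
      show 2 * n + 2 - b.snd = b.1.2 + 1 by omega]
    abel
  · rw [rootVec_of_lt h1 h2, h0 (2 * n + 2 - b.snd) (by omega),
      show b.snd = 2 * n - b.1.2 + 1 by omega]
    abel

/-- The standard root vector of weight `-β`. -/
noncomputable def PosRoot.vector (b : PosRoot n) : SO n := wedge n (vec n b.1.1) (vec n b.snd)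

theorem PosRoot.vector_mem (b : PosRoot n) : b.vector ∈ rootSpace (-b.root) := by
  have hb := b.bounds
  rw [neg_root_eq]
  exact wedge_mem_rootSpace (by omega) (by omega) (by omega) (by omega)

theorem wedge_dual_mem_rootSpace (b : PosRoot n) :
    wedge n (vec n (2 * n + 2 - b.1.1)) (vec n (2 * n + 2 - b.snd)) ∈ rootSpace b.root := by
  have hb := b.bounds
  have := wedge_mem_rootSpace (n := n) (k := 2 * n + 2 - b.1.1) (l := 2 * n + 2 - b.snd)
    (by omega) (by omega) (by omega) (by omega)
  rwa [vecWt_dual (by omega), vecWt_dual (by omega), ← neg_add, ← neg_root_eq, neg_neg] at this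

/-- Negative root spaces are lines: a nonzero matrix entry of `M` determines a pair of basis vectors
of total weight `-β`, and only one unordered pair has this weight. This lets arbitrary root vectors
be compared with the standard ones. -/
theorem exists_eq_smul_vector (b : PosRoot n) {M : SO n} (hM : M ∈ rootSpace (-b.root)) :
    ∃ c : ℂ, M = c • b.vector := by
  suffices h : M ∈ Submodule.span ℂ {b.vector} by
    obtain ⟨c, hc⟩ := Submodule.mem_span_singleton.1 h
    exact ⟨c, hc.symm⟩
  have hb := b.bounds
  rw [SO_eq_double_sum M]
  refine Submodule.smul_mem _ _ (Submodule.sum_mem _ fun a _ => Submodule.sum_mem _ fun c _ => ?_)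
  by_cases h0 : M.1 c a = 0
  · rw [h0, zero_smul]
    exact Submodule.zero_mem _
  refine Submodule.smul_mem _ _ ?_
  rw [dualVec, map_smul]
  refine Submodule.smul_mem _ _ ?_
  have h1 := stdWt_of_mem_rootSpace hM h0
  have ha := pos_mem a
  have hc := pos_mem c
  rw [stdWt_eq_vecWt, stdWt_eq_vecWt, neg_root_eq] at h1
  have h2 : vecWt n (pos c) + vecWt n (2 * n + 2 - pos a) = vecWt n b.1.1 + vecWt n b.snd := by
    rw [vecWt_dual (by omega), h1]
    abel
  rcases pair_of_vecWt_add hc.1 hc.2 (by omega) (by omega) hb.1 hb.2.1 hb.2.2.1 h2 with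
    ⟨h3, h4⟩ | ⟨h3, h4⟩
  · rw [h3, h4]
    exact Submodule.mem_span_singleton_self _
  · rw [h3, h4, wedge_swap]
    exact Submodule.neg_mem _ (Submodule.mem_span_singleton_self _)

theorem wedge_dual_eq_cartanElt {k : ℕ} (hk : 1 ≤ k) (hk' : k ≤ n) :
    wedge n (vec n (2 * n + 2 - k)) (vec n k) = cartanElt (Pi.single ⟨k - 1, by omega⟩ 1) := by
  refine SO_ext fun x => ?_
  have h : ∀ b, (wedge n (vec n (2 * n + 2 - k)) (vec n k)).1.mulVec (vec n (pos b)) =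
      (cartanElt (Pi.single ⟨k - 1, by omega⟩ 1)).1.mulVec (vec n (pos b)) := fun b => by
    have hb := pos_mem b
    rw [wedge_mulVec, cartanElt_mulVec_vec _ hb.1 hb.2, form_vec hk (by omega) hb.1 hb.2,
      form_vec (by omega) (by omega) hb.1 hb.2]
    have h1 : evalWt (vecWt n (pos b)) (Pi.single ⟨k - 1, by omega⟩ 1) =
        (vecWt n (pos b) ⟨k - 1, by omega⟩ : ℂ) := by
      simp [evalWt, Pi.single_apply]
    rw [h1, vecWt_apply]
    simp only
    by_cases h2 : pos b = k
    · simp [h2]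
      split_ifs <;> first | omega | simp
    · by_cases h3 : pos b = 2 * n + 2 - k
      · simp [h3]
        split_ifs <;> first | omega | simp
      · split_ifs <;> first | omega | simp
  conv_lhs => rw [eq_sum_vec x]
  conv_rhs => rw [eq_sum_vec x]
  simp only [Matrix.mulVec_sum, Matrix.mulVec_smul, h]

end Basis

/-! ### The action of the parabolic subalgebra on the highest weight vector -/

section HighestWeight

variable {n m i : ℕ} {V : Type*} [AddCommGroup V] [Module ℂ V] [LieRingModule (SO n) V]
  [LieModule ℂ (SO n) V] {v : V}

/-- The scalar `(m ω_i, ε_1)`. -/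
noncomputable def level (n m i : ℕ) : ℂ := if i = n then (m : ℂ) / 2 else m

theorem lie_cartan_highestWeight (hV : IsHighestWeightModule V ((m : ℝ) • fundWeight n i) v)
    {k : ℕ} (hk : 1 ≤ k) (hk' : k ≤ n) :
    ⁅wedge n (vec n (2 * n + 2 - k)) (vec n k), v⁆ = (if k ≤ i then level n m i else 0) • v := by
  rw [wedge_dual_eq_cartanElt hk hk', hV.weight]
  congr 1
  have h1 : evalWt ((m : ℝ) • fundWeight n i) (Pi.single ⟨k - 1, by omega⟩ 1) =
      (((m : ℝ) • fundWeight n i) ⟨k - 1, by omega⟩ : ℂ) := by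
    simp [evalWt, Pi.single_apply]
  rw [h1, Pi.smul_apply, fundWeight, level]
  by_cases h2 : k ≤ i
  · rw [if_pos (by simp only; omega), if_pos h2]
    split_ifs <;> simp [div_eq_mul_inv]
  · rw [if_neg (by simp only; omega), if_neg h2]
    simp

theorem lie_pos_highestWeight {μ : Fin n → ℝ} (hV : IsHighestWeightModule V μ v) {k l : ℕ}
    (hk' : k ≤ 2 * n + 1) (hl' : l ≤ 2 * n + 1)
    (h : 2 * n + 2 < k + l) : ⁅wedge n (vec n k) (vec n l), v⁆ = 0 := by
  have key : ∀ k l, k ≤ 2 * n + 1 → l ≤ 2 * n + 1 → 2 * n + 2 < k + l → l < k →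
      ⁅wedge n (vec n k) (vec n l), v⁆ = 0 := by
    intro k l hk hl h hlk
    obtain ⟨b, hb1, hb2⟩ := exists_posRoot (n := n) (p := 2 * n + 2 - k) (q := 2 * n + 2 - l)
      (by omega) (by omega) (by omega)
    have := hV.nPlus b _ (wedge_dual_mem_rootSpace b)
    rwa [hb1, hb2, show 2 * n + 2 - (2 * n + 2 - k) = k by omega,
      show 2 * n + 2 - (2 * n + 2 - l) = l by omega] at this
  rcases lt_trichotomy k l with h1 | h1 | h1
  · rw [wedge_swap, neg_lie, key l k hl' hk' (by omega) h1, neg_zero]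
  · rw [h1, wedge_self, zero_lie]
  · exact key k l hk' hl' h h1

theorem pow_toEnd_highestWeight {μ : Fin n → ℝ} (hV : IsHighestWeightModule V μ v) {h e f : SO n}
    (t : IsSl2Triple h e f) (N : ℕ) (hh : ⁅h, v⁆ = (N : ℂ) • v) (he : ⁅e, v⁆ = 0) {d : ℕ}
    (hd : N < d) : (LieModule.toEnd ℂ (SO n) V f ^ d) v = 0 := by
  have := hV.finite
  have P : IsSl2Triple.HasPrimitiveVectorWith t v (N : ℂ) := ⟨hV.ne_zero, hh, he⟩
  have h0 := P.pow_toEnd_f_eq_zero_of_eq_nat rfl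
  obtain ⟨k, rfl⟩ : ∃ k, d = k + (N + 1) := ⟨d - (N + 1), by omega⟩
  rw [pow_add, Module.End.mul_apply, h0, map_zero]

theorem lie_sl2_highestWeight {μ : Fin n → ℝ} (hV : IsHighestWeightModule V μ v) {h e f : SO n}
    (t : IsSl2Triple h e f) (hh : ⁅h, v⁆ = 0) (he : ⁅e, v⁆ = 0) : ⁅f, v⁆ = 0 := by
  simpa using pow_toEnd_highestWeight hV t 0 (by simpa using hh) he one_pos

theorem lie_neg_highestWeight (hV : IsHighestWeightModule V ((m : ℝ) • fundWeight n i) v)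
    (hin : i ≤ n) {k l : ℕ} (hk : 1 ≤ k) (hkl : k < l) (hl : k + l < 2 * n + 2)
    (h : i < k ∨ 2 * n + 1 < l + i) : ⁅wedge n (vec n k) (vec n l), v⁆ = 0 := by
  have hc := fun k hk hk' => lie_cartan_highestWeight hV (k := k) hk hk'
  have hp := fun k l hk hl h => lie_pos_highestWeight hV (k := k) (l := l) hk hl h
  by_cases hs : l = n + 1
  · subst hs
    have t := isSl2Triple_wedge_short (n := n) (a := vec n k) (b := vec n (n + 1))
      (a' := vec n (2 * n + 2 - k))
      (by rw [form_vec (by omega) (by omega) (by omega) (by omega), if_neg (by omega)])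
      (by rw [form_vec (by omega) (by omega) (by omega) (by omega), if_neg (by omega)])
      (by rw [form_vec (by omega) (by omega) (by omega) (by omega), if_pos (by omega), if_pos rfl])
      (by rw [form_vec (by omega) (by omega) (by omega) (by omega), if_neg (by omega)])
      (by rw [form_vec (by omega) (by omega) (by omega) (by omega), if_pos (by omega),
        if_neg (by omega)])
      (by rw [form_vec (by omega) (by omega) (by omega) (by omega), if_neg (by omega)])
    refine lie_sl2_highestWeight hV t ?_ ?_
    · rw [smul_lie, hc k (by omega) (by omega), if_neg (by omega), zero_smul, smul_zero]
    · rw [neg_lie, hp _ _ (by omega) (by omega) (by omega), neg_zero]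
  · have t := isSl2Triple_wedge (n := n) (a := vec n k) (b := vec n l)
      (a' := vec n (2 * n + 2 - k)) (b' := vec n (2 * n + 2 - l))
      (by rw [form_vec (by omega) (by omega) (by omega) (by omega), if_neg (by omega)])
      (by rw [form_vec (by omega) (by omega) (by omega) (by omega), if_neg (by omega)])
      (by rw [form_vec (by omega) (by omega) (by omega) (by omega), if_neg (by omega)])
      (by rw [form_vec (by omega) (by omega) (by omega) (by omega), if_neg (by omega)])
      (by rw [form_vec (by omega) (by omega) (by omega) (by omega), if_neg (by omega)])
      (by rw [form_vec (by omega) (by omega) (by omega) (by omega), if_neg (by omega)])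
      (by rw [form_vec (by omega) (by omega) (by omega) (by omega), if_pos (by omega),
        if_neg (by omega)])
      (by rw [form_vec (by omega) (by omega) (by omega) (by omega), if_neg (by omega)])
      (by rw [form_vec (by omega) (by omega) (by omega) (by omega), if_neg (by omega)])
      (by rw [form_vec (by omega) (by omega) (by omega) (by omega), if_pos (by omega),
        if_neg (by omega)])
    refine lie_sl2_highestWeight hV t ?_ (hp _ _ (by omega) (by omega) (by omega))
    rw [add_lie, hc k (by omega) (by omega)]
    rcases lt_or_gt_of_ne hs with h1 | h1
    · rw [hc l (by omega) (by omega), if_neg (by omega), if_neg (by omega), zero_smul, add_zero]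
    -- For `l > n + 1` the vector `v_l` is `e_{l'}` with `l' = 2n+2-l`, so its Cartan term enters
    -- with the opposite sign. The hypotheses put `k` and `l'` on the same side of `i`, and the two
    -- scalars cancel or both vanish.
    · have h2 := hc (2 * n + 2 - l) (by omega) (by omega)
      rw [show 2 * n + 2 - (2 * n + 2 - l) = l by omega] at h2
      rw [wedge_swap, neg_lie, h2]
      by_cases h3 : k ≤ i
      · rw [if_pos h3, if_pos (by omega), add_neg_cancel]
      · rw [if_neg h3, if_neg (by omega), zero_smul, neg_zero, add_zero]

/-- The span of `e_1, …, e_i`. -/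
noncomputable def dualIsotropic (n i : ℕ) : Submodule ℂ (Unit ⊕ Fin n ⊕ Fin n → ℂ) :=
  Submodule.span ℂ {a | ∃ k, 1 ≤ k ∧ k ≤ i ∧ a = vec n (2 * n + 2 - k)}

/-- The span of the basis vectors orthogonal to `e_1, …, e_i`, `f_1, …, f_i`. -/
noncomputable def leviPart (n i : ℕ) : Submodule ℂ (Unit ⊕ Fin n ⊕ Fin n → ℂ) :=
  Submodule.span ℂ {a | ∃ k, i < k ∧ k + i ≤ 2 * n + 1 ∧ a = vec n k}

/-- For `k ≤ i`, `e_k ∧ v_l` is a positive root vector, a Cartan element, or a negative root vector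
whose root omits `α_i`. Only the Cartan case `v_l = f_k` acts nontrivially, which is what the form
detects. Consequently a bivector may be altered by terms with a factor in `⟨e_1, …, e_i⟩` without
leaving its class modulo the stabilizer. -/
theorem lie_wedge_dualIsotropic (hV : IsHighestWeightModule V ((m : ℝ) • fundWeight n i) v)
    (hin : i ≤ n) {a : Unit ⊕ Fin n ⊕ Fin n → ℂ} (ha : a ∈ dualIsotropic n i)
    (y : Unit ⊕ Fin n ⊕ Fin n → ℂ) :
    ⁅wedge n a y, v⁆ = (level n m i * form n a y) • v := by
  induction ha using Submodule.span_induction with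
  | zero => simp
  | add a b _ _ ha hb => simp only [map_add, LinearMap.add_apply, add_lie, ha, hb, mul_add, add_smul]
  | smul c a _ ha =>
    simp only [map_smul, LinearMap.smul_apply, smul_lie, ha, smul_smul, smul_eq_mul]
    ring_nf
  | mem a ha =>
    obtain ⟨k, hk, hki, rfl⟩ := ha
    suffices h : ∀ l, 1 ≤ l → l ≤ 2 * n + 1 → ⁅wedge n (vec n (2 * n + 2 - k)) (vec n l), v⁆ =
        (level n m i * form n (vec n (2 * n + 2 - k)) (vec n l)) • v by
      rw [eq_sum_vec y]
      simp only [map_sum, map_smul, sum_lie, smul_lie]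
      rw [Finset.mul_sum, Finset.sum_smul]
      refine Finset.sum_congr rfl fun b _ => ?_
      rw [h _ (pos_mem b).1 (pos_mem b).2, smul_smul, smul_eq_mul]
      ring_nf
    intro l hl hl'
    rw [form_vec (by omega) (by omega) hl hl']
    rcases lt_trichotomy l k with h | h | h
    · rw [wedge_swap, neg_lie, lie_neg_highestWeight hV hin hl (by omega) (by omega) (by omega),
        if_neg (by omega)]
      simp
    · rw [h, lie_cartan_highestWeight hV hk (by omega), if_pos hki, if_pos (by omega),
        if_neg (by omega), mul_one]
    · rw [lie_pos_highestWeight hV (by omega) hl' (by omega), if_neg (by omega)]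
      simp

/-- These bivectors form the smaller orthogonal Lie algebra inside the Levi subalgebra, on whose
Cartan subalgebra the weight `m ω_i` vanishes. -/
theorem lie_wedge_leviPart (hV : IsHighestWeightModule V ((m : ℝ) • fundWeight n i) v)
    (hin : i ≤ n) {a b : Unit ⊕ Fin n ⊕ Fin n → ℂ} (ha : a ∈ leviPart n i)
    (hb : b ∈ leviPart n i) : ⁅wedge n a b, v⁆ = 0 := by
  have key : ∀ k l, i < k → l + i ≤ 2 * n + 1 → k < l →
      ⁅wedge n (vec n k) (vec n l), v⁆ = 0 := by
    intro k l hk hl hkl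
    rcases lt_trichotomy (k + l) (2 * n + 2) with h | h | h
    · exact lie_neg_highestWeight hV hin (by omega) hkl h (Or.inl hk)
    · have h1 := lie_cartan_highestWeight hV (k := k) (by omega) (by omega)
      rw [if_neg (by omega), zero_smul, show 2 * n + 2 - k = l by omega] at h1
      rw [wedge_swap, neg_lie, h1, neg_zero]
    · exact lie_pos_highestWeight hV (by omega) (by omega) h
  induction ha using Submodule.span_induction with
  | zero => simp
  | add a b _ _ ha hb => simp only [map_add, LinearMap.add_apply, add_lie, ha, hb, add_zero]
  | smul c a _ ha => simp only [map_smul, LinearMap.smul_apply, smul_lie, ha, smul_zero]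
  | mem a ha =>
    obtain ⟨k, hk, hk', rfl⟩ := ha
    induction hb using Submodule.span_induction with
    | zero => simp
    | add a b _ _ ha hb => simp only [map_add, add_lie, ha, hb, add_zero]
    | smul c a _ ha => simp only [map_smul, smul_lie, ha, smul_zero]
    | mem a ha =>
      obtain ⟨l, hl, hl', rfl⟩ := ha
      rcases lt_trichotomy k l with h | h | h
      · exact key k l hk hl' h
      · rw [h, wedge_self, zero_lie]
      · rw [wedge_swap, neg_lie, key l k hl hk' h, neg_zero]

/-- The stabilizer in `so(2n+1)` of the line through `v`. -/
noncomputable def lineStab (n : ℕ) {V : Type*} [AddCommGroup V] [Module ℂ V]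
    [LieRingModule (SO n) V] [LieModule ℂ (SO n) V] (v : V) : Submodule ℂ (SO n) where
  carrier := {y | ∃ c : ℂ, ⁅y, v⁆ = c • v}
  zero_mem' := ⟨0, by simp⟩
  add_mem' := by
    rintro y z ⟨c, hc⟩ ⟨d, hd⟩
    exact ⟨c + d, by rw [add_lie, hc, hd, add_smul]⟩
  smul_mem' := by
    rintro r y ⟨c, hc⟩
    exact ⟨r * c, by rw [smul_lie, hc, smul_smul]⟩

/-- The Borel subalgebra stabilizes the highest weight line, so this is the triangular
decomposition. -/
theorem nMinus_sup_lineStab (hV : IsHighestWeightModule V ((m : ℝ) • fundWeight n i) v) :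
    (nMinus n).toSubmodule ⊔ lineStab n v = ⊤ := by
  refine eq_top_of_wedge_mem _ fun k l hk hkl hl => ?_
  rcases lt_trichotomy (k + l) (2 * n + 2) with h | h | h
  · refine Submodule.mem_sup_left ?_
    obtain ⟨b, hb1, hb2⟩ := exists_posRoot hk hkl h
    have := rootSpace_le_nMinus b b.vector_mem
    rwa [PosRoot.vector, hb1, hb2] at this
  · refine Submodule.mem_sup_right ?_
    rw [wedge_swap]
    refine Submodule.neg_mem _ ⟨if k ≤ i then level n m i else 0, ?_⟩
    rw [show l = 2 * n + 2 - k by omega]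
    exact lie_cartan_highestWeight hV hk (by omega)
  · exact Submodule.mem_sup_right ⟨0, by
      rw [zero_smul, lie_pos_highestWeight hV (by omega) hl h]⟩

theorem lie_vector_of_not_memR (hV : IsHighestWeightModule V ((m : ℝ) • fundWeight n i) v)
    (hin : i ≤ n) {b : PosRoot n} (hb : ¬ b.MemR i) : ⁅b.vector, v⁆ = 0 := by
  have h := b.bounds
  rw [PosRoot.MemR] at hb
  exact lie_neg_highestWeight hV hin h.1 h.2.1 h.2.2.1 (by omega)

end HighestWeight

/-! ### The associated graded module -/

section GradedAction

variable {N V : Type*} [LieRing N] [LieAlgebra ℂ N] [AddCommGroup V] [Module ℂ V]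
  [LieRingModule N V] [LieModule ℂ N V]

/-- The class in `V_s / V_{s-1} ⊆ gr V` of an element of `V_s`. -/
noncomputable def grMk (v : V) (s : ℕ) : pbwFiltration N v s →ₗ[ℂ] Gr N v :=
  DirectSum.lof ℂ ℕ (GrPiece N v) s ∘ₗ Submodule.mkQ _

theorem grAct_grMk (v : V) (s : ℕ) (y : N) (w : pbwFiltration N v s) :
    grAct v y (grMk v s w) = grMk v (s + 1) ⟨⁅y, (w : V)⁆, lie_mem_pbwFiltration v s y w.2⟩ := by
  simp only [grAct, grMk, LinearMap.comp_apply, DirectSum.toModule_lof]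
  rfl

theorem grMk_eq_zero (v : V) (s : ℕ) (w : pbwFiltration N v s) (h : (w : V) ∈ pbwPrev N v s) :
    grMk v s w = 0 := by
  have h0 : (Submodule.Quotient.mk w : GrPiece N v s) = 0 := (Submodule.Quotient.mk_eq_zero _).2 h
  rw [grMk, LinearMap.comp_apply, Submodule.mkQ_apply, h0, map_zero]

theorem gr_hom_ext {v : V} {f g : Module.End ℂ (Gr N v)}
    (h : ∀ s w, f (grMk v s w) = g (grMk v s w)) : f = g := by
  refine DirectSum.linearMap_ext ℂ fun s => LinearMap.ext fun w => ?_
  obtain ⟨w, rfl⟩ := Submodule.Quotient.mk_surjective _ w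
  exact h s w

/-- `grAct` as a linear map. -/
noncomputable def grActLinear (v : V) : N →ₗ[ℂ] Module.End ℂ (Gr N v) where
  toFun y := grAct v y
  map_add' y z := gr_hom_ext fun s w => by
    rw [LinearMap.add_apply, grAct_grMk, grAct_grMk, grAct_grMk, ← map_add]
    congr 1
    exact Subtype.ext (add_lie y z (w : V))
  map_smul' c y := gr_hom_ext fun s w => by
    rw [RingHom.id_apply, LinearMap.smul_apply, grAct_grMk, grAct_grMk, ← map_smul]
    congr 1
    exact Subtype.ext (smul_lie c y (w : V))

theorem pow_toEnd_mem_pbwFiltration (v : V) (y : N) (d : ℕ) :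
    (LieModule.toEnd ℂ N V y ^ d) v ∈ pbwFiltration N v d := by
  induction d with
  | zero => exact self_mem_pbwFiltration v 0
  | succ d ih =>
    rw [pow_succ', Module.End.mul_apply]
    exact lie_mem_pbwFiltration v d y ih

theorem grAct_pow_grVec (v : V) (y : N) (d : ℕ) :
    (grAct v y ^ d) (grVec N v) =
      grMk v d ⟨(LieModule.toEnd ℂ N V y ^ d) v, pow_toEnd_mem_pbwFiltration v y d⟩ := by
  induction d with
  | zero => rfl
  | succ d ih =>
    rw [pow_succ', Module.End.mul_apply, ih, grAct_grMk]
    congr 1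
    refine Subtype.ext ?_
    change ⁅y, (LieModule.toEnd ℂ N V y ^ d) v⁆ = (LieModule.toEnd ℂ N V y ^ (d + 1)) v
    rw [pow_succ', Module.End.mul_apply, LieModule.toEnd_apply_apply]

theorem mem_annIdeal {ι : Type*} {v : V} {x : ι → N} {P : MvPolynomial ι ℂ} :
    P ∈ annIdeal v x ↔ grRep v x P (grVec N v) = 0 := Iff.rfl

theorem grRep_linear {ι : Type*} [Fintype ι] (v : V) (x : ι → N) (c : ι → ℂ) :
    grRep v x (∑ b, MvPolynomial.C (c b) * MvPolynomial.X b) = grAct v (∑ b, c b • x b) := by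
  change _ = grActLinear v _
  rw [map_sum, map_sum]
  refine Finset.sum_congr rfl fun b _ => ?_
  rw [MvPolynomial.C_mul', map_smul, map_smul, grRep_X]
  rfl

theorem linear_pow_mem_annIdeal {ι : Type*} [Fintype ι] {v : V} {x : ι → N} {c : ι → ℂ} {d : ℕ}
    (h : (LieModule.toEnd ℂ N V (∑ b, c b • x b) ^ d) v ∈ pbwPrev N v d) :
    (∑ b, MvPolynomial.C (c b) * MvPolynomial.X b) ^ d ∈ annIdeal v x := by
  rw [mem_annIdeal, map_pow, grRep_linear, grAct_pow_grVec]
  exact grMk_eq_zero _ _ _ h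

/-- If `x` spans `N`, then `gr V` is generated by the class of `v` over `S(N)`. -/
theorem grRep_surjective {ι : Type*} [Fintype ι] (v : V) (x : ι → N)
    (hx : Submodule.span ℂ (Set.range x) = ⊤) :
    Function.Surjective fun P => grRep v x P (grVec N v) := by
  let φ : MvPolynomial ι ℂ →ₗ[ℂ] Gr N v :=
    (LinearMap.applyₗ (grVec N v)) ∘ₗ (grRep v x).toLinearMap
  have hstab : ∀ (y : N) (w : Gr N v), w ∈ LinearMap.range φ → grAct v y w ∈ LinearMap.range φ := by
    rintro y _ ⟨P, rfl⟩
    obtain ⟨c, hc⟩ := (Submodule.mem_span_range_iff_exists_fun ℂ).1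
      (hx ▸ Submodule.mem_top : y ∈ Submodule.span ℂ (Set.range x))
    refine ⟨(∑ b, MvPolynomial.C (c b) * MvPolynomial.X b) * P, ?_⟩
    change grRep v x (_ * P) (grVec N v) = grAct v y (grRep v x P (grVec N v))
    rw [map_mul, grRep_linear, hc, Module.End.mul_apply]
  have hfold : ∀ l : List N, ∀ h : l.foldr (fun y u => ⁅y, u⁆) v ∈ pbwFiltration N v l.length,
      grMk v l.length ⟨_, h⟩ ∈ LinearMap.range φ := by
    intro l
    induction l with
    | nil => exact fun _ => ⟨1, by
        change grRep v x 1 (grVec N v) = _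
        rw [map_one, Module.End.one_apply]
        rfl⟩
    | cons y l ih =>
      intro h
      have h' : l.foldr (fun y u => ⁅y, u⁆) v ∈ pbwFiltration N v l.length :=
        Submodule.subset_span ⟨l, le_rfl, rfl⟩
      have := hstab y _ (ih h')
      rw [grAct_grMk] at this
      exact this
  have hpiece : ∀ s (w : pbwFiltration N v s), grMk v s w ∈ LinearMap.range φ := by
    rintro s ⟨w, hw⟩
    have h1 : pbwFiltration N v s ≤
        ((LinearMap.range φ).comap (grMk v s)).map (pbwFiltration N v s).subtype := by
      refine Submodule.span_le.2 ?_
      rintro _ ⟨l, hl, rfl⟩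
      refine ⟨⟨_, Submodule.subset_span ⟨l, hl, rfl⟩⟩, ?_, rfl⟩
      change grMk v s _ ∈ LinearMap.range φ
      rcases hl.lt_or_eq with h | rfl
      · rw [grMk_eq_zero]
        · exact Submodule.zero_mem _
        · obtain ⟨t, rfl⟩ : ∃ t, s = t + 1 := ⟨s - 1, by omega⟩
          exact Submodule.subset_span ⟨l, by omega, rfl⟩
      · exact hfold l _
    obtain ⟨u, hu, rfl⟩ := h1 hw
    exact hu
  intro w
  have htop : w ∈ LinearMap.range φ := by
    induction w using DirectSum.induction_on with
    | zero => exact Submodule.zero_mem _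
    | of s w =>
      obtain ⟨w, rfl⟩ := Submodule.Quotient.mk_surjective _ w
      exact hpiece s w
    | add a b ha hb => exact Submodule.add_mem _ ha hb
  exact htop

end GradedAction

/-! ### From the action of the whole Lie algebra to relations in the annihilator ideal -/

section Parabolic

variable {n m i : ℕ} {V : Type*} [AddCommGroup V] [Module ℂ V] [LieRingModule (SO n) V]
  [LieModule ℂ (SO n) V] {v : V}

theorem pbwFiltration_mono {N V : Type*} [LieRing N] [LieAlgebra ℂ N] [AddCommGroup V] [Module ℂ V]
    [LieRingModule N V] [LieModule ℂ N V] (v : V) {s t : ℕ} (h : s ≤ t) :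
    pbwFiltration N v s ≤ pbwFiltration N v t :=
  Submodule.span_mono fun _ ⟨l, hl, hw⟩ => ⟨l, hl.trans h, hw⟩

theorem pbwPrev_le {N V : Type*} [LieRing N] [LieAlgebra ℂ N] [AddCommGroup V] [Module ℂ V]
    [LieRingModule N V] [LieModule ℂ N V] (v : V) (s : ℕ) :
    pbwPrev N v s ≤ pbwFiltration N v s := by
  cases s with
  | zero => exact bot_le
  | succ s => exact pbwFiltration_mono v (Nat.le_succ s)

/-- Move `y` to the right through a word in `𝔫⁻`. Each commutator splits into an element of `𝔫⁻`,
which replaces one letter, and an element of the stabilizer acting on a shorter word; at the end `y`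
multiplies `v` by a scalar. -/
theorem lineStab_lie_mem (hv : (nMinus n).toSubmodule ⊔ lineStab n v = ⊤) {s : ℕ} {y : SO n}
    (hy : y ∈ lineStab n v) {w : V} (hw : w ∈ pbwFiltration (nMinus n) v s) :
    ⁅y, w⁆ ∈ pbwFiltration (nMinus n) v s := by
  have key : ∀ l : List (nMinus n), ∀ y ∈ lineStab n v,
      ⁅y, l.foldr (fun y u => ⁅y, u⁆) v⁆ ∈ pbwFiltration (nMinus n) v l.length := by
    intro l
    induction l with
    | nil =>
      rintro y ⟨c, hc⟩
      rw [List.foldr_nil, hc]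
      exact Submodule.smul_mem _ _ (self_mem_pbwFiltration v _)
    | cons z l ih =>
      intro y hy
      have hl : l.foldr (fun y u => ⁅y, u⁆) v ∈ pbwFiltration (nMinus n) v l.length :=
        Submodule.subset_span ⟨l, le_rfl, rfl⟩
      rw [List.foldr_cons, LieSubalgebra.coe_bracket_of_module, leibniz_lie]
      refine Submodule.add_mem _ ?_ (lie_mem_pbwFiltration v l.length z (ih y hy))
      obtain ⟨a, ha, b, hb, hab⟩ := Submodule.mem_sup.1
        (hv ▸ Submodule.mem_top : ⁅y, (z : SO n)⁆ ∈ (nMinus n).toSubmodule ⊔ lineStab n v)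
      rw [← hab, add_lie]
      exact Submodule.add_mem _ (lie_mem_pbwFiltration v l.length (⟨a, ha⟩ : nMinus n) hl)
        (pbwFiltration_mono v (Nat.le_succ _) (ih b hb))
  induction hw using Submodule.span_induction with
  | mem w hw =>
    obtain ⟨l, hl, rfl⟩ := hw
    exact pbwFiltration_mono v hl (key l y hy)
  | zero => simp
  | add a b _ _ ha hb => rw [lie_add]; exact add_mem ha hb
  | smul c a _ ha => rw [lie_smul]; exact Submodule.smul_mem _ _ ha

theorem lie_mem_pbwPrev_succ (hv : (nMinus n).toSubmodule ⊔ lineStab n v = ⊤) {s : ℕ} (y : SO n)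
    {w : V} (hw : w ∈ pbwPrev (nMinus n) v s) : ⁅y, w⁆ ∈ pbwPrev (nMinus n) v (s + 1) := by
  obtain ⟨a, ha, b, hb, hab⟩ := Submodule.mem_sup.1
    (hv ▸ Submodule.mem_top : y ∈ (nMinus n).toSubmodule ⊔ lineStab n v)
  rw [← hab, add_lie]
  exact Submodule.add_mem _ (lie_mem_pbwPrev v s (⟨a, ha⟩ : nMinus n) hw)
    (lineStab_lie_mem hv hb (pbwPrev_le v s hw))

/-- Modulo lower filtration, an element of `so(2n+1)` acts as its component in `𝔫⁻`. -/
theorem pow_toEnd_sub_mem (hv : (nMinus n).toSubmodule ⊔ lineStab n v = ⊤) {y : SO n}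
    {z : nMinus n} (hyz : y - z ∈ lineStab n v) (d : ℕ) :
    (LieModule.toEnd ℂ (SO n) V y ^ d) v - (LieModule.toEnd ℂ (nMinus n) V z ^ d) v ∈
      pbwPrev (nMinus n) v d := by
  induction d with
  | zero => simp
  | succ d ih =>
    rw [pow_succ', pow_succ', Module.End.mul_apply, Module.End.mul_apply]
    set a := (LieModule.toEnd ℂ (SO n) V y ^ d) v
    set b := (LieModule.toEnd ℂ (nMinus n) V z ^ d) v with hb
    have h1 : LieModule.toEnd ℂ (SO n) V y a - LieModule.toEnd ℂ (nMinus n) V z b =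
        ⁅y, a - b⁆ + ⁅y - (z : SO n), b⁆ := by
      rw [LieModule.toEnd_apply_apply, LieModule.toEnd_apply_apply, lie_sub, sub_lie,
        LieSubalgebra.coe_bracket_of_module]
      abel
    rw [h1]
    exact Submodule.add_mem _ (lie_mem_pbwPrev_succ hv y ih)
      (lineStab_lie_mem hv hyz (pow_toEnd_mem_pbwFiltration v z d))

noncomputable instance : Fintype (PosRoot n) :=
  Set.Finite.fintype (((Set.finite_Iic (2 * n)).prod (Set.finite_Iic (2 * n))).subset
    fun b (hb : _ ∧ _) => ⟨by simp only [Set.mem_Iic]; omega, by simp only [Set.mem_Iic]; omega⟩)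

/-- The source of all relations: `f^d v = 0` by `sl₂`-theory, and modulo lower filtration `f` may be
replaced by its component `∑ c_b x_b` in `𝔫⁻`. -/
theorem linear_pow_mem_annIdeal_of_sl2
    (hV : IsHighestWeightModule V ((m : ℝ) • fundWeight n i) v) {x : PosRoot n → nMinus n}
    {c : PosRoot n → ℂ} {h e f : SO n} (t : IsSl2Triple h e f)
    (hf : f - ∑ b, c b • (x b : SO n) ∈ lineStab n v) {M : ℕ} (hh : ⁅h, v⁆ = (M : ℂ) • v)
    (he : ⁅e, v⁆ = 0) {d : ℕ} (hd : M < d) :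
    (∑ b, MvPolynomial.C (c b) * MvPolynomial.X b) ^ d ∈ annIdeal v x := by
  refine linear_pow_mem_annIdeal ?_
  have h0 := pow_toEnd_sub_mem (nMinus_sup_lineStab hV) (y := f) (z := ∑ b, c b • x b)
    (by simpa using hf) d
  rw [pow_toEnd_highestWeight hV t M hh he hd, zero_sub] at h0
  exact (Submodule.neg_mem_iff _).1 h0

theorem X_mem_annIdeal (hV : IsHighestWeightModule V ((m : ℝ) • fundWeight n i) v) (hin : i ≤ n)
    {x : PosRoot n → nMinus n} (hx : ∀ b, (x b : SO n) ∈ rootSpace (-b.root)) {b : PosRoot n}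
    (hb : ¬ b.MemR i) : MvPolynomial.X b ∈ annIdeal v x := by
  have h0 : ⁅x b, v⁆ = 0 := by
    obtain ⟨c, hc⟩ := exists_eq_smul_vector b (hx b)
    rw [LieSubalgebra.coe_bracket_of_module, hc, smul_lie, lie_vector_of_not_memR hV hin hb,
      smul_zero]
  rw [mem_annIdeal, grRep_X]
  change grAct v (x b) (grMk v 0 ⟨v, self_mem_pbwFiltration v 0⟩) = 0
  rw [grAct_grMk]
  refine grMk_eq_zero _ _ _ ?_
  simp only [h0]
  exact Submodule.zero_mem _

theorem span_range_rootVectors {x : PosRoot n → nMinus n}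
    (hx : ∀ b, (x b : SO n) ∈ rootSpace (-b.root)) (hx0 : ∀ b, x b ≠ 0) :
    Submodule.span ℂ (Set.range x) = ⊤ := by
  have h1 : (nMinus n).toSubmodule ≤
      (Submodule.span ℂ (Set.range x)).map (nMinus n).toSubmodule.subtype := by
    refine iSup_le fun b y hy => ?_
    obtain ⟨c, hc⟩ := exists_eq_smul_vector b (hx b)
    obtain ⟨d, rfl⟩ := exists_eq_smul_vector b hy
    have hc0 : c ≠ 0 := by
      rintro rfl
      exact hx0 b (Subtype.ext (by rw [hc, zero_smul]; rfl))
    refine ⟨(d * c⁻¹) • x b, Submodule.smul_mem _ _ (Submodule.subset_span ⟨b, rfl⟩), ?_⟩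
    change (d * c⁻¹) • (x b : SO n) = _
    rw [hc, smul_smul, mul_assoc, inv_mul_cancel₀ hc0, mul_one]
  refine eq_top_iff.2 fun y _ => ?_
  obtain ⟨z, hz, hzy⟩ := h1 y.2
  rwa [← Subtype.ext hzy]

end Parabolic

/-! ### The monomial order -/

section Order

variable {n : ℕ}

/-- A numbering of the positive roots which reverses the order `rootLT`. -/
def rootKey (b : PosRoot n) : ℕ := b.snd * (2 * n + 2) + b.1.1

theorem rootLT_iff {b c : PosRoot n} :
    rootLT b c ↔ c.snd < b.snd ∨ c.snd = b.snd ∧ c.1.1 < b.1.1 := by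
  have hb := b.bounds
  have hc := c.bounds
  rw [rootLT]
  omega

theorem rootLT_iff_key {b c : PosRoot n} : rootLT b c ↔ rootKey c < rootKey b := by
  have hb := b.bounds
  have hc := c.bounds
  have key : ∀ p q r s : ℕ, p < 2 * n + 2 → q < r → q * (2 * n + 2) + p < r * (2 * n + 2) + s := by
    intro p q r s hp h
    have := Nat.mul_le_mul_right (2 * n + 2) h
    rw [Nat.succ_mul] at this
    omega
  rw [rootLT_iff, rootKey, rootKey]
  constructor
  · rintro (h | ⟨h1, h2⟩)
    · exact key _ _ _ _ (by omega) h
    · rw [h1]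
      omega
  · intro h
    rcases lt_trichotomy c.snd b.snd with h1 | h1 | h1
    · exact Or.inl h1
    · rw [h1] at h
      exact Or.inr ⟨h1, by omega⟩
    · exact absurd h (key _ _ _ _ (by omega) h1).not_gt

theorem rootLT_trichotomy (b c : PosRoot n) : rootLT b c ∨ b = c ∨ rootLT c b := by
  rw [rootLT_iff, rootLT_iff]
  by_cases h : b = c
  · exact Or.inr (Or.inl h)
  · have : ¬ (b.1.1 = c.1.1 ∧ b.snd = c.snd) := fun h' => h (PosRoot.ext' h'.1 h'.2)
    omega

theorem exists_max_root {P : PosRoot n → Prop} (h : ∃ b, P b) :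
    ∃ b, P b ∧ ∀ c, rootLT b c → ¬ P c := by
  classical
  obtain ⟨b, hb⟩ := h
  obtain ⟨b, hb, hmin⟩ := Finset.exists_min_image (Finset.univ.filter P) rootKey ⟨b, by simpa⟩
  refine ⟨b, by simpa using hb, fun c hc hPc => ?_⟩
  have := hmin c (by simpa)
  rw [rootLT_iff_key] at hc
  omega

theorem eq_or_monoLT_or {t s : PosRoot n →₀ ℕ} (h : t.degree = s.degree) :
    t = s ∨ monoLT t s ∨ ∃ b, t b < s b ∧ ∀ c, rootLT b c → t c = s c := by
  by_cases hts : t = s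
  · exact Or.inl hts
  obtain ⟨b, hb, hmax⟩ := exists_max_root (P := fun b => t b ≠ s b)
    (by by_contra! h'; exact hts (Finsupp.ext h'))
  have hmax' : ∀ c, rootLT b c → t c = s c := fun c hc => not_not.1 (hmax c hc)
  rcases lt_or_gt_of_ne hb with h1 | h1
  · exact Or.inr (Or.inr ⟨b, h1, hmax'⟩)
  · exact Or.inr (Or.inl (Or.inr ⟨h, b, h1, hmax'⟩))

theorem monoLT_trans {r s t : PosRoot n →₀ ℕ} (h1 : monoLT r s) (h2 : monoLT s t) :
    monoLT r t := by
  rcases h1 with h1 | ⟨h1, b, hb, hb'⟩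
  · rcases h2 with h2 | ⟨h2, -⟩
    · exact Or.inl (h1.trans h2)
    · exact Or.inl (h2 ▸ h1)
  · rcases h2 with h2 | ⟨h2, c, hc, hc'⟩
    · exact Or.inl (h1 ▸ h2)
    · refine Or.inr ⟨h1.trans h2, ?_⟩
      have tr : ∀ {x y z : PosRoot n}, rootLT x y → rootLT y z → rootLT x z := by
        intro x y z
        simp only [rootLT_iff_key]
        omega
      rcases rootLT_trichotomy b c with h | rfl | h
      · exact ⟨c, by rw [hb' c h]; exact hc, fun d hd => (hb' d (tr h hd)).trans (hc' d hd)⟩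
      · exact ⟨b, hc.trans hb, fun d hd => (hb' d hd).trans (hc' d hd)⟩
      · exact ⟨b, by rw [← hc' b h]; exact hb, fun d hd => (hb' d hd).trans (hc' d (tr h hd))⟩

theorem monoLT_irrefl (s : PosRoot n →₀ ℕ) : ¬ monoLT s s := by
  rintro (h | ⟨-, b, hb, -⟩)
  · exact lt_irrefl _ h
  · exact lt_irrefl _ hb

theorem monoLT_add_right {t s : PosRoot n →₀ ℕ} (h : monoLT t s) (u : PosRoot n →₀ ℕ) :
    monoLT (t + u) (s + u) := by
  rcases h with h | ⟨h, b, hb, hb'⟩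
  · exact Or.inl (by rw [map_add, map_add]; omega)
  · refine Or.inr ⟨by rw [map_add, map_add, h], b, ?_, fun c hc => ?_⟩
    · rw [Finsupp.add_apply, Finsupp.add_apply]
      omega
    · rw [Finsupp.add_apply, Finsupp.add_apply, hb' c hc]

/-- The order never raises the degree, and there are finitely many monomials of bounded degree in
finitely many variables; on a finite set a strict order is well-founded. -/
theorem monoLT_wellFounded : WellFounded (monoLT (n := n)) := by
  refine ⟨fun s => ?_⟩
  have hfin : {t : PosRoot n →₀ ℕ | t.degree ≤ s.degree}.Finite := Finsupp.finite_of_degree_le _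
  have hwf : {t : PosRoot n →₀ ℕ | t.degree ≤ s.degree}.WellFoundedOn monoLT := by
    have : IsStrictOrder (PosRoot n →₀ ℕ) monoLT :=
      { irrefl := monoLT_irrefl, trans := fun _ _ _ => monoLT_trans }
    exact hfin.wellFoundedOn
  have key := hwf.induction (P := fun t => Acc monoLT t) (x := s) (le_refl s.degree)
  refine key fun t ht ih => Acc.intro t fun u hu => ih u ?_ hu
  have : u.degree ≤ t.degree := by
    rcases hu with h | ⟨h, -⟩
    · exact h.le
    · exact h.le
  exact this.trans ht

end Order

/-! ### Coefficients of families of powers of linear forms -/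

section Extraction

/-- Expand the power as a polynomial in the parameters `τ` with coefficients in the polynomial ring.
If the coefficient of `τ^E` were outside `I`, a linear functional killing `I` but not this
coefficient would turn the expansion into a nonzero polynomial in `τ` vanishing wherever `g` does
not. Several indices `j` may share a variable `ρ j`, so coefficients may be sums of parameter
monomials. -/
theorem coefficient_mem {R σ J : Type*} (I : Submodule ℂ (MvPolynomial R ℂ)) [DecidableEq J]
    (S : Finset J) (ρ : J → R) (e : J → σ →₀ ℕ) (κ : J → ℂ) {g : MvPolynomial σ ℂ} (hg : g ≠ 0)
    (d : ℕ)
    (H : ∀ τ : σ → ℂ, MvPolynomial.eval τ g ≠ 0 →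
      (∑ j ∈ S, MvPolynomial.C (κ j * (e j).prod fun a k => τ a ^ k) * MvPolynomial.X (ρ j)) ^ d
        ∈ I) (E : σ →₀ ℕ) [DecidableEq σ] :
    ∑ k ∈ (S.piAntidiag d).filter (fun k => ∑ j ∈ S, k j • e j = E),
      ((Nat.multinomial S k : ℂ) * ∏ j ∈ S, κ j ^ k j) •
        MvPolynomial.monomial (∑ j ∈ S, Finsupp.single (ρ j) (k j)) (1 : ℂ) ∈ I := by
  by_contra hnot
  obtain ⟨φ, hφ, hI⟩ := Submodule.exists_le_ker_of_notMem hnot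
  set a : (J → ℕ) → ℂ := fun k => ((Nat.multinomial S k : ℂ) * ∏ j ∈ S, κ j ^ k j) *
    φ (MvPolynomial.monomial (∑ j ∈ S, Finsupp.single (ρ j) (k j)) (1 : ℂ)) with ha
  set G : MvPolynomial σ ℂ := ∑ k ∈ S.piAntidiag d,
    MvPolynomial.monomial (∑ j ∈ S, k j • e j) (a k) with hG
  have hmon : ∀ (τ : σ → ℂ) (k : J → ℕ), (∑ j ∈ S, k j • e j).prod (fun a k => τ a ^ k) =
      ∏ j ∈ S, ((e j).prod fun a k => τ a ^ k) ^ k j := by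
    intro τ k
    have h1 : ∀ s : σ →₀ ℕ, s.prod (fun a k => τ a ^ k) =
        MvPolynomial.eval τ (MvPolynomial.monomial s 1) := fun s => by
      rw [MvPolynomial.eval_monomial, one_mul]
    simp only [h1]
    rw [MvPolynomial.monomial_sum_one, map_prod]
    refine Finset.prod_congr rfl fun j _ => ?_
    rw [← map_pow, MvPolynomial.monomial_pow, one_pow]
  have hev : ∀ τ : σ → ℂ, MvPolynomial.eval τ G = φ ((∑ j ∈ S,
      MvPolynomial.C (κ j * (e j).prod fun a k => τ a ^ k) * MvPolynomial.X (ρ j)) ^ d) := by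
    intro τ
    rw [Finset.sum_pow_eq_sum_piAntidiag, hG, map_sum, map_sum]
    refine Finset.sum_congr rfl fun k _ => ?_
    have h2 : (∏ j ∈ S, (MvPolynomial.C (κ j * (e j).prod fun a k => τ a ^ k) *
        MvPolynomial.X (ρ j)) ^ k j : MvPolynomial R ℂ) =
        (∏ j ∈ S, (κ j * (e j).prod fun a k => τ a ^ k) ^ k j) •
          MvPolynomial.monomial (∑ j ∈ S, Finsupp.single (ρ j) (k j)) (1 : ℂ) := by
      rw [MvPolynomial.monomial_sum_one, ← MvPolynomial.C_mul', map_prod, ← Finset.prod_mul_distrib]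
      refine Finset.prod_congr rfl fun j _ => ?_
      rw [mul_pow, map_pow, MvPolynomial.X_pow_eq_monomial]
    rw [h2, MvPolynomial.eval_monomial, hmon, ha, ← nsmul_eq_mul, map_nsmul, map_smul,
      nsmul_eq_mul, smul_eq_mul]
    simp only [mul_pow, Finset.prod_mul_distrib]
    ring
  -- The product vanishes at every point, hence as a polynomial; the open condition `g ≠ 0` is then
  -- removed by cancelling `g` in a domain.
  have hzero : g * G = 0 := by
    refine MvPolynomial.funext fun τ => ?_
    rw [map_mul, map_zero]
    by_cases h0 : MvPolynomial.eval τ g = 0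
    · rw [h0, zero_mul]
    · rw [hev, show φ _ = 0 from hI (H τ h0), mul_zero]
  have hG0 : G = 0 := (mul_eq_zero.1 hzero).resolve_left hg
  apply hφ
  have hc := congrArg (MvPolynomial.coeff E) hG0
  rw [hG, MvPolynomial.coeff_sum, MvPolynomial.coeff_zero] at hc
  simp only [MvPolynomial.coeff_monomial] at hc
  rw [← Finset.sum_filter] at hc
  rw [map_sum]
  refine Eq.trans (Finset.sum_congr rfl fun k _ => ?_) hc
  rw [map_smul, smul_eq_mul]

/-- Apply `coefficient_mem` to the parameter monomial produced by the choice `k₀`. The choice `k₀`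
itself contributes a multinomial coefficient times powers of the nonzero `κ j`, and by `hdom` no
other choice reaches its monomial, so one can divide by its coefficient. -/
theorem exists_leading_relation {n i : ℕ} {σ J : Type*} (I : Ideal (MvPolynomial (PosRoot n) ℂ))
    (S : Finset J) (ρ : J → PosRoot n) (e : J → σ →₀ ℕ) (κ : J → ℂ) {g : MvPolynomial σ ℂ}
    (hg : g ≠ 0) (k₀ : J → ℕ) (hk₀ : ∀ j, k₀ j ≠ 0 → j ∈ S) (hκ : ∀ j ∈ S, κ j ≠ 0)
    (hρ : ∀ j ∈ S, (ρ j).MemR i)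
    (H : ∀ τ : σ → ℂ, MvPolynomial.eval τ g ≠ 0 →
      (∑ j ∈ S, MvPolynomial.C (κ j * (e j).prod fun a k => τ a ^ k) * MvPolynomial.X (ρ j)) ^
        (∑ j ∈ S, k₀ j) ∈ I)
    (hdom : ∀ k : J → ℕ, (∀ j, k j ≠ 0 → j ∈ S) → ∑ j ∈ S, k j = ∑ j ∈ S, k₀ j →
      ∑ j ∈ S, k j • e j = ∑ j ∈ S, k₀ j • e j → k = k₀ ∨
        monoLT (∑ j ∈ S, Finsupp.single (ρ j) (k j)) (∑ j ∈ S, Finsupp.single (ρ j) (k₀ j))) :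
    ∃ c : (PosRoot n →₀ ℕ) →₀ ℂ,
      (∀ t ∈ c.support, monoLT t (∑ j ∈ S, Finsupp.single (ρ j) (k₀ j)) ∧
        ∀ b, ¬ b.MemR i → t b = 0) ∧
      mon (∑ j ∈ S, Finsupp.single (ρ j) (k₀ j)) + c.sum (fun t a => a • mon t) ∈ I := by
  classical
  have h := coefficient_mem (I.restrictScalars ℂ) S ρ e κ hg _ H (∑ j ∈ S, k₀ j • e j)
  rw [Submodule.restrictScalars_mem] at h
  set K := (S.piAntidiag (∑ j ∈ S, k₀ j)).filter
    (fun k => ∑ j ∈ S, k j • e j = ∑ j ∈ S, k₀ j • e j) with hK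
  have hmem : k₀ ∈ K := by
    rw [hK, Finset.mem_filter, Finset.mem_piAntidiag]
    exact ⟨⟨rfl, hk₀⟩, rfl⟩
  set a : (J → ℕ) → ℂ := fun k => (Nat.multinomial S k : ℂ) * ∏ j ∈ S, κ j ^ k j with ha
  have ha0 : a k₀ ≠ 0 :=
    mul_ne_zero (Nat.cast_ne_zero.2 (Nat.multinomial_pos _ _).ne')
      (Finset.prod_ne_zero_iff.2 fun j hj => pow_ne_zero _ (hκ j hj))
  set T : (J → ℕ) → PosRoot n →₀ ℕ := fun k => ∑ j ∈ S, Finsupp.single (ρ j) (k j) with hT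
  -- Different choices `k` may yield the same monomial `T k`, so the coefficients are collected by
  -- adding single terms.
  refine ⟨∑ k ∈ K.erase k₀, Finsupp.single (T k) ((a k₀)⁻¹ * a k), fun t ht => ?_, ?_⟩
  · obtain ⟨k, hk, hk'⟩ := Finset.mem_biUnion.1 (Finsupp.support_finsetSum ht)
    obtain rfl : t = T k := Finset.mem_singleton.1 (Finsupp.support_single_subset hk')
    obtain ⟨hne, hk⟩ := Finset.mem_erase.1 hk
    rw [hK, Finset.mem_filter, Finset.mem_piAntidiag] at hk
    refine ⟨(hdom k hk.1.2 hk.1.1 hk.2).resolve_left hne, fun b hb => ?_⟩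
    simp only [hT, Finsupp.finsetSum_apply]
    refine Finset.sum_eq_zero fun j hj => ?_
    rw [Finsupp.single_apply, if_neg]
    rintro rfl
    exact hb (hρ j hj)
  · have h2 : (∑ k ∈ K.erase k₀, Finsupp.single (T k) ((a k₀)⁻¹ * a k)).sum
        (fun t a => a • mon t) = ∑ k ∈ K.erase k₀, ((a k₀)⁻¹ * a k) • mon (T k) := by
      rw [← Finsupp.sum_finsetSum_index (h := fun t (a : ℂ) => a • mon t)
        (fun _ => zero_smul _ _) fun _ _ _ => add_smul _ _ _]
      refine Finset.sum_congr rfl fun k _ => ?_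
      rw [Finsupp.sum_single_index (h := fun t (a : ℂ) => a • mon t) (zero_smul _ _)]
    rw [h2]
    have h3 : mon (T k₀) + ∑ k ∈ K.erase k₀, ((a k₀)⁻¹ * a k) • mon (T k) =
        MvPolynomial.C (a k₀)⁻¹ * ∑ k ∈ K, a k • mon (T k) := by
      rw [← Finset.add_sum_erase K _ hmem, MvPolynomial.C_mul', smul_add, smul_smul,
        inv_mul_cancel₀ ha0, one_smul, Finset.smul_sum]
      simp only [smul_smul]
    rw [h3]
    exact I.mul_mem_left _ h

end Extraction

/-! ### Leading monomials of matchings -/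

section Matchings

variable {n : ℕ}

/-- The sum of the exponents in row `p`. -/
noncomputable def rowSum (t : PosRoot n →₀ ℕ) (p : ℕ) : ℕ := ∑ b with b.1.1 = p, t b

/-- The sum of the exponents in the column with second index `q`. -/
noncomputable def colSum (t : PosRoot n →₀ ℕ) (q : ℕ) : ℕ := ∑ b with b.snd = q, t b

theorem sum_filter_eq_of_fiberwise {ι : Type*} [Fintype ι] (f : ι → ℕ) (t s : ι → ℕ)
    (P : ℕ → Prop) [DecidablePred P] (h : ∀ k, P k → ∑ b with f b = k, t b = ∑ b with f b = k, s b) :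
    ∑ b with P (f b), t b = ∑ b with P (f b), s b := by
  classical
  have key : ∀ t : ι → ℕ, ∑ b with P (f b), t b =
      ∑ k ∈ (Finset.univ.image f).filter P, ∑ b with f b = k, t b := fun t => by
    rw [← Finset.sum_fiberwise_of_maps_to (s := Finset.univ.filter fun b => P (f b))
      (t := (Finset.univ.image f).filter P) (g := f)
      (fun b hb => by simpa using hb)]
    refine Finset.sum_congr rfl fun k hk => Finset.sum_congr ?_ fun _ _ => rfl
    ext b
    simp only [Finset.mem_filter, Finset.mem_univ, true_and] at hk ⊢
    constructor
    · exact fun h => h.2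
    · rintro rfl
      exact ⟨hk.2, rfl⟩
  rw [key, key]
  exact Finset.sum_congr rfl fun k hk => h k (Finset.mem_filter.1 hk).2

theorem sum_filter_split {ι : Type*} [Fintype ι] (t : ι → ℕ) (P Q R : ι → Prop) [DecidablePred P]
    [DecidablePred Q] [DecidablePred R] (h : ∀ b, P b ↔ Q b ∨ R b) (h' : ∀ b, Q b → ¬ R b) :
    ∑ b with P b, t b = ∑ b with Q b, t b + ∑ b with R b, t b := by
  classical
  rw [← Finset.sum_union (Finset.disjoint_filter.2 fun b _ => h' b), ← Finset.filter_or]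
  exact Finset.sum_congr (Finset.filter_congr fun b _ => h b) fun _ _ => rfl

theorem sum_filter_le_of_imp {ι : Type*} [Fintype ι] (t : ι → ℕ) (P Q : ι → Prop) [DecidablePred P]
    [DecidablePred Q] (h : ∀ b, t b ≠ 0 → P b → Q b) : ∑ b with P b, t b ≤ ∑ b with Q b, t b := by
  classical
  rw [← Finset.sum_filter_ne_zero (s := Finset.univ.filter P)]
  refine Finset.sum_le_sum_of_subset fun b hb => ?_
  simp only [Finset.mem_filter, Finset.mem_univ, true_and] at hb ⊢
  exact h b hb.2 hb.1

theorem rowSum_eq_zero {t : PosRoot n →₀ ℕ} {p : ℕ} (h : ∀ b : PosRoot n, b.1.1 = p → t b = 0) :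
    rowSum t p = 0 :=
  Finset.sum_eq_zero fun b hb => h b (Finset.mem_filter.1 hb).2

theorem colSum_eq_zero {t : PosRoot n →₀ ℕ} {q : ℕ} (h : ∀ b : PosRoot n, b.snd = q → t b = 0) :
    colSum t q = 0 :=
  Finset.sum_eq_zero fun b hb => h b (Finset.mem_filter.1 hb).2

theorem eq_zero_of_colSum {t : PosRoot n →₀ ℕ} {b : PosRoot n} (h : colSum t b.snd = 0) :
    t b = 0 :=
  Finset.sum_eq_zero_iff.1 h b (by simp)

theorem rows_eq {t s : PosRoot n →₀ ℕ} (P : ℕ → Prop) [DecidablePred P]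
    (h : ∀ p, P p → rowSum t p = rowSum s p) :
    ∑ b : PosRoot n with P b.1.1, t b = ∑ b : PosRoot n with P b.1.1, s b :=
  sum_filter_eq_of_fiberwise (fun b : PosRoot n => b.1.1) t s P h

theorem degree_eq_of_rowSum {t s : PosRoot n →₀ ℕ} (h : ∀ p, rowSum t p = rowSum s p) :
    t.degree = s.degree := by
  have := rows_eq (t := t) (s := s) (fun _ => True) fun p _ => h p
  simpa [Finsupp.degree_eq_sum] using this

/-- If `t` and `s` agree at the roots of a column which are larger than `b`, but `t b < s b`,
then the remaining part of the column is larger for `t`. -/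
theorem tail_lt {t s : PosRoot n →₀ ℕ} {b : PosRoot n} (hlt : t b < s b)
    (habove : ∀ c, c.snd = b.snd → c.1.1 < b.1.1 → t c = s c)
    (hcol : colSum s b.snd ≤ colSum t b.snd) :
    ∑ c with c.snd = b.snd ∧ b.1.1 < c.1.1, s c < ∑ c with c.snd = b.snd ∧ b.1.1 < c.1.1, t c := by
  have key : ∀ t : PosRoot n →₀ ℕ, colSum t b.snd =
      ∑ c with c.snd = b.snd ∧ c.1.1 < b.1.1, t c + t b +
        ∑ c with c.snd = b.snd ∧ b.1.1 < c.1.1, t c := fun t => by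
    have h1 : ∑ c with c = b, t c = t b := by
      rw [Finset.filter_eq' _ b, if_pos (Finset.mem_univ _), Finset.sum_singleton]
    rw [colSum, sum_filter_split t _ (fun c => c.snd = b.snd ∧ c.1.1 ≤ b.1.1)
      (fun c => c.snd = b.snd ∧ b.1.1 < c.1.1) (by intro c; omega) (by intro c; omega),
      sum_filter_split t (fun c => c.snd = b.snd ∧ c.1.1 ≤ b.1.1)
      (fun c => c.snd = b.snd ∧ c.1.1 < b.1.1) (fun c => c = b) ?_ ?_, h1]
    · intro c
      constructor
      · rintro ⟨h2, h3⟩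
        rcases h3.lt_or_eq with h4 | h4
        · exact Or.inl ⟨h2, h4⟩
        · exact Or.inr (PosRoot.ext' h4 h2)
      · rintro (⟨h2, h3⟩ | rfl)
        · exact ⟨h2, h3.le⟩
        · exact ⟨rfl, le_rfl⟩
    · rintro c ⟨h2, h3⟩ rfl
      exact lt_irrefl _ h3
  have h2 : ∑ c with c.snd = b.snd ∧ c.1.1 < b.1.1, t c =
      ∑ c with c.snd = b.snd ∧ c.1.1 < b.1.1, s c :=
    Finset.sum_congr rfl fun c hc => by
      simp only [Finset.mem_filter, Finset.mem_univ, true_and] at hc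
      exact habove c hc.1 hc.2
  rw [key s, key t, h2] at hcol
  omega

/-- The support of the exponent `s` is a chain. -/
def ChainSupported (s : PosRoot n →₀ ℕ) : Prop :=
  ∀ b c, s b ≠ 0 → s c ≠ 0 → b.1.1 < c.1.1 → c.snd ≤ b.snd

theorem eq_or_monoLT_of_chain {t s : PosRoot n →₀ ℕ} (hs : ChainSupported s)
    (hrow : ∀ p, rowSum t p = rowSum s p)
    (hcol : ∀ q, (∀ c, c.snd < q → t c = s c) → colSum s q ≤ colSum t q) :
    t = s ∨ monoLT t s := by
  rcases eq_or_monoLT_or (degree_eq_of_rowSum hrow) with h | h | ⟨b, hb, habove⟩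
  · exact Or.inl h
  · exact Or.inr h
  simp only [rootLT_iff] at habove
  have h1 := tail_lt hb (fun c h1 h2 => habove c (Or.inr ⟨h1, h2⟩))
    (hcol _ fun c hc => habove c (Or.inl hc))
  have h2 := rows_eq (t := t) (s := s) (fun p => b.1.1 < p) fun p _ => hrow p
  have split : ∀ t : PosRoot n →₀ ℕ, ∑ c : PosRoot n with b.1.1 < c.1.1, t c =
      ∑ c : PosRoot n with b.1.1 < c.1.1 ∧ c.snd < b.snd, t c +
        ∑ c : PosRoot n with c.snd = b.snd ∧ b.1.1 < c.1.1, t c +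
          ∑ c : PosRoot n with b.1.1 < c.1.1 ∧ b.snd < c.snd, t c := fun t => by
    rw [sum_filter_split t (fun c => b.1.1 < c.1.1) (fun c => b.1.1 < c.1.1 ∧ c.snd ≤ b.snd)
      (fun c => b.1.1 < c.1.1 ∧ b.snd < c.snd) (by intro c; omega) (by intro c; omega),
      sum_filter_split t (fun c => b.1.1 < c.1.1 ∧ c.snd ≤ b.snd)
      (fun c => b.1.1 < c.1.1 ∧ c.snd < b.snd) (fun c => c.snd = b.snd ∧ b.1.1 < c.1.1)
      (by intro c; omega) (by intro c; omega)]
  have h3 : ∑ c : PosRoot n with b.1.1 < c.1.1 ∧ b.snd < c.snd, s c = 0 :=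
    Finset.sum_eq_zero fun c hc => by
      simp only [Finset.mem_filter, Finset.mem_univ, true_and] at hc
      by_contra h
      have := hs b c (by omega) h hc.1
      omega
  have h4 : ∑ c : PosRoot n with b.1.1 < c.1.1 ∧ c.snd < b.snd, t c =
      ∑ c : PosRoot n with b.1.1 < c.1.1 ∧ c.snd < b.snd, s c :=
    Finset.sum_congr rfl fun c hc => by
      simp only [Finset.mem_filter, Finset.mem_univ, true_and] at hc
      exact habove c (Or.inl hc.2)
  rw [split t, split s, h3, h4] at h2
  omega

/-- Either `t` already has more in the column of the largest roots, and so differs from `s` there,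
or all column sums agree; both cases satisfy the hypothesis of `eq_or_monoLT_of_chain`. -/
theorem eq_or_monoLT_of_top_column {t s : PosRoot n →₀ ℕ} (hs : ChainSupported s)
    (hrow : ∀ p, rowSum t p = rowSum s p) (top : ℕ) (htop : ∀ c, s c ≠ 0 → top ≤ c.snd)
    (hle : colSum s top ≤ colSum t top)
    (heq : colSum s top = colSum t top → ∀ q, colSum s q = colSum t q) : t = s ∨ monoLT t s := by
  refine eq_or_monoLT_of_chain hs hrow fun q hq => ?_
  rcases lt_trichotomy q top with h | rfl | h
  · rw [colSum_eq_zero]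
    · exact Nat.zero_le _
    · intro b hb
      by_contra h'
      have := htop b h'
      omega
  · exact hle
  · refine (heq (Finset.sum_congr rfl fun c hc => (hq c ?_).symm) q).le
    simp only [Finset.mem_filter, Finset.mem_univ, true_and] at hc
    omega

/-- In the expansion of `(∑ (a_p b_q - a_q b_p) X)^d`, `tp` records the choices of `a_p b_q` and
`tm` those of `-a_q b_p`; `ha` and `hb` compare the exponents of the `a_k` and the `b_k`. These
equations mix rows of one part with columns of the other. Assuming that `t` is not smaller than `s`,
nothing of `t` lies in columns before `x`; this and a count of degrees decouple the equations, and
the chain lemma applies to each part. -/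
theorem eq_or_monoLT_of_matching {x : ℕ} {tp tm s₁ s₂ : PosRoot n →₀ ℕ}
    (h₁ : ∀ b, s₁ b ≠ 0 → b.1.1 < x ∧ x ≤ b.snd) (h₂ : ∀ b, s₂ b ≠ 0 → b.1.1 ≤ x ∧ x < b.snd)
    (c₁ : ChainSupported s₁) (c₂ : ChainSupported s₂)
    (ha : ∀ k, rowSum tp k + colSum tm k = rowSum s₁ k + colSum s₂ k)
    (hb : ∀ k, colSum tp k + rowSum tm k = colSum s₁ k + rowSum s₂ k)
    (hdeg : (tp + tm).degree = (s₁ + s₂).degree) :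
    tp = s₁ ∧ tm = s₂ ∨ monoLT (tp + tm) (s₁ + s₂) := by
  by_contra! hnot
  obtain ⟨hne, hnot⟩ := hnot
  have hQ : ∀ b, (∀ c, rootLT b c → (tp + tm) c = (s₁ + s₂) c) →
      (tp + tm) b ≤ (s₁ + s₂) b := fun b hb => by
    by_contra! h
    exact hnot (Or.inr ⟨hdeg, b, h, hb⟩)
  simp only [Finsupp.add_apply, rootLT_iff] at hQ
  have z₁ : ∀ b : PosRoot n, b.snd < x ∨ x ≤ b.1.1 → s₁ b = 0 := fun b hb => by
    by_contra h
    have := h₁ b h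
    omega
  have z₂ : ∀ b : PosRoot n, b.snd ≤ x ∨ x < b.1.1 → s₂ b = 0 := fun b hb => by
    by_contra h
    have := h₂ b h
    omega
  -- no root of `t` has its second index below `x`
  have hlow : ∀ b : PosRoot n, b.snd < x → tp b + tm b = 0 := by
    by_contra! h
    obtain ⟨b, ⟨hbx, hb0⟩, hmax⟩ := exists_max_root
      (P := fun b : PosRoot n => b.snd < x ∧ tp b + tm b ≠ 0) (by simpa using h)
    simp only [rootLT_iff] at hmax
    have := hQ b fun c hc => by
      rw [z₁ c (by omega), z₂ c (by omega)]
      by_contra h'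
      exact hmax c hc ⟨by omega, h'⟩
    rw [z₁ b (by omega), z₂ b (by omega)] at this
    omega
  have ctp : ∀ k, k < x → colSum tp k = 0 := fun k hk => colSum_eq_zero fun b hb => by
    have := hlow b (by omega)
    omega
  have ctm : ∀ k, k < x → colSum tm k = 0 := fun k hk => colSum_eq_zero fun b hb => by
    have := hlow b (by omega)
    omega
  have cs₁ : ∀ k, k < x → colSum s₁ k = 0 := fun k hk => colSum_eq_zero fun b hb => z₁ b (by omega)
  have cs₂ : ∀ k, k ≤ x → colSum s₂ k = 0 := fun k hk => colSum_eq_zero fun b hb => z₂ b (by omega)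
  have rs₁ : ∀ k, x ≤ k → rowSum s₁ k = 0 := fun k hk => rowSum_eq_zero fun b hb => z₁ b (by omega)
  have rs₂ : ∀ k, x < k → rowSum s₂ k = 0 := fun k hk => rowSum_eq_zero fun b hb => z₂ b (by omega)
  have rtp : ∀ k, k ≤ x → rowSum tp k = rowSum s₁ k := fun k hk => by
    rcases hk.lt_or_eq with h | rfl
    · have := ha k
      rw [ctm k h, cs₂ k hk] at this
      omega
    · have := ha k
      rw [rs₁ k le_rfl, cs₂ k le_rfl] at this
      rw [rs₁ k le_rfl]
      omega
  have ctmx : colSum tm x = 0 := by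
    have := ha x
    rw [rs₁ x le_rfl, cs₂ x le_rfl] at this
    omega
  have rtm : ∀ k, k < x → rowSum tm k = rowSum s₂ k := fun k hk => by
    have := hb k
    rw [ctp k hk, cs₁ k hk] at this
    omega
  have hbx := hb x
  -- counting the first indices up to `x`
  have split : ∀ t : PosRoot n →₀ ℕ, t.degree = ∑ b : PosRoot n with b.1.1 < x, t b +
      rowSum t x + ∑ b : PosRoot n with x < b.1.1, t b := fun t => by
    have h0 : t.degree = ∑ b : PosRoot n with True, t b := by simp [Finsupp.degree_eq_sum]
    rw [h0, sum_filter_split t (fun _ => True) (fun b => b.1.1 ≤ x) (fun b => x < b.1.1)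
      (fun b => ⟨fun _ => le_or_gt _ _, fun _ => trivial⟩) (by intro b; omega),
      sum_filter_split t (fun b => b.1.1 ≤ x)
      (fun b => b.1.1 < x) (fun b => b.1.1 = x) (by intro b; omega) (by intro b; omega)]
    rfl
  have hp1 := rows_eq (t := tp) (s := s₁) (fun p => p < x) fun k hk => rtp k hk.le
  have hm1 := rows_eq (t := tm) (s := s₂) (fun p => p < x) fun k hk => rtm k hk
  have h1 : ∑ b : PosRoot n with x < b.1.1, s₁ b = 0 := Finset.sum_eq_zero fun b hb =>
    z₁ b (by simp only [Finset.mem_filter, Finset.mem_univ, true_and] at hb; omega)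
  have h2 : ∑ b : PosRoot n with x < b.1.1, s₂ b = 0 := Finset.sum_eq_zero fun b hb =>
    z₂ b (by simp only [Finset.mem_filter, Finset.mem_univ, true_and] at hb; omega)
  have hcount := hdeg
  rw [map_add, map_add, split tp, split tm, split s₁, split s₂, hp1, hm1, h1, h2,
    rtp x le_rfl] at hcount
  -- The rows before `x` carry the same amounts on both sides, and what remains of `s₁ + s₂` is row
  -- `x` of `s₂`. So row `x` of `tm` is at most row `x` of `s₂`, and `hb` at `x` turns this into the
  -- column inequality.
  have hcolx : colSum s₁ x ≤ colSum tp x := by omega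
  -- agreement in column `x`
  have hagree : ∀ b : PosRoot n, b.snd = x → tp b = s₁ b := by
    by_contra! h
    obtain ⟨b, ⟨hbx', hb0⟩, hmax⟩ := exists_max_root
      (P := fun b : PosRoot n => b.snd = x ∧ tp b ≠ s₁ b) h
    simp only [rootLT_iff] at hmax
    have tmx : ∀ c : PosRoot n, c.snd = x → tm c = 0 := fun c hc =>
      eq_zero_of_colSum (by rw [hc, ctmx])
    have hab : ∀ c : PosRoot n, c.snd = b.snd → c.1.1 < b.1.1 → tp c = s₁ c := fun c hc hc' => by
      by_contra h'
      exact hmax c (Or.inr ⟨hc, hc'⟩) ⟨by omega, h'⟩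
    have hq := hQ b fun c hc => by
      rcases hc with hc | ⟨hc, hc'⟩
      · have := hlow c (by omega)
        rw [z₁ c (by omega), z₂ c (by omega)]
        omega
      · rw [hab c hc hc', tmx c (by omega), z₂ c (by omega)]
    rw [tmx b hbx', z₂ b (by omega)] at hq
    have hlt : tp b < s₁ b := by omega
    have ht := tail_lt hlt hab (by rwa [hbx'])
    -- The rows strictly between that of `b` and `x` contain the whole tail of column `x` for `tp`,
    -- since a row index is less than its column index; for `s₁` the chain condition confines them
    -- to that tail. Equal row sums contradict `ht`.
    have hr := rows_eq (t := tp) (s := s₁) (fun p => b.1.1 < p ∧ p < x) fun k hk =>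
      rtp k hk.2.le
    have e1 := sum_filter_le_of_imp tp (fun c : PosRoot n => c.snd = b.snd ∧ b.1.1 < c.1.1)
      (fun c : PosRoot n => b.1.1 < c.1.1 ∧ c.1.1 < x) fun c _ hc => by
        have := c.bounds
        omega
    have e2 := sum_filter_le_of_imp s₁ (fun c : PosRoot n => b.1.1 < c.1.1 ∧ c.1.1 < x)
      (fun c : PosRoot n => c.snd = b.snd ∧ b.1.1 < c.1.1) fun c hc0 hc => by
        have := c₁ b c (by omega) hc0 hc.1
        have := h₁ c hc0
        omega
    omega
  have hcolx' : colSum tp x = colSum s₁ x := Finset.sum_congr rfl fun b hb =>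
    hagree b (by simpa using hb)
  -- Equality in column `x` forces equality in row `x` of `tm` and `s₂`, and the degree count then
  -- leaves nothing of `tp` or `tm` in rows beyond `x`.
  have rtp' : ∀ k, rowSum tp k = rowSum s₁ k := fun k => by
    by_cases hk : k ≤ x
    · exact rtp k hk
    · rw [rs₁ k (by omega)]
      have h0 : ∑ b : PosRoot n with x < b.1.1, tp b = 0 := by omega
      exact rowSum_eq_zero fun b hb => Finset.sum_eq_zero_iff.1 h0 b
        (by simp only [Finset.mem_filter, Finset.mem_univ, true_and]; omega)
  have rtm' : ∀ k, rowSum tm k = rowSum s₂ k := fun k => by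
    rcases lt_trichotomy k x with hk | rfl | hk
    · exact rtm k hk
    · omega
    · rw [rs₂ k hk]
      have h0 : ∑ b : PosRoot n with x < b.1.1, tm b = 0 := by omega
      exact rowSum_eq_zero fun b hb => Finset.sum_eq_zero_iff.1 h0 b
        (by simp only [Finset.mem_filter, Finset.mem_univ, true_and]; omega)
  rcases eq_or_monoLT_of_chain c₁ rtp' (fun k _ => by have := hb k; have := rtm' k; omega) with
    e1 | e1
  · rcases eq_or_monoLT_of_chain c₂ rtm' (fun k _ => by have := ha k; have := rtp' k; omega) with
      e2 | e2
    · exact hne e1 e2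
    · rw [e1, add_comm, add_comm s₁] at hnot
      exact hnot (monoLT_add_right e2 s₁)
  · rcases eq_or_monoLT_of_chain c₂ rtm' (fun k _ => by have := ha k; have := rtp' k; omega) with
      e2 | e2
    · rw [e2] at hnot
      exact hnot (monoLT_add_right e1 s₂)
    · refine hnot (monoLT_trans (monoLT_add_right e1 tm) ?_)
      rw [add_comm, add_comm s₁]
      exact monoLT_add_right e2 s₁

end Matchings

/-! ### Nilpotent elements annihilating the highest weight vector -/

section Families

variable {n m i : ℕ} {V : Type*} [AddCommGroup V] [Module ℂ V] [LieRingModule (SO n) V]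
  [LieModule ℂ (SO n) V] {v : V}

/-- A reindexed form of `linear_pow_mem_annIdeal_of_sl2`, in which several summands may belong to
the same root; needed because one coefficient can be a sum of parameter monomials. -/
theorem sum_pow_mem_annIdeal_of_sl2
    (hV : IsHighestWeightModule V ((m : ℝ) • fundWeight n i) v) {x : PosRoot n → nMinus n}
    {J : Type*} {S : Finset J} {ρ : J → PosRoot n} {z : J → ℂ} {h e f : SO n}
    (t : IsSl2Triple h e f) (hf : f - ∑ j ∈ S, z j • (x (ρ j) : SO n) ∈ lineStab n v) {M : ℕ}
    (hh : ⁅h, v⁆ = (M : ℂ) • v) (he : ⁅e, v⁆ = 0) {d : ℕ} (hd : M < d) :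
    (∑ j ∈ S, MvPolynomial.C (z j) * MvPolynomial.X (ρ j)) ^ d ∈ annIdeal v x := by
  classical
  have h1 : ∑ j ∈ S, z j • (x (ρ j) : SO n) =
      ∑ b, (∑ j ∈ S with ρ j = b, z j) • (x b : SO n) := by
    rw [← Finset.sum_fiberwise S ρ]
    refine Finset.sum_congr rfl fun b _ => ?_
    rw [Finset.sum_smul]
    exact Finset.sum_congr rfl fun j hj => by rw [(Finset.mem_filter.1 hj).2]
  have h2 : (∑ j ∈ S, MvPolynomial.C (z j) * MvPolynomial.X (ρ j) : MvPolynomial (PosRoot n) ℂ) =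
      ∑ b, MvPolynomial.C (∑ j ∈ S with ρ j = b, z j) * MvPolynomial.X b := by
    rw [← Finset.sum_fiberwise S ρ]
    refine Finset.sum_congr rfl fun b _ => ?_
    rw [map_sum, Finset.sum_mul]
    exact Finset.sum_congr rfl fun j hj => by rw [(Finset.mem_filter.1 hj).2]
  rw [h1] at hf
  rw [h2]
  exact linear_pow_mem_annIdeal_of_sl2 hV t hf hh he hd

/-- The vector with coordinates `a k`, `1 ≤ k ≤ 2n+1-i`. -/
noncomputable def coordVec (n i : ℕ) (a : ℕ → ℂ) : Unit ⊕ Fin n ⊕ Fin n → ℂ :=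
  ∑ k ∈ Finset.Icc 1 (2 * n + 1 - i), a k • vec n k

theorem form_coordVec_vec (a : ℕ → ℂ) {l : ℕ} (hl : 1 ≤ l) (hl' : l ≤ 2 * n + 1) :
    form n (coordVec n i a) (vec n l) =
      if i < l then a (2 * n + 2 - l) * (if l = n + 1 then 2 else 1) else 0 := by
  have h : ∀ k ∈ Finset.Icc 1 (2 * n + 1 - i), form n (a k • vec n k) (vec n l) =
      if k = 2 * n + 2 - l then a (2 * n + 2 - l) * (if l = n + 1 then 2 else 1) else 0 := by
    intro k hk
    rw [Finset.mem_Icc] at hk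
    rw [map_smul, LinearMap.smul_apply, form_vec (by omega) (by omega) hl hl', smul_eq_mul]
    by_cases h1 : k = 2 * n + 2 - l
    · rw [if_pos (by omega), if_pos h1, h1]
      congr 1
      exact if_congr (by omega) rfl rfl
    · rw [if_neg (by omega), if_neg h1, mul_zero]
  rw [coordVec, map_sum, LinearMap.sum_apply, Finset.sum_congr rfl h, Finset.sum_ite_eq']
  exact if_congr (by rw [Finset.mem_Icc]; omega) rfl rfl

theorem form_coordVec (a b : ℕ → ℂ) :
    form n (coordVec n i a) (coordVec n i b) = ∑ l ∈ Finset.Icc (i + 1) (2 * n + 1 - i),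
      a (2 * n + 2 - l) * b l * (if l = n + 1 then 2 else 1) := by
  have h1 : form n (coordVec n i a) (coordVec n i b) = ∑ l ∈ Finset.Icc 1 (2 * n + 1 - i),
      if i < l then a (2 * n + 2 - l) * b l * (if l = n + 1 then 2 else 1) else 0 := by
    conv_lhs => rw [coordVec.eq_def n i b, map_sum]
    refine Finset.sum_congr rfl fun l hl => ?_
    rw [Finset.mem_Icc] at hl
    rw [map_smul, form_coordVec_vec a hl.1 (by omega), smul_eq_mul]
    split_ifs <;> ring
  rw [h1, ← Finset.sum_filter]
  refine Finset.sum_congr ?_ fun _ _ => rfl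
  ext l
  simp only [Finset.mem_filter, Finset.mem_Icc]
  omega

theorem sum_Icc_mul_antisymm {M : Type*} [AddCommGroup M] (r : ℕ) (F : ℕ → ℕ → M)
    (h0 : ∀ k, F k k = 0) :
    ∑ k ∈ Finset.Icc 1 r, ∑ l ∈ Finset.Icc 1 r, F k l =
      ∑ p ∈ Finset.Icc 1 r ×ˢ Finset.Icc 1 r with p.1 < p.2, (F p.1 p.2 + F p.2 p.1) := by
  rw [← Finset.sum_product', Finset.sum_add_distrib,
    ← Finset.sum_filter_add_sum_filter_not (Finset.Icc 1 r ×ˢ Finset.Icc 1 r) fun p => p.1 < p.2]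
  congr 1
  have h1 : ∑ p ∈ Finset.Icc 1 r ×ˢ Finset.Icc 1 r with ¬ p.1 < p.2, F p.1 p.2 =
      ∑ p ∈ Finset.Icc 1 r ×ˢ Finset.Icc 1 r with p.2 < p.1, F p.1 p.2 := by
    symm
    refine Finset.sum_subset (fun p hp => ?_) fun p hp hp' => ?_
    · simp only [Finset.mem_filter] at hp ⊢
      exact ⟨hp.1, by omega⟩
    · simp only [Finset.mem_filter] at hp hp'
      have : p.1 = p.2 := by
        by_contra h
        exact hp' ⟨hp.1, by omega⟩
      rw [this, h0]
  rw [h1]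
  refine Finset.sum_nbij' Prod.swap Prod.swap ?_ ?_ ?_ ?_ ?_
  · intro p hp
    simp only [Finset.mem_filter, Finset.mem_product, Prod.fst_swap, Prod.snd_swap] at hp ⊢
    exact ⟨⟨hp.1.2, hp.1.1⟩, hp.2⟩
  · intro p hp
    simp only [Finset.mem_filter, Finset.mem_product, Prod.fst_swap, Prod.snd_swap] at hp ⊢
    exact ⟨⟨hp.1.2, hp.1.1⟩, hp.2⟩
  · intro p _; rfl
  · intro p _; rfl
  · intro p _; rfl

theorem memR_iff {b : PosRoot n} : b.MemR i ↔ b.1.1 ≤ i ∧ b.snd + i ≤ 2 * n + 1 := by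
  have := b.bounds
  rw [PosRoot.MemR]
  omega

open Classical in
/-- Modulo the stabilizer of the highest weight line, a decomposable bivector is the combination
of root vectors given by its Plücker coordinates. -/
theorem wedge_coordVec_sub_mem (hV : IsHighestWeightModule V ((m : ℝ) • fundWeight n i) v)
    (hin : i ≤ n) (a b : ℕ → ℂ) :
    wedge n (coordVec n i a) (coordVec n i b) -
      ∑ c : PosRoot n with c.MemR i, (a c.1.1 * b c.snd - a c.snd * b c.1.1) • c.vector ∈
        lineStab n v := by
  set r := 2 * n + 1 - i with hr
  set G : ℕ × ℕ → SO n := fun p => (a p.1 * b p.2 - a p.2 * b p.1) • wedge n (vec n p.1) (vec n p.2)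
    with hG
  have h1 : wedge n (coordVec n i a) (coordVec n i b) =
      ∑ p ∈ Finset.Icc 1 r ×ˢ Finset.Icc 1 r with p.1 < p.2, G p := by
    have h2 : wedge n (coordVec n i a) (coordVec n i b) = ∑ k ∈ Finset.Icc 1 r,
        ∑ l ∈ Finset.Icc 1 r, (a k * b l) • wedge n (vec n k) (vec n l) := by
      rw [coordVec.eq_def n i a, LinearMap.map_sum₂]
      refine Finset.sum_congr rfl fun k _ => ?_
      rw [coordVec, map_sum]
      refine Finset.sum_congr rfl fun l _ => ?_
      rw [map_smul, map_smul, LinearMap.smul_apply, smul_smul, mul_comm]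
    rw [h2, sum_Icc_mul_antisymm r _ fun k => by rw [wedge_self, smul_zero]]
    refine Finset.sum_congr rfl fun p _ => ?_
    rw [hG, wedge_swap (vec n p.2)]
    module
  have h3 : ∑ c : PosRoot n with c.MemR i, (a c.1.1 * b c.snd - a c.snd * b c.1.1) • c.vector =
      ∑ p ∈ Finset.Icc 1 r ×ˢ Finset.Icc 1 r with p.1 < p.2 ∧ p.1 ≤ i, G p := by
    refine Finset.sum_bij (fun c _ => (c.1.1, c.snd)) ?_ ?_ ?_ ?_
    · intro c hc
      simp only [Finset.mem_filter, Finset.mem_univ, true_and, memR_iff] at hc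
      simp only [Finset.mem_filter, Finset.mem_product, Finset.mem_Icc]
      have := c.bounds
      omega
    · intro c _ d _ h
      rw [Prod.mk.injEq] at h
      exact PosRoot.ext' h.1 h.2
    · rintro ⟨p, q⟩ hp
      simp only [Finset.mem_filter, Finset.mem_product, Finset.mem_Icc] at hp
      obtain ⟨c, hc1, hc2⟩ := exists_posRoot (n := n) (p := p) (q := q) (by omega) (by omega)
        (by omega)
      refine ⟨c, ?_, by rw [hc1, hc2]⟩
      simp only [Finset.mem_filter, Finset.mem_univ, true_and, memR_iff]
      omega
    · intro c _
      rfl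
  have h4 := Finset.sum_filter_add_sum_filter_not
    ((Finset.Icc 1 r ×ˢ Finset.Icc 1 r).filter fun p => p.1 < p.2) (fun p => p.1 ≤ i) G
  rw [Finset.filter_filter, Finset.filter_filter] at h4
  rw [h1, h3, ← h4, add_sub_cancel_left]
  refine Submodule.sum_mem _ fun p hp => Submodule.smul_mem _ _ ⟨0, ?_⟩
  simp only [Finset.mem_filter, Finset.mem_product, Finset.mem_Icc] at hp
  rw [zero_smul]
  exact lie_wedge_leviPart hV hin (Submodule.subset_span ⟨p.1, by omega, by omega, rfl⟩)
    (Submodule.subset_span ⟨p.2, by omega, by omega, rfl⟩)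

/-- The dual plane is spanned by `e_1 / a_1` and `v_{o'} / w_o`. In `h`, only the summand involving
`e_1` acts on `v`, by the level `m`; the other lies in the Levi part and acts by zero. Hence the
bound is `m` and not `2m`. -/
theorem exists_sl2_of_isotropic (hV : IsHighestWeightModule V ((m : ℝ) • fundWeight n i) v)
    (hi : 1 ≤ i) (hin : i < n) {o o' : ℕ}
    (ho : o = i + 1 ∧ o' = 2 * n + 1 - i ∨ o = 2 * n + 1 - i ∧ o' = i + 1)
    {a w : ℕ → ℂ} (ha : ∀ k, i < k → a k = 0) (hw : ∀ k, k ≤ i → w k = 0) (ha1 : a 1 ≠ 0)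
    (hwo : w o ≠ 0) (hww : form n (coordVec n i w) (coordVec n i w) = 0) :
    ∃ h e : SO n, IsSl2Triple h e (wedge n (coordVec n i a) (coordVec n i w)) ∧
      ⁅h, v⁆ = (m : ℂ) • v ∧ ⁅e, v⁆ = 0 := by
  have hd : (a 1)⁻¹ • vec n (2 * n + 1) ∈ dualIsotropic n i :=
    Submodule.smul_mem _ _ (Submodule.subset_span ⟨1, le_rfl, hi, by congr 1⟩)
  have hl : (w o)⁻¹ • vec n o' ∈ leviPart n i :=
    Submodule.smul_mem _ _ (Submodule.subset_span ⟨o', by omega, by omega, rfl⟩)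
  have hlw : coordVec n i w ∈ leviPart n i := by
    refine Submodule.sum_mem _ fun k hk => ?_
    rw [Finset.mem_Icc] at hk
    by_cases h : k ≤ i
    · rw [hw k h, zero_smul]
      exact Submodule.zero_mem _
    · exact Submodule.smul_mem _ _ (Submodule.subset_span ⟨k, by omega, by omega, rfl⟩)
  have f1 : form n (coordVec n i a) ((a 1)⁻¹ • vec n (2 * n + 1)) = 1 := by
    rw [map_smul, form_coordVec_vec a (by omega) le_rfl, if_pos (by omega), if_neg (by omega),
      show 2 * n + 2 - (2 * n + 1) = 1 by omega, mul_one, smul_eq_mul, inv_mul_cancel₀ ha1]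
  have f2 : form n ((a 1)⁻¹ • vec n (2 * n + 1)) ((w o)⁻¹ • vec n o') = 0 := by
    rw [map_smul, map_smul, LinearMap.smul_apply,
      form_vec (by omega) (by omega) (by omega) (by omega), if_neg (by omega), smul_zero, smul_zero]
  refine ⟨_, _, isSl2Triple_wedge (a' := (a 1)⁻¹ • vec n (2 * n + 1)) (b' := (w o)⁻¹ • vec n o')
    ?_ ?_ hww ?_ f2 ?_ f1 ?_ ?_ ?_, ?_, ?_⟩
  · rw [form_coordVec]
    refine Finset.sum_eq_zero fun l hl => ?_
    rw [Finset.mem_Icc] at hl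
    rw [ha l (by omega), mul_zero, zero_mul]
  · rw [form_coordVec]
    refine Finset.sum_eq_zero fun l hl => ?_
    rw [Finset.mem_Icc] at hl
    rw [ha (2 * n + 2 - l) (by omega), zero_mul, zero_mul]
  · rw [map_smul, map_smul, LinearMap.smul_apply,
      form_vec (by omega) (by omega) (by omega) (by omega), if_neg (by omega), smul_zero, smul_zero]
  · rw [map_smul, map_smul, LinearMap.smul_apply,
      form_vec (by omega) (by omega) (by omega) (by omega), if_neg (by omega), smul_zero, smul_zero]
  · rw [map_smul, form_coordVec_vec a (by omega) (by omega), if_pos (by omega),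
      ha _ (by omega), zero_mul, smul_zero]
  · rw [map_smul, form_coordVec_vec w (by omega) le_rfl, if_pos (by omega),
      hw _ (by omega), zero_mul, smul_zero]
  · rw [map_smul, form_coordVec_vec w (by omega) (by omega), if_pos (by omega),
      show 2 * n + 2 - o' = o by omega, if_neg (by omega), mul_one, smul_eq_mul,
      inv_mul_cancel₀ hwo]
  · rw [add_lie, lie_wedge_dualIsotropic hV hin.le hd, lie_wedge_leviPart hV hin.le hl hlw,
      form_comm, f1, add_zero, mul_one, level, if_neg hin.ne]
  · rw [wedge_swap, neg_lie, lie_wedge_dualIsotropic hV hin.le hd, f2, mul_zero, zero_smul, neg_zero]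

/-- Nonvanishing of `D` provides a basis of `⟨e_1, e_2⟩` dual to `A, B`. Corrections by vectors of
this isotropic plane make `A, B` span an isotropic plane and change the bivector only inside the
stabilizer, so the coordinates of `A, B` remain free parameters. Both summands of `h` act by the
level, which is `m/2` for `i = n` and `m` otherwise. -/
theorem exists_sl2_of_plane (hV : IsHighestWeightModule V ((m : ℝ) • fundWeight n i) v)
    (hi : 2 ≤ i) (hin : i ≤ n) {a b : ℕ → ℂ} (hD : a 1 * b 2 - a 2 * b 1 ≠ 0) :
    ∃ h e f : SO n, IsSl2Triple h e f ∧
      f - wedge n (coordVec n i a) (coordVec n i b) ∈ lineStab n v ∧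
      ⁅h, v⁆ = (((if i = n then m else 2 * m : ℕ) : ℕ) : ℂ) • v ∧ ⁅e, v⁆ = 0 := by
  set D := a 1 * b 2 - a 2 * b 1 with hDdef
  set A := coordVec n i a with hA
  set B := coordVec n i b with hB
  set e₁ := vec n (2 * n + 1) with he₁
  set e₂ := vec n (2 * n) with he₂
  have m₁ : e₁ ∈ dualIsotropic n i := Submodule.subset_span ⟨1, le_rfl, by omega, by congr 1⟩
  have m₂ : e₂ ∈ dualIsotropic n i := Submodule.subset_span ⟨2, by omega, hi, by congr 1⟩
  set A' := D⁻¹ • (b 2 • e₁ - b 1 • e₂) with hA'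
  set B' := D⁻¹ • (a 1 • e₂ - a 2 • e₁) with hB'
  have mA : A' ∈ dualIsotropic n i := Submodule.smul_mem _ _
    (Submodule.sub_mem _ (Submodule.smul_mem _ _ m₁) (Submodule.smul_mem _ _ m₂))
  have mB : B' ∈ dualIsotropic n i := Submodule.smul_mem _ _
    (Submodule.sub_mem _ (Submodule.smul_mem _ _ m₂) (Submodule.smul_mem _ _ m₁))
  have k₁ : ∀ c : ℕ → ℂ, form n (coordVec n i c) e₁ = c 1 := fun c => by
    rw [he₁, form_coordVec_vec c (by omega) le_rfl, if_pos (by omega), if_neg (by omega), mul_one]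
    congr 1
    omega
  have k₂ : ∀ c : ℕ → ℂ, form n (coordVec n i c) e₂ = c 2 := fun c => by
    rw [he₂, form_coordVec_vec c (by omega) (by omega), if_pos (by omega), if_neg (by omega),
      mul_one]
    congr 1
    omega
  have e11 : form n e₁ e₁ = 0 := by
    rw [form_vec (by omega) (by omega) (by omega) (by omega), if_neg (by omega)]
  have e12 : form n e₁ e₂ = 0 := by
    rw [form_vec (by omega) (by omega) (by omega) (by omega), if_neg (by omega)]
  have e21 : form n e₂ e₁ = 0 := by
    rw [form_vec (by omega) (by omega) (by omega) (by omega), if_neg (by omega)]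
  have e22 : form n e₂ e₂ = 0 := by
    rw [form_vec (by omega) (by omega) (by omega) (by omega), if_neg (by omega)]
  have AA' : form n A A' = 1 := by
    rw [hA', map_smul, map_sub, map_smul, map_smul, k₁, k₂]
    simp only [smul_eq_mul]
    rw [inv_mul_eq_one₀ hD, hDdef]
    ring
  have AB' : form n A B' = 0 := by
    rw [hB', map_smul, map_sub, map_smul, map_smul, k₁, k₂]
    simp only [smul_eq_mul]
    ring
  have BA' : form n B A' = 0 := by
    rw [hA', map_smul, map_sub, map_smul, map_smul, k₁, k₂]
    simp only [smul_eq_mul]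
    ring
  have BB' : form n B B' = 1 := by
    rw [hB', map_smul, map_sub, map_smul, map_smul, k₁, k₂]
    simp only [smul_eq_mul]
    rw [inv_mul_eq_one₀ hD, hDdef]
  have A'A' : form n A' A' = 0 := by
    simp [hA', e11, e12, e21, e22]
  have A'B' : form n A' B' = 0 := by
    simp [hA', hB', e11, e12, e21, e22]
  have B'B' : form n B' B' = 0 := by
    simp [hB', e11, e12, e21, e22]
  have A'A : form n A' A = 1 := by rw [form_comm, AA']
  have B'A : form n B' A = 0 := by rw [form_comm, AB']
  have A'B : form n A' B = 0 := by rw [form_comm, BA']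
  have B'B : form n B' B = 1 := by rw [form_comm, BB']
  have B'A' : form n B' A' = 0 := by rw [form_comm, A'B']
  have BA : form n B A = form n A B := form_comm _ _
  set α := form n A A with hα
  set β := form n B B with hβ
  set γ := form n A B with hγ
  -- The coefficients solve `(A₁,A₁) = (A₁,B₁) = (B₁,B₁) = 0`; as `A', B'` span an isotropic plane,
  -- the pairings with `A', B'` are unaffected.
  set A₁ := A - (α / 2) • A' with hA₁
  set B₁ := B - (β / 2) • B' - γ • A' with hB₁
  have g1 : form n A₁ A' = 1 := by simp [hA₁, AA', A'A']
  have g2 : form n A₁ B' = 0 := by simp [hA₁, AB', A'B']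
  have g3 : form n B₁ A' = 0 := by simp [hB₁, BA', B'A', A'A']
  have g4 : form n B₁ B' = 1 := by simp [hB₁, BB', B'B', A'B']
  refine ⟨_, _, wedge n A₁ B₁, isSl2Triple_wedge (a' := A') (b' := B') ?_ ?_ ?_ A'A' A'B' B'B'
    g1 g2 g3 g4, ?_, ?_, ?_⟩
  · simp only [hA₁, map_sub, map_smul, LinearMap.sub_apply, LinearMap.smul_apply, smul_eq_mul, AA',
      A'A, A'A', ← hα]
    ring
  · simp only [hA₁, hB₁, map_sub, map_smul, LinearMap.sub_apply, LinearMap.smul_apply, smul_eq_mul,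
      AA', AB', A'B, A'B', A'A', ← hγ]
    ring
  · simp only [hB₁, map_sub, map_smul, LinearMap.sub_apply, LinearMap.smul_apply, smul_eq_mul,
      BA', BB', A'B, B'B, A'B', B'A', A'A', B'B', ← hβ]
    ring
  -- The difference is written with a factor `A₁ - A` or `B₁ - B` from `⟨e_1, …, e_i⟩` in each term.
  · have h1 : wedge n A₁ B₁ - wedge n A B =
        wedge n (A₁ - A) B₁ - wedge n (B₁ - B) A := by
      rw [wedge_swap (B₁ - B)]
      simp only [map_sub, LinearMap.sub_apply]
      abel
    have m3 : A₁ - A ∈ dualIsotropic n i := by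
      rw [hA₁, sub_sub_cancel_left]
      exact Submodule.neg_mem _ (Submodule.smul_mem _ _ mA)
    have m4 : B₁ - B ∈ dualIsotropic n i := by
      rw [show B₁ - B = -((β / 2) • B' + γ • A') by rw [hB₁]; abel]
      exact Submodule.neg_mem _
        (Submodule.add_mem _ (Submodule.smul_mem _ _ mB) (Submodule.smul_mem _ _ mA))
    rw [h1]
    exact Submodule.sub_mem _ ⟨_, lie_wedge_dualIsotropic hV hin m3 _⟩
      ⟨_, lie_wedge_dualIsotropic hV hin m4 _⟩
  · rw [add_lie, lie_wedge_dualIsotropic hV hin mA, lie_wedge_dualIsotropic hV hin mB,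
      form_comm A', g1, form_comm B', g4, ← add_smul, level]
    congr 1
    split_ifs
    · ring
    · push_cast
      ring
  · rw [lie_wedge_dualIsotropic hV hin mB, B'A', mul_zero, zero_smul]

end Families

/-! ### Straightening relations -/

section Relations

variable {n m i : ℕ} {V : Type*} [AddCommGroup V] [Module ℂ V] [LieRingModule (SO n) V]
  [LieModule ℂ (SO n) V] {v : V}

theorem exists_vector_eq_smul {x : PosRoot n → nMinus n}
    (hx : ∀ b, (x b : SO n) ∈ rootSpace (-b.root)) (hx0 : ∀ b, x b ≠ 0) :
    ∃ ν : PosRoot n → ℂ, (∀ b, ν b ≠ 0) ∧ ∀ b, b.vector = ν b • (x b : SO n) := by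
  have h : ∀ b, ∃ c : ℂ, c ≠ 0 ∧ b.vector = c • (x b : SO n) := fun b => by
    obtain ⟨c, hc⟩ := exists_eq_smul_vector b (hx b)
    have hc0 : c ≠ 0 := by
      rintro rfl
      exact hx0 b (Subtype.ext (by rw [hc, zero_smul]; rfl))
    exact ⟨c⁻¹, inv_ne_zero hc0, by rw [hc, smul_smul, inv_mul_cancel₀ hc0, one_smul]⟩
  choose ν h0 h1 using h
  exact ⟨ν, h0, h1⟩

theorem sum_subset_of_support {J A : Type*} [AddCommMonoid A] {S T : Finset J} (hST : S ⊆ T)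
    {k : J → ℕ} (hk : ∀ j, k j ≠ 0 → j ∈ S) (F : J → ℕ → A) (hF : ∀ j, F j 0 = 0) :
    ∑ j ∈ S, F j (k j) = ∑ j ∈ T, F j (k j) := by
  refine Finset.sum_subset hST fun j _ hj => ?_
  rw [show k j = 0 by by_contra h; exact hj (hk j h), hF]

theorem rowSum_eq (t : PosRoot n →₀ ℕ) (p : ℕ) :
    rowSum t p = ∑ b, t b * if b.1.1 = p then 1 else 0 := by
  simp [rowSum, Finset.sum_filter]

theorem colSum_eq (t : PosRoot n →₀ ℕ) (q : ℕ) :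
    colSum t q = ∑ b, t b * if b.snd = q then 1 else 0 := by
  simp [colSum, Finset.sum_filter]

theorem sum_single_apply {J : Type*} (S : Finset J) (ρ : J → PosRoot n) (k : J → ℕ) (b : PosRoot n)
    [DecidableEq (PosRoot n)] :
    (∑ j ∈ S, Finsupp.single (ρ j) (k j)) b = ∑ j ∈ S, if ρ j = b then k j else 0 := by
  rw [Finsupp.finsetSum_apply]
  exact Finset.sum_congr rfl fun j _ => by rw [Finsupp.single_apply]

/-- The parameters are all coordinates of `A` and `B`. The target monomial chooses `a_p b_q` on `s₁`
and `-a_q b_p` on `s₂`; the position of the two chains relative to `x = j + 1` is what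
`eq_or_monoLT_of_matching` requires. -/
theorem exists_plane_relation (hV : IsHighestWeightModule V ((m : ℝ) • fundWeight n i) v)
    (hin : i ≤ n) {x : PosRoot n → nMinus n} (hx : ∀ b, (x b : SO n) ∈ rootSpace (-b.root))
    (hx0 : ∀ b, x b ≠ 0) {j : ℕ} (hj : 1 ≤ j) (hji : j < i) {s₁ s₂ : PosRoot n →₀ ℕ}
    (h₁ : ∀ b, s₁ b ≠ 0 → b.MemR i ∧ b.1.1 ≤ j ∧ j < b.snd)
    (h₂ : ∀ b, s₂ b ≠ 0 → b.MemR i ∧ b.1.1 ≤ j + 1 ∧ j + 1 < b.snd)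
    (c₁ : ChainSupported s₁) (c₂ : ChainSupported s₂)
    (hd : (if i = n then m else 2 * m) < (s₁ + s₂).degree) :
    ∃ c : (PosRoot n →₀ ℕ) →₀ ℂ,
      (∀ t ∈ c.support, monoLT t (s₁ + s₂) ∧ ∀ b, ¬ b.MemR i → t b = 0) ∧
      mon (s₁ + s₂) + c.sum (fun t a => a • mon t) ∈ annIdeal v x := by
  classical
  obtain ⟨ν, hν, hvec⟩ := exists_vector_eq_smul hx hx0
  set T : Finset (PosRoot n × Bool) := Finset.univ ×ˢ Finset.univ with hT
  set S : Finset (PosRoot n × Bool) := (Finset.univ.filter fun b : PosRoot n => b.MemR i) ×ˢ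
    Finset.univ with hS
  have hST : S ⊆ T := Finset.subset_univ _ |>.trans (by rw [hT, Finset.univ_product_univ])
  have memS : ∀ j : PosRoot n × Bool, j ∈ S ↔ j.1.MemR i := fun j => by simp [hS]
  -- `Sum.inl k` stands for `a_k` and `Sum.inr k` for `b_k`; the Boolean selects one of the two
  -- terms of the Plücker coordinate.
  let e : PosRoot n × Bool → (ℕ ⊕ ℕ) →₀ ℕ := fun j =>
    if j.2 then Finsupp.single (Sum.inl j.1.1.1) 1 + Finsupp.single (Sum.inr j.1.snd) 1
    else Finsupp.single (Sum.inl j.1.snd) 1 + Finsupp.single (Sum.inr j.1.1.1) 1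
  let κ : PosRoot n × Bool → ℂ := fun j => if j.2 then ν j.1 else -ν j.1
  let k₀ : PosRoot n × Bool → ℕ := fun j => if j.2 then s₁ j.1 else s₂ j.1
  have hk₀ : ∀ j, k₀ j ≠ 0 → j ∈ S := by
    rintro ⟨b, _ | _⟩ h
    · exact (memS _).2 (h₂ b h).1
    · exact (memS _).2 (h₁ b h).1
  -- the two parts of an exponent
  let part : (PosRoot n × Bool → ℕ) → Bool → PosRoot n →₀ ℕ := fun k c =>
    Finsupp.equivFunOnFinite.symm fun b => k (b, c)
  have part_apply : ∀ k c b, part k c b = k (b, c) := fun k c b => rfl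
  have part₁ : part k₀ true = s₁ := Finsupp.ext fun b => rfl
  have part₂ : part k₀ false = s₂ := Finsupp.ext fun b => rfl
  have hsum : ∀ k : PosRoot n × Bool → ℕ, (∀ j, k j ≠ 0 → j ∈ S) →
      ∑ j ∈ S, Finsupp.single j.1 (k j) = part k true + part k false := by
    intro k hk
    rw [sum_subset_of_support hST hk (fun j a => Finsupp.single j.1 a) fun j =>
      Finsupp.single_zero _]
    ext b
    rw [sum_single_apply, hT, Finset.sum_product]
    simp [part_apply, Finset.sum_add_distrib]
  have hsum₀ : ∑ j ∈ S, Finsupp.single j.1 (k₀ j) = s₁ + s₂ := by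
    rw [hsum k₀ hk₀, part₁, part₂]
  have hdeg : ∀ k : PosRoot n × Bool → ℕ, (∀ j, k j ≠ 0 → j ∈ S) →
      ∑ j ∈ S, k j = (part k true + part k false).degree := by
    intro k hk
    rw [← hsum k hk, map_sum]
    simp
  have hinl : ∀ k : PosRoot n × Bool → ℕ, (∀ j, k j ≠ 0 → j ∈ S) → ∀ p,
      (∑ j ∈ S, k j • e j) (Sum.inl p) = rowSum (part k true) p + colSum (part k false) p := by
    intro k hk p
    rw [sum_subset_of_support hST hk (fun j a => a • e j) fun j => zero_smul _ _,
      Finsupp.finsetSum_apply, hT, Finset.sum_product, rowSum_eq, colSum_eq,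
      ← Finset.sum_add_distrib]
    refine Finset.sum_congr rfl fun b _ => ?_
    simp [e, part_apply, Finsupp.single_apply]
  have hinr : ∀ k : PosRoot n × Bool → ℕ, (∀ j, k j ≠ 0 → j ∈ S) → ∀ p,
      (∑ j ∈ S, k j • e j) (Sum.inr p) = colSum (part k true) p + rowSum (part k false) p := by
    intro k hk p
    rw [sum_subset_of_support hST hk (fun j a => a • e j) fun j => zero_smul _ _,
      Finsupp.finsetSum_apply, hT, Finset.sum_product, rowSum_eq, colSum_eq,
      ← Finset.sum_add_distrib]
    refine Finset.sum_congr rfl fun b _ => ?_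
    simp [e, part_apply, Finsupp.single_apply]
  let g : MvPolynomial (ℕ ⊕ ℕ) ℂ :=
    MvPolynomial.X (Sum.inl 1) * MvPolynomial.X (Sum.inr 2) -
      MvPolynomial.X (Sum.inl 2) * MvPolynomial.X (Sum.inr 1)
  have hg : g ≠ 0 := by
    intro h
    have := congrArg (MvPolynomial.eval
      (Sum.elim (fun k => if k = 1 then 1 else 0) (fun k => if k = 2 then 1 else 0))) h
    simp [g] at this
  have key := exists_leading_relation (i := i) (annIdeal v x) S Prod.fst e κ hg k₀ hk₀
    (by
      rintro ⟨b, _ | _⟩ _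
      · exact neg_ne_zero.2 (hν b)
      · exact hν b)
    (fun j hj => (memS j).1 hj) ?_ ?_
  · rwa [hsum₀] at key
  · intro τ hτ
    have hD : τ (Sum.inl 1) * τ (Sum.inr 2) - τ (Sum.inl 2) * τ (Sum.inr 1) ≠ 0 := by
      simpa [g] using hτ
    obtain ⟨h, E, f, t, hf, hh, hE⟩ := exists_sl2_of_plane hV (a := fun k => τ (Sum.inl k))
      (b := fun k => τ (Sum.inr k)) (by omega) hin hD
    refine sum_pow_mem_annIdeal_of_sl2 hV t ?_ hh hE ?_
    · have hf' := wedge_coordVec_sub_mem hV hin (fun k => τ (Sum.inl k)) fun k => τ (Sum.inr k)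
      have := Submodule.add_mem _ hf hf'
      rw [sub_add_sub_cancel] at this
      convert this using 2
      rw [hS, Finset.sum_product]
      refine Finset.sum_congr rfl fun b _ => ?_
      simp only [Fintype.sum_bool, κ, e, hvec b, smul_smul, ← add_smul]
      congr 1
      simp only [if_true, Bool.false_eq_true, if_false]
      rw [Finsupp.prod_add_index' (fun _ => pow_zero _) (fun _ _ _ => pow_add _ _ _),
        Finsupp.prod_add_index' (fun _ => pow_zero _) (fun _ _ _ => pow_add _ _ _)]
      simp only [Finsupp.prod_single_index, pow_zero, pow_one]
      ring
    · rw [hdeg k₀ hk₀, part₁, part₂]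
      exact hd
  · intro k hk hkd hke
    rw [hsum k hk, hsum₀]
    rw [hdeg k hk, hdeg k₀ hk₀, part₁, part₂] at hkd
    refine (eq_or_monoLT_of_matching (x := j + 1)
      (fun b hb => by have := h₁ b hb; omega) (fun b hb => (h₂ b hb).2) c₁ c₂
      (fun p => ?_) (fun p => ?_) hkd).imp_left fun h => ?_
    · rw [← hinl k hk, hke, hinl k₀ hk₀, part₁, part₂]
    · rw [← hinr k hk, hke, hinr k₀ hk₀, part₁, part₂]
    · funext ⟨b, c⟩
      cases c
      · exact DFunLike.congr_fun h.2 b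
      · exact DFunLike.congr_fun h.1 b

/-- The quadric of isotropic vectors in the Levi part is parametrised by solving for the coordinate
at `o'`, which pairs with `o`. The two choices of `o'` are the extreme columns avoided by the two
kinds of type 1 paths. -/
theorem exists_isotropic_relation (hV : IsHighestWeightModule V ((m : ℝ) • fundWeight n i) v)
    (hi : 1 ≤ i) (hin : i < n) {x : PosRoot n → nMinus n}
    (hx : ∀ b, (x b : SO n) ∈ rootSpace (-b.root)) (hx0 : ∀ b, x b ≠ 0) {o o' : ℕ}
    (ho : o = i + 1 ∧ o' = 2 * n + 1 - i ∨ o = 2 * n + 1 - i ∧ o' = i + 1) {s : PosRoot n →₀ ℕ}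
    (hs : ∀ b, s b ≠ 0 → b.MemR i ∧ i < b.snd ∧ b.snd ≠ o') (hc : ChainSupported s)
    (hd : m < s.degree) :
    ∃ c : (PosRoot n →₀ ℕ) →₀ ℂ,
      (∀ t ∈ c.support, monoLT t s ∧ ∀ b, ¬ b.MemR i → t b = 0) ∧
      mon s + c.sum (fun t a => a • mon t) ∈ annIdeal v x := by
  classical
  obtain ⟨ν, hν, hvec⟩ := exists_vector_eq_smul hx hx0
  let T : Finset (PosRoot n × ℕ) := Finset.univ ×ˢ Finset.range (2 * n + 2)
  -- Outside column `o'` the coordinate of `w` is one monomial and the second index is the dummy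
  -- value `0`. In column `o'` the second index runs over the terms of the quadratic expression
  -- solved for.
  let good : PosRoot n × ℕ → Prop := fun j => j.1.MemR i ∧ i < j.1.snd ∧
    (j.1.snd ≠ o' ∧ j.2 = 0 ∨ j.1.snd = o' ∧ i + 2 ≤ j.2 ∧ j.2 ≤ 2 * n - i)
  let S : Finset (PosRoot n × ℕ) := T.filter good
  have hST : S ⊆ T := Finset.filter_subset _ _
  have memS : ∀ j : PosRoot n × ℕ, j ∈ S ↔ good j := fun j => by
    simp only [S, T, Finset.mem_filter, Finset.mem_product, Finset.mem_univ, true_and,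
      Finset.mem_range, and_iff_right_iff_imp]
    intro h
    have := h.2.2
    omega
  let e : PosRoot n × ℕ → (ℕ ⊕ ℕ) →₀ ℕ := fun j =>
    if j.1.snd = o' then Finsupp.single (Sum.inl j.1.1.1) 1 +
      (Finsupp.single (Sum.inr j.2) 1 + Finsupp.single (Sum.inr (2 * n + 2 - j.2)) 1)
    else Finsupp.single (Sum.inl j.1.1.1) 1 +
      (Finsupp.single (Sum.inr o) 1 + Finsupp.single (Sum.inr j.1.snd) 1)
  -- In `(w,w)` the columns `o` and `o'` together contribute `2 w_o w_{o'}`, whence the `-1/2`; the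
  -- numerator accounts for `(u,u) = 2`.
  let γ : ℕ → ℂ := fun l => -(if l = n + 1 then 2 else 1) / 2
  have hγ : ∀ l, γ l ≠ 0 := fun l => by
    simp only [γ]
    split_ifs <;> norm_num
  let κ : PosRoot n × ℕ → ℂ := fun j => ν j.1 * if j.1.snd = o' then γ j.2 else 1
  let k₀ : PosRoot n × ℕ → ℕ := fun j => if j.2 = 0 then s j.1 else 0
  have hk₀ : ∀ j, k₀ j ≠ 0 → j ∈ S := by
    rintro ⟨b, l⟩ h
    have hl : l = 0 := by
      by_contra h'
      exact h (if_neg h')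
    subst hl
    have := hs b h
    exact (memS _).2 ⟨this.1, this.2.1, Or.inl ⟨this.2.2, rfl⟩⟩
  let proj : (PosRoot n × ℕ → ℕ) → PosRoot n →₀ ℕ := fun k =>
    Finsupp.equivFunOnFinite.symm fun b => ∑ l ∈ Finset.range (2 * n + 2), k (b, l)
  have proj_apply : ∀ k b, proj k b = ∑ l ∈ Finset.range (2 * n + 2), k (b, l) := fun k b => rfl
  have proj₀ : proj k₀ = s := Finsupp.ext fun b => by
    rw [proj_apply]
    simp [k₀]
  have hsum : ∀ k : PosRoot n × ℕ → ℕ, (∀ j, k j ≠ 0 → j ∈ S) →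
      ∑ j ∈ S, Finsupp.single j.1 (k j) = proj k := by
    intro k hk
    rw [sum_subset_of_support hST hk (fun j a => Finsupp.single j.1 a) fun j =>
      Finsupp.single_zero _]
    ext b
    rw [sum_single_apply, Finset.sum_product, proj_apply, Finset.sum_eq_single b]
    · simp
    · intro c _ hcb
      simp [hcb]
    · simp
  have hsum₀ : ∑ j ∈ S, Finsupp.single j.1 (k₀ j) = s := by rw [hsum k₀ hk₀, proj₀]
  have hdeg : ∀ k : PosRoot n × ℕ → ℕ, (∀ j, k j ≠ 0 → j ∈ S) →
      ∑ j ∈ S, k j = (proj k).degree := by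
    intro k hk
    rw [← hsum k hk, map_sum]
    simp
  have hinl : ∀ k : PosRoot n × ℕ → ℕ, (∀ j, k j ≠ 0 → j ∈ S) → ∀ p,
      (∑ j ∈ S, k j • e j) (Sum.inl p) = rowSum (proj k) p := by
    intro k hk p
    rw [sum_subset_of_support hST hk (fun j a => a • e j) fun j => zero_smul _ _,
      Finsupp.finsetSum_apply, Finset.sum_product, rowSum_eq]
    refine Finset.sum_congr rfl fun b _ => ?_
    rw [proj_apply, Finset.sum_mul]
    refine Finset.sum_congr rfl fun l _ => ?_
    by_cases h : b.snd = o' <;> simp [e, h, Finsupp.single_apply]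
  have hinr : ∀ k : PosRoot n × ℕ → ℕ, (∀ j, k j ≠ 0 → j ∈ S) → ∀ q,
      (∑ j ∈ S, k j • e j) (Sum.inr q) =
        ∑ b, if b.snd = o' then ∑ l ∈ Finset.range (2 * n + 2),
          k (b, l) * ((if l = q then 1 else 0) + if 2 * n + 2 - l = q then 1 else 0)
        else proj k b * ((if o = q then 1 else 0) + if b.snd = q then 1 else 0) := by
    intro k hk q
    rw [sum_subset_of_support hST hk (fun j a => a • e j) fun j => zero_smul _ _,
      Finsupp.finsetSum_apply, Finset.sum_product]
    refine Finset.sum_congr rfl fun b _ => ?_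
    by_cases h : b.snd = o'
    · rw [if_pos h]
      refine Finset.sum_congr rfl fun l _ => ?_
      simp [e, h, Finsupp.single_apply, mul_add]
    · rw [if_neg h, proj_apply, Finset.sum_mul]
      refine Finset.sum_congr rfl fun l _ => ?_
      simp [e, h, Finsupp.single_apply, mul_add]
  -- the balance between the columns `o` and `o'`
  have hbal : ∀ k : PosRoot n × ℕ → ℕ, (∀ j, k j ≠ 0 → j ∈ S) →
      (∑ j ∈ S, k j • e j) (Sum.inr o) + colSum (proj k) o' =
        (proj k).degree + colSum (proj k) o := by
    intro k hk
    rw [hinr k hk, colSum_eq, colSum_eq, Finsupp.degree_eq_sum, ← Finset.sum_add_distrib,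
      ← Finset.sum_add_distrib]
    refine Finset.sum_congr rfl fun b _ => ?_
    by_cases h : b.snd = o'
    -- The terms in column `o'` involve only intermediate coordinates, never the parameter at `o`,
    -- whereas every other term contains it at least once, and twice in column `o`.
    · rw [if_pos h, if_pos h, if_neg (by omega), Finset.sum_eq_zero]
      · ring
      · intro l _
        by_cases h0 : k (b, l) = 0
        · rw [h0, zero_mul]
        · have := ((memS _).1 (hk _ h0)).2.2
          simp only at this
          rw [if_neg (by omega), if_neg (by omega), add_zero, mul_zero]
    · rw [if_neg h, if_neg h, if_pos rfl]
      ring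
  have hmid : ∀ k : PosRoot n × ℕ → ℕ, (∀ j, k j ≠ 0 → j ∈ S) → colSum (proj k) o' = 0 →
      ∀ q, q ≠ o → (∑ j ∈ S, k j • e j) (Sum.inr q) = colSum (proj k) q := by
    intro k hk hz q hq
    rw [hinr k hk, colSum_eq]
    refine Finset.sum_congr rfl fun b _ => ?_
    by_cases h : b.snd = o'
    · have h0 : proj k b = 0 := eq_zero_of_colSum (by rw [h, hz])
      rw [if_pos h, h0, zero_mul]
      rw [proj_apply, Finset.sum_eq_zero_iff] at h0
      exact Finset.sum_eq_zero fun l hl => by rw [h0 l hl, zero_mul]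
    · rw [if_neg h, if_neg (Ne.symm hq), zero_add]
  have hs' : colSum s o' = 0 := colSum_eq_zero fun b hb => by
    by_contra h
    exact (hs b h).2.2 hb
  let g : MvPolynomial (ℕ ⊕ ℕ) ℂ := MvPolynomial.X (Sum.inl 1) * MvPolynomial.X (Sum.inr o)
  have hg : g ≠ 0 := mul_ne_zero (MvPolynomial.X_ne_zero _) (MvPolynomial.X_ne_zero _)
  have key := exists_leading_relation (i := i) (annIdeal v x) S Prod.fst e κ hg k₀ hk₀
    (by
      rintro ⟨b, l⟩ _
      refine mul_ne_zero (hν b) ?_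
      split_ifs
      · exact hγ l
      · exact one_ne_zero)
    (fun j hj => ((memS j).1 hj).1) ?_ ?_
  · rwa [hsum₀] at key
  · intro τ hτ
    have hτ' : τ (Sum.inl 1) ≠ 0 ∧ τ (Sum.inr o) ≠ 0 := by
      simpa [g] using hτ
    let Q : ℂ := ∑ l ∈ Finset.Icc (i + 2) (2 * n - i), γ l * (τ (Sum.inr l) *
      τ (Sum.inr (2 * n + 2 - l)))
    let a : ℕ → ℂ := fun k => if k ≤ i then τ (Sum.inl k) else 0
    -- Scaling by the parameter at `o` removes the denominator: all nonzero coordinates, including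
    -- `Q` at `o'`, become quadratic in the parameters.
    let w : ℕ → ℂ := fun k => if k ≤ i then 0 else if k = o' then Q
      else τ (Sum.inr o) * τ (Sum.inr k)
    have hwo : w o = τ (Sum.inr o) * τ (Sum.inr o) := by
      simp only [w]
      rw [if_neg (by omega), if_neg (by omega)]
    have hwo' : w o' = Q := by
      simp only [w]
      rw [if_neg (by omega), if_pos trivial]
    have hww : form n (coordVec n i w) (coordVec n i w) = 0 := by
      have hI : Finset.Icc (i + 1) (2 * n + 1 - i) =
          insert (i + 1) (insert (2 * n + 1 - i) (Finset.Icc (i + 2) (2 * n - i))) := by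
        ext l
        simp only [Finset.mem_insert, Finset.mem_Icc]
        omega
      rw [form_coordVec, hI, Finset.sum_insert (by simp only [Finset.mem_insert, Finset.mem_Icc]; omega),
        Finset.sum_insert (by simp only [Finset.mem_Icc]; omega), if_neg (by omega),
        if_neg (by omega), show 2 * n + 2 - (i + 1) = 2 * n + 1 - i by omega,
        show 2 * n + 2 - (2 * n + 1 - i) = i + 1 by omega]
      have h1 : ∑ l ∈ Finset.Icc (i + 2) (2 * n - i), w (2 * n + 2 - l) * w l *
          (if l = n + 1 then 2 else 1) = -2 * (τ (Sum.inr o) * τ (Sum.inr o)) * Q := by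
        rw [Finset.mul_sum]
        refine Finset.sum_congr rfl fun l hl => ?_
        rw [Finset.mem_Icc] at hl
        simp only [w, γ]
        rw [if_neg (by omega), if_neg (by omega), if_neg (by omega), if_neg (by omega)]
        ring
      rw [h1]
      rcases ho with ⟨h2, h3⟩ | ⟨h2, h3⟩
      · rw [← h2, ← h3, hwo, hwo']
        ring
      · rw [← h2, ← h3, hwo, hwo']
        ring
    obtain ⟨h, E, t, hh, hE⟩ := exists_sl2_of_isotropic hV hi hin ho (a := a) (w := w)
      (fun k hk => if_neg (by omega)) (fun k hk => if_pos hk)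
      (by simpa only [a, if_pos hi] using hτ'.1)
      (by rw [hwo]; exact mul_ne_zero hτ'.2 hτ'.2) hww
    refine sum_pow_mem_annIdeal_of_sl2 hV t ?_ hh hE ?_
    · convert wedge_coordVec_sub_mem hV hin.le a w using 2
      rw [Finset.sum_filter, Finset.sum_product, Finset.sum_filter]
      refine Finset.sum_congr rfl fun b _ => ?_
      by_cases hbR : b.MemR i
      swap
      · rw [if_neg hbR]
        exact Finset.sum_eq_zero fun l _ => if_neg fun h => hbR h.1
      rw [if_pos hbR]
      have hbR' := hbR.1
      by_cases hb : i < b.snd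
      swap
      · have ea : w b.snd = 0 := if_pos (by omega)
        have eb : w b.1.1 = 0 := if_pos hbR'
        rw [ea, eb, mul_zero, mul_zero, sub_zero, zero_smul]
        exact Finset.sum_eq_zero fun l _ => if_neg fun h => hb h.2.1
      have ea : a b.snd = 0 := if_neg (by omega)
      have eb : a b.1.1 = τ (Sum.inl b.1.1) := if_pos hbR'
      rw [ea, eb, zero_mul, sub_zero, hvec b, smul_smul]
      by_cases hbo : b.snd = o'
      · rw [hbo, hwo', ← Finset.sum_filter]
        have hI : (Finset.range (2 * n + 2)).filter (fun l => good (b, l)) =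
            Finset.Icc (i + 2) (2 * n - i) := by
          ext l
          simp only [good, Finset.mem_filter, Finset.mem_range, Finset.mem_Icc, hbR, hbo,
            true_and, ne_eq, not_true_eq_false, false_and, false_or]
          omega
        rw [hI]
        refine (Finset.sum_smul (x := (x b : SO n)) (s := Finset.Icc (i + 2) (2 * n - i))
          (f := fun l => κ (b, l) * (e (b, l)).prod fun a k => τ a ^ k)).symm.trans ?_
        congr 1
        simp only [Q]
        rw [Finset.mul_sum, Finset.sum_mul]
        refine Finset.sum_congr rfl fun l _ => ?_
        simp only [κ, e]
        rw [if_pos hbo, if_pos hbo,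
          Finsupp.prod_add_index' (fun _ => pow_zero _) (fun _ _ _ => pow_add _ _ _),
          Finsupp.prod_add_index' (fun _ => pow_zero _) (fun _ _ _ => pow_add _ _ _)]
        simp only [Finsupp.prod_single_index, pow_zero, pow_one]
        ring
      · have hw : w b.snd = τ (Sum.inr o) * τ (Sum.inr b.snd) := by
          simp only [w]
          rw [if_neg (by omega), if_neg hbo]
        rw [hw, Finset.sum_eq_single 0]
        · rw [if_pos ⟨hbR, hb, Or.inl ⟨hbo, rfl⟩⟩]
          congr 1
          simp only [κ, e]
          rw [if_neg hbo, if_neg hbo,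
            Finsupp.prod_add_index' (fun _ => pow_zero _) (fun _ _ _ => pow_add _ _ _),
            Finsupp.prod_add_index' (fun _ => pow_zero _) (fun _ _ _ => pow_add _ _ _)]
          simp only [Finsupp.prod_single_index, pow_zero, pow_one]
          ring
        · intro l _ hl
          refine if_neg fun h => ?_
          rcases h.2.2 with h | h
          · exact hl h.2
          · exact hbo h.1
        · simp
    · rw [hdeg k₀ hk₀, proj₀]
      exact hd
  · intro k hk hkd hke
    rw [hsum k hk, hsum₀]
    rw [hdeg k hk, hdeg k₀ hk₀, proj₀] at hkd
    have hrow : ∀ p, rowSum (proj k) p = rowSum s p := fun p => by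
      rw [← hinl k hk, hke, hinl k₀ hk₀, proj₀]
    have hb1 := hbal k hk
    have hb2 := hbal k₀ hk₀
    rw [← hke, proj₀, hs'] at hb2
    -- Once column `o'` is empty, the parameter exponents at `q ≠ o` are the column sums, and the
    -- balance determines column `o`.
    have hz : colSum (proj k) o' = 0 → ∀ q, colSum s q = colSum (proj k) q := by
      intro hz q
      by_cases hq : q = o
      · subst hq
        omega
      · rw [← hmid k hk hz q hq, hke, hmid k₀ hk₀ (by rw [proj₀, hs']) q hq, proj₀]
    -- The balance says that column `o` of `t` exceeds that of `s` by column `o'` of `t`. Since `i +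
    -- 1` is `o` or `o'`, column `i + 1` of `t` has at least as much as that of `s`, with equality
    -- only if column `o'` is empty.
    have hres := eq_or_monoLT_of_top_column hc hrow (i + 1) (fun b hb => (hs b hb).2.1)
      (by
        rcases ho with ⟨h2, h3⟩ | ⟨h2, h3⟩
        · rw [← h2]
          omega
        · rw [← h3, hs']
          exact Nat.zero_le _)
      (fun h => hz (by
        rcases ho with ⟨h2, h3⟩ | ⟨h2, h3⟩
        · rw [← h2] at h
          omega
        · rw [← h3] at h
          omega))
    refine hres.imp_left fun h => ?_
    funext ⟨b, l⟩
    by_cases hl : l = 0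
    · subst hl
      have h1 : proj k b = s b := by rw [h]
      rw [proj_apply, Finset.sum_eq_single 0] at h1
      · rw [h1]
        exact (if_pos rfl).symm
      · intro l _ hl
        by_contra h0
        rcases ((memS _).1 (hk _ h0)).2.2 with h2 | h2
        · exact hl h2.2
        · have h3 : proj k b = 0 := eq_zero_of_colSum (by rw [h2.1, h, hs'])
          rw [proj_apply, Finset.sum_eq_zero_iff] at h3
          simp only at h2
          exact h0 (h3 l (by rw [Finset.mem_range]; omega))
      · simp
    · rw [show k₀ (b, l) = 0 from if_neg hl]
      by_contra h0
      rcases ((memS _).1 (hk _ h0)).2.2 with h2 | h2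
      · exact hl h2.2
      · have h3 : proj k b = 0 := eq_zero_of_colSum (by rw [h2.1, h, hs'])
        rw [proj_apply, Finset.sum_eq_zero_iff] at h3
        simp only at h2
        exact h0 (h3 l (by rw [Finset.mem_range]; omega))

end Relations

/-! ### Dyck paths -/

section Dyck

variable {n m i : ℕ}

theorem IsPath.bounds {p : Finset (PosRoot n)} {a e : ℕ × ℕ} (hp : IsPath p a e) :
    (∀ b ∈ p, a.1 ≤ b.1.1 ∧ b.1.1 ≤ e.1 ∧ a.2 ≤ b.1.2 ∧ b.1.2 ≤ e.2) ∧
      ∀ b ∈ p, ∀ c ∈ p, b.1.1 < c.1.1 → b.1.2 ≤ c.1.2 := by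
  obtain ⟨k, β, rfl, rfl, hs, rfl⟩ := hp
  have mono : ∀ d r, r + d ≤ k → (β r).1.1 ≤ (β (r + d)).1.1 ∧ (β r).1.2 ≤ (β (r + d)).1.2 := by
    intro d
    induction d with
    | zero => exact fun r _ => ⟨le_rfl, le_rfl⟩
    | succ d ih =>
      intro r hr
      obtain ⟨h1, h2⟩ := ih r (by omega)
      rcases hs (r + d) (by omega) with h | h <;> rw [← add_assoc, h] <;> exact ⟨by omega, by omega⟩
  have mono' : ∀ r t, r ≤ t → t ≤ k → (β r).1.1 ≤ (β t).1.1 ∧ (β r).1.2 ≤ (β t).1.2 := by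
    intro r t hrt ht
    have := mono (t - r) r (by omega)
    rwa [show r + (t - r) = t by omega] at this
  simp only [Finset.mem_image, Finset.mem_range]
  refine ⟨?_, ?_⟩
  · rintro _ ⟨r, hr, rfl⟩
    have h1 := mono' 0 r (by omega) (by omega)
    have h2 := mono' r k (by omega) le_rfl
    exact ⟨h1.1, h2.1, h1.2, h2.2⟩
  · rintro _ ⟨r, hr, rfl⟩ _ ⟨t, ht, rfl⟩ hlt
    rcases le_total r t with h | h
    · exact (mono' r t h (by omega)).2
    · exact absurd (mono' t r h (by omega)).1 (by omega)

theorem IsPath.left_mem {p : Finset (PosRoot n)} {a e : ℕ × ℕ} (hp : IsPath p a e) :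
    ∃ b ∈ p, b.1 = a := by
  obtain ⟨k, β, h0, -, -, rfl⟩ := hp
  exact ⟨β 0, Finset.mem_image.2 ⟨0, by simp, rfl⟩, h0⟩

theorem IsPath.right_mem {p : Finset (PosRoot n)} {a e : ℕ × ℕ} (hp : IsPath p a e) :
    ∃ b ∈ p, b.1 = e := by
  obtain ⟨k, β, -, h0, -, rfl⟩ := hp
  exact ⟨β k, Finset.mem_image.2 ⟨k, by simp, rfl⟩, h0⟩

theorem IsPath.chainSupported {p : Finset (PosRoot n)} {a e : ℕ × ℕ} (hp : IsPath p a e)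
    {s : PosRoot n →₀ ℕ} (hs : ∀ b, s b ≠ 0 → b ∈ p) : ChainSupported s := by
  intro b c hb hc h
  have := hp.bounds.2 b (hs b hb) c (hs c hc) h
  have h1 := b.bounds
  have h2 := c.bounds
  omega

theorem fundWeight_coroot_highestRoot (hi : 2 ≤ i) (hin : i ≤ n) :
    fundWeight n i ⬝ᵥ coroot (highestRoot n) = if i = n then 1 else 2 := by
  have e1 : ∀ (k : ℕ) (hk : k < n) (μ : Fin n → ℝ), μ ⬝ᵥ eps n (k + 1) = μ ⟨k, hk⟩ :=
    fun k hk μ => by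
      have : eps n (k + 1) = Pi.single ⟨k, hk⟩ 1 := by
        funext l
        simp [eps, Pi.single_apply, Fin.ext_iff]
      rw [this, dotProduct_single_one]
  have hθ : highestRoot n = eps n (0 + 1) + eps n (1 + 1) := by
    rw [highestRoot, rootVec_of_lt (by omega) (by omega),
      show 2 * n - (2 * n - 1) + 1 = 1 + 1 by omega]
  rw [coroot, dotProduct_smul, hθ]
  simp only [dotProduct_add, e1 0 (by omega), e1 1 (by omega), Pi.add_apply, smul_eq_mul]
  simp only [eps, fundWeight]
  split_ifs <;> first | omega | norm_num

theorem degree_eq_sum_of_support {p : Finset (PosRoot n)} {s : PosRoot n →₀ ℕ}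
    (hs : ∀ b, b ∉ p → s b = 0) : s.degree = ∑ b ∈ p, s b := by
  rw [Finsupp.degree_eq_sum]
  exact (Finset.sum_subset (Finset.subset_univ p) fun b _ hb => hs b hb).symm

end Dyck

/-! ### Dyck relations, straightening and spanning sets -/

section Spanning

variable {n m i : ℕ} {V : Type*} [AddCommGroup V] [Module ℂ V] [LieRingModule (SO n) V]
  [LieModule ℂ (SO n) V] {v : V} {x : PosRoot n → nMinus n}

theorem exists_dyck_relation (hV : IsHighestWeightModule V ((m : ℝ) • fundWeight n i) v)
    (hi : 1 ≤ i) (hin : i ≤ n) (hx : ∀ b, (x b : SO n) ∈ rootSpace (-b.root))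
    (hx0 : ∀ b, x b ≠ 0) {p : Finset (PosRoot n)} {s : PosRoot n →₀ ℕ} (hp : IsDyck i p)
    (hs : ∀ b, b ∉ p → s b = 0) (hd : pathBound m i p < ∑ b ∈ p, (s b : ℝ)) :
    ∃ c : (PosRoot n →₀ ℕ) →₀ ℂ,
      (∀ t ∈ c.support, monoLT t s ∧ ∀ b, ¬ b.MemR i → t b = 0) ∧
      mon s + c.sum (fun t a => a • mon t) ∈ annIdeal v x := by
  classical
  have hsp : ∀ b, s b ≠ 0 → b ∈ p := fun b hb => by
    by_contra h
    exact hb (hs b h)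
  by_cases h1 : IsDyck1 i p
  · have hd' : m < s.degree := by
      rw [pathBound, if_pos h1] at hd
      rw [degree_eq_sum_of_support hs]
      exact_mod_cast hd
    rcases h1 with h | h
    · obtain ⟨b, hb, hbe⟩ := h.right_mem
      have h2 := b.2
      rw [hbe] at h2
      simp only at h2
      -- The path stops at second label `2n-i-1`, so it avoids column `i + 1`. That its endpoint is
      -- a positive root forces `i < n`.
      refine exists_isotropic_relation hV hi (by omega) hx hx0 (o := 2 * n + 1 - i) (o' := i + 1)
        (Or.inr ⟨rfl, rfl⟩) (fun c hc => ?_) (h.chainSupported hsp) hd'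
      have h3 := h.bounds.1 c (hsp c hc)
      have h4 := c.bounds
      rw [PosRoot.MemR]
      simp only at h3
      omega
    · obtain ⟨b, hb, hbe⟩ := h.right_mem
      have h2 := b.2
      rw [hbe] at h2
      obtain ⟨a, ha, hae⟩ := h.left_mem
      have h5 := (h.bounds.1 a ha)
      rw [hae] at h5
      simp only at h2 h5
      -- The path starts at second label `i + 1`, so it avoids column `2n+1-i`. Here `i < n` follows
      -- from `i + 1 ≤ 2n - i`.
      refine exists_isotropic_relation hV hi (by omega) hx hx0 (o := i + 1) (o' := 2 * n + 1 - i)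
        (Or.inl ⟨rfl, rfl⟩) (fun c hc => ?_) (h.chainSupported hsp) hd'
      have h3 := h.bounds.1 c (hsp c hc)
      have h4 := c.bounds
      rw [PosRoot.MemR]
      simp only at h3
      omega
  · obtain ⟨j, hj, hji, p₁, p₂, hp₁, hp₂, -, rfl⟩ := hp.resolve_left h1
    have hd' : (if i = n then m else 2 * m) < s.degree := by
      rw [pathBound, if_neg h1, fundWeight_coroot_highestRoot (by omega) hin] at hd
      rw [degree_eq_sum_of_support hs]
      have : (((if i = n then m else 2 * m : ℕ)) : ℝ) < ((∑ b ∈ p₁ ∪ p₂, s b : ℕ) : ℝ) := by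
        push_cast
        refine lt_of_eq_of_lt ?_ hd
        split_ifs <;> ring
      exact_mod_cast this
    have hs₁ : ∀ b, s.filter (· ∈ p₁) b ≠ 0 → b ∈ p₁ := fun b hb => by
      by_contra h
      exact hb (Finsupp.filter_apply_neg _ _ h)
    have hs₂ : ∀ b, s.filter (fun b => ¬ b ∈ p₁) b ≠ 0 → b ∈ p₂ := fun b hb => by
      have h : b ∉ p₁ := by
        by_contra h
        exact hb (Finsupp.filter_apply_neg _ _ (not_not.2 h))
      rw [Finsupp.filter_apply_pos (fun b => ¬ b ∈ p₁) s h] at hb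
      exact (Finset.mem_union.1 (hsp b hb)).resolve_left h
    have hsum := Finsupp.filter_add_filter_not s (· ∈ p₁)
    have key := exists_plane_relation hV hin hx hx0 hj hji
      (s₁ := s.filter (· ∈ p₁)) (s₂ := s.filter fun b => ¬ b ∈ p₁) (fun b hb => ?_)
      (fun b hb => ?_) (hp₁.chainSupported hs₁) (hp₂.chainSupported hs₂) (by rwa [hsum])
    · rwa [hsum] at key
    · have h3 := hp₁.bounds.1 b (hs₁ b hb)
      have h4 := b.bounds
      rw [PosRoot.MemR]
      simp only at h3
      omega
    · have h3 := hp₂.bounds.1 b (hs₂ b hb)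
      have h4 := b.bounds
      rw [PosRoot.MemR]
      simp only at h3
      omega

/-- Straightening by well-founded induction: a monomial with a variable outside `R_i⁺` lies in the
annihilator, and one supported on `R_i⁺` that is not a lattice point is congruent to a combination
of smaller monomials. -/
theorem mon_mem_span_sup (hV : IsHighestWeightModule V ((m : ℝ) • fundWeight n i) v)
    (hi : 1 ≤ i) (hin : i ≤ n) (hx : ∀ b, (x b : SO n) ∈ rootSpace (-b.root))
    (hx0 : ∀ b, x b ≠ 0) (t : PosRoot n →₀ ℕ) :
    mon t ∈ Submodule.span ℂ (mon '' latticePoints n m i) ⊔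
      (annIdeal v x).restrictScalars ℂ := by
  classical
  induction t using (monoLT_wellFounded (n := n)).induction with
  | _ t ih =>
    by_cases hR : ∃ b, ¬ b.MemR i ∧ t b ≠ 0
    · obtain ⟨b, hb, htb⟩ := hR
      refine Submodule.mem_sup_right ?_
      have h : Finsupp.single b 1 ≤ t := by
        rw [Finsupp.single_le_iff]
        omega
      have e : mon t = mon (t - Finsupp.single b 1) * MvPolynomial.X b := by
        rw [MvPolynomial.X, MvPolynomial.monomial_mul, one_mul, tsub_add_cancel_of_le h]
      change mon t ∈ annIdeal v x
      rw [e]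
      exact Ideal.mul_mem_left _ _ (X_mem_annIdeal hV hin hx hb)
    push Not at hR
    by_cases hL : t ∈ latticePoints n m i
    · exact Submodule.mem_sup_left (Submodule.subset_span ⟨t, hL, rfl⟩)
    obtain ⟨p, hp, hd⟩ : ∃ p : Finset (PosRoot n), IsDyck i p ∧
        pathBound m i p < ∑ b ∈ p, (t b : ℝ) := by
      by_contra! h
      exact hL ⟨fun b => Nat.cast_nonneg _, fun b hb => by simp [hR b hb], h⟩
    obtain ⟨c, hc, hI⟩ := exists_dyck_relation hV hi hin hx hx0 (s := t.filter (· ∈ p)) hp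
      (fun b hb => Finsupp.filter_apply_neg _ _ hb) (by
        refine lt_of_lt_of_eq hd (Finset.sum_congr rfl fun b hb => ?_)
        rw [Finsupp.filter_apply_pos (· ∈ p) t hb])
    have hsum := Finsupp.filter_add_filter_not t (· ∈ p)
    -- The relation for the part of `t` on the violated path is multiplied by the remaining part
    -- `u`; multiplicativity of the order keeps `t` the leading exponent.
    set u := t.filter fun b => ¬ b ∈ p with hu
    have hI' := Ideal.mul_mem_right (mon u) _ hI
    rw [add_mul, MvPolynomial.monomial_mul, one_mul, hsum] at hI'
    refine (Submodule.add_mem_iff_left _ ?_).1 (Submodule.mem_sup_right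
      (show _ ∈ (annIdeal v x).restrictScalars ℂ from hI'))
    rw [Finsupp.sum, Finset.sum_mul]
    refine Submodule.sum_mem _ fun r hr => ?_
    rw [smul_mul_assoc, MvPolynomial.monomial_mul, one_mul]
    refine Submodule.smul_mem _ _ (ih _ ?_)
    have := monoLT_add_right (hc r hr).1 u
    rwa [hsum] at this

theorem span_mon_sup_annIdeal (hV : IsHighestWeightModule V ((m : ℝ) • fundWeight n i) v)
    (hi : 1 ≤ i) (hin : i ≤ n) (hx : ∀ b, (x b : SO n) ∈ rootSpace (-b.root))
    (hx0 : ∀ b, x b ≠ 0) :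
    Submodule.span ℂ (mon '' latticePoints n m i) ⊔ (annIdeal v x).restrictScalars ℂ = ⊤ := by
  rw [eq_top_iff]
  rintro P -
  rw [MvPolynomial.as_sum P]
  refine Submodule.sum_mem _ fun t _ => ?_
  rw [← mul_one (P.coeff t), ← smul_eq_mul, ← MvPolynomial.smul_monomial]
  exact Submodule.smul_mem _ _ (mon_mem_span_sup hV hi hin hx hx0 t)

/-- The image of a spanning set under a surjection whose kernel contains the annihilator. -/
theorem span_image_latticePoints_eq_top
    (hV : IsHighestWeightModule V ((m : ℝ) • fundWeight n i) v)
    (hi : 1 ≤ i) (hin : i ≤ n) (hx : ∀ b, (x b : SO n) ∈ rootSpace (-b.root))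
    (hx0 : ∀ b, x b ≠ 0) {W : Type*} [AddCommMonoid W] [Module ℂ W]
    (φ : MvPolynomial (PosRoot n) ℂ →ₗ[ℂ] W) (hφ : Function.Surjective φ)
    (hI : ∀ P ∈ annIdeal v x, φ P = 0) :
    Submodule.span ℂ ((fun s => φ (mon s)) '' latticePoints n m i) = ⊤ := by
  have h := congrArg (Submodule.map φ) (span_mon_sup_annIdeal hV hi hin hx hx0)
  rw [Submodule.map_sup, Submodule.map_span, Set.image_image, Submodule.map_top,
    LinearMap.range_eq_top.2 hφ] at h
  rw [← h, eq_comm, sup_eq_left]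
  rintro _ ⟨P, hP, rfl⟩
  rw [hI P hP]
  exact zero_mem _

end Spanning

end PBWTypeB

open PBWTypeB in
theorem mainTheorem4 (n m i : ℕ) (hi : 1 ≤ i) (hin : i ≤ n)
    {V : Type*} [AddCommGroup V] [Module ℂ V] [LieRingModule (SO n) V] [LieModule ℂ (SO n) V]
    (v : V) (hV : IsHighestWeightModule V ((m : ℝ) • fundWeight n i) v)
    (x : PosRoot n → nMinus n) (hx : ∀ b, (x b : SO n) ∈ rootSpace (-b.root)) (hx0 : ∀ b, x b ≠ 0) :
    (∀ (p : Finset (PosRoot n)) (s : PosRoot n →₀ ℕ), IsDyck i p → (∀ b, b ∉ p → s b = 0) →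
      pathBound m i p < ∑ b ∈ p, (s b : ℝ) →
      ∃ c : (PosRoot n →₀ ℕ) →₀ ℂ,
        (∀ t ∈ c.support, monoLT t s ∧ ∀ b, ¬ b.MemR i → t b = 0) ∧
        mon s + c.sum (fun t a => a • mon t) ∈ annIdeal v x) ∧
    Submodule.span ℂ ((fun s => Ideal.Quotient.mk (annIdeal v x) (mon s)) '' latticePoints n m i)
      = ⊤ ∧
    Submodule.span ℂ ((fun s => grRep v x (mon s) (grVec (nMinus n) v)) '' latticePoints n m i)
      = ⊤ := by
  refine ⟨fun p s hp hs hd => exists_dyck_relation hV hi hin hx hx0 hp hs hd, ?_, ?_⟩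
  · exact span_image_latticePoints_eq_top hV hi hin hx hx0
      (Ideal.Quotient.mkₐ ℂ (annIdeal v x)).toLinearMap Ideal.Quotient.mk_surjective
      fun P hP => Ideal.Quotient.eq_zero_iff_mem.2 hP
  · let φ : MvPolynomial (PosRoot n) ℂ →ₗ[ℂ] Gr (nMinus n) v :=
      { toFun := fun P => grRep v x P (grVec (nMinus n) v)
        map_add' := fun P Q => by rw [map_add, LinearMap.add_apply]
        map_smul' := fun a P => by rw [map_smul, LinearMap.smul_apply, RingHom.id_apply] }
    exact span_image_latticePoints_eq_top hV hi hin hx hx0 φ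
      (grRep_surjective v x (span_range_rootVectors hx hx0)) fun P hP => hP
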